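/- **Conventions.** For an embedded compact hypersurface $\Sigma\subset\mathbb R^{n+1}$ let $\nu$ be the inward unit normal, $X$ the position vector, and $H$ the mean curvature, i.e. the sum of the principal curvatures, with the sign for which round spheres with inward normal have $H>0$. $\Sigma$ is a $\lambda$-hypersurface if $H+\langle X,\nu\rangle=\lambda$ on $\Sigma$. Write $\mathbb R^{n+1}=\{(x,y):x\in\mathbb R,\ y\in\mathbb R^n\}$; rotationally invariant means invariant under $SO(n)$ acting on $y$. For real $\lambda$ let $R_\lambda=\tfrac12\big(\lambda+\sqrt{\lambda^2+4(n-1)}\big)$, and for $0<\delta<R_\lambda$ let $\Gamma_\delta=(x_\delta,r_\delta,\theta_\delta):[0,S(\delta))\to\{(x,r):r>0\}\times\mathbb R$ be the right maximally extended solution of $$\dot x=\cos\theta,\qquad \dot r=\sin\theta,\qquad \dot\theta=\Big(\frac{n-1}{r}-r\Big)\cos\theta+x\sin\theta+\lambda,\qquad \Gamma_\delta(0)=(0,\delta,0),$$ and let $\gamma_\delta=(x_\delta,r_\delta)$. Let $s_1(\delta)$, $s_3(\delta)$, $s_4(\delta)$ be the first $s\in(0,S(\delta))$ at which, respectively, $\theta_\delta\in\{0,\pi\}$,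 $\theta_\delta\in\{0,\pi/2\}$, $x_\delta=0$; a time that does not exist is set equal to $S(\delta)$. Call $\delta$ of type 1.1, 1.2, 1.3 (with respect to $\lambda$) if $s_3(\delta)<s_1(\delta)$ and, respectively, $s_4(\delta)<s_1(\delta)$, $s_4(\delta)=s_1(\delta)$, $s_4(\delta)>s_1(\delta)$. **Theorem 1.2.** For each integer $n\ge2$ there are constants $c_2(n)>0$ and $\delta_2^*\in(0,\sqrt{n-1})$, depending only on $n$, such that for every $\lambda$ with $-c_2(n)<\lambda<0$ the following holds. The number $\delta_2^*$ is of type 1.3 (in particular $\delta_2^*<R_\lambda$), the set $\{\delta\in(0,\delta_2^*):\delta\text{ is of type }1.1\}$ is non-empty, and its infimum $\delta_{t_1}$ and supremum $\delta_{t_2}$ satisfy $\delta_{t_1}<\delta_{t_2}$ and are both of type 1.2. For $i=1,2$ the curve $\gamma_{\delta_{t_i}}(s)$, $0\le s\le 2s_1(\delta_{t_i})$, is defined and is a smooth simple closed curve in the half plane $r>0$, and $$\Sigma_i=\{(x_{\delta_{t_i}}(s),\,r_{\delta_{t_i}}(s)\,\alpha):0\le s\le 2s_1(\delta_{t_i}),\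 \alpha\in\mathbb S^{n-1}\}\subset\mathbb R^{n+1}$$ is an embedded, rotationally invariant $\lambda$-hypersurface diffeomorphic to $\mathbb S^1\times\mathbb S^{n-1}$. The hypersurfaces $\Sigma_1$ and $\Sigma_2$, with the Riemannian metrics induced from $\mathbb R^{n+1}$, are not isometric to each other. -/

import Mathlib

open scoped Manifold ContDiff Topology

noncomputable section

namespace LambdaHypersurface

/-! ### The manifold `S¹ × Sⁿ⁻¹` and hypersurfaces of `ℝⁿ⁺¹` parametrized by it -/

/-- For `n ≥ 1`, the unit sphere of `ℝⁿ` is a manifold of dimension `n - 1`. -/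
instance factFinrank (n : ℕ) [NeZero n] :
    Fact (Module.finrank ℝ (EuclideanSpace ℝ (Fin n)) = (n - 1) + 1) :=
  ⟨by
    rw [finrank_euclideanSpace_fin]
    have := NeZero.ne n
    omega⟩

/-- The ambient space `ℝⁿ⁺¹`; the coordinate `p 0` is `x`, the other `n` coordinates are `y`. -/
abbrev Ambient (n : ℕ) : Type := EuclideanSpace ℝ (Fin (n + 1))

/-- The manifold `S¹ × Sⁿ⁻¹`. -/
abbrev Torus (n : ℕ) : Type := Circle × Metric.sphere (0 : EuclideanSpace ℝ (Fin n)) 1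

/-- The model with corners of `S¹ × Sⁿ⁻¹` (without boundary, of dimension `1 + (n - 1)`). -/
abbrev torusModel (n : ℕ) := (𝓡 1).prod (𝓡 (n - 1))

variable {n : ℕ} [NeZero n]

/-- `X` is a smooth embedding of `S¹ × Sⁿ⁻¹` into `ℝⁿ⁺¹`: a smooth immersion that is a
homeomorphism onto its image. So the range of `X` is an embedded hypersurface diffeomorphic to
`S¹ × Sⁿ⁻¹`. -/
structure IsTorusEmbedding (X : Torus n → Ambient n) : Prop where
  contMDiff : ContMDiff (torusModel n) 𝓘(ℝ, Ambient n) ∞ X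
  immersion : ∀ p, Function.Injective (mvfderiv (torusModel n) X p)
  embedding : Topology.IsEmbedding X

/-- The points of the complement of `Σ` that lie in a bounded component of the complement. -/
def inside (Sig : Set (Ambient n)) : Set (Ambient n) :=
  {q | q ∉ Sig ∧ Bornology.IsBounded (connectedComponentIn Sigᶜ q)}

/-- `ν` is the smooth inward unit normal vector field along the hypersurface `X`. -/
structure IsInwardUnitNormal (X ν : Torus n → Ambient n) : Prop where
  contMDiff : ContMDiff (torusModel n) 𝓘(ℝ, Ambient n) ∞ ν
  unit : ∀ p, ‖ν p‖ = 1
  normal : ∀ p v, inner ℝ (ν p) (mvfderiv (torusModel n) X p v) = 0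
  inward : ∀ p, ∀ᶠ t : ℝ in 𝓝[>] 0, X p + t • ν p ∈ inside (Set.range X)

/-- `H` is the mean curvature of the hypersurface `X` at `p` with respect to the unit normal field
`ν`: the trace (sum of the principal curvatures) of the shape operator `A`, which is given by the
Weingarten equation `dν = - dX ∘ A`. Round spheres with inward normal have `H > 0`. -/
def HasMeanCurvatureAt (X ν : Torus n → Ambient n) (p : Torus n) (H : ℝ) : Prop :=
  ∃ A : TangentSpace (torusModel n) p →ₗ[ℝ] TangentSpace (torusModel n) p,
    (∀ v, mvfderiv (torusModel n) ν p v = -mvfderiv (torusModel n) X p (A v)) ∧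
      LinearMap.trace ℝ (TangentSpace (torusModel n) p) A = H

/-- `X` is a `λ`-hypersurface: `H + ⟨X, ν⟩ = λ` for the inward unit normal field `ν`. -/
def IsLambdaHypersurface (lam : ℝ) (X : Torus n → Ambient n) : Prop :=
  ∃ ν : Torus n → Ambient n, IsInwardUnitNormal X ν ∧
    ∀ p, ∃ H : ℝ, HasMeanCurvatureAt X ν p H ∧ H + inner ℝ (X p) (ν p) = lam

/-- The hypersurfaces `X₁`, `X₂`, with the Riemannian metrics induced from `ℝⁿ⁺¹`, are isometric:
some diffeomorphism `Φ` satisfies `Φ^* g₂ = g₁`. -/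
def AreIsometric (X₁ X₂ : Torus n → Ambient n) : Prop :=
  ∃ Φ : Diffeomorph (torusModel n) (torusModel n) (Torus n) (Torus n) ∞,
    ∀ p (v w : TangentSpace (torusModel n) p),
      inner ℝ (mvfderiv (torusModel n) (X₂ ∘ Φ) p v) (mvfderiv (torusModel n) (X₂ ∘ Φ) p w) =
        inner ℝ (mvfderiv (torusModel n) X₁ p v) (mvfderiv (torusModel n) X₁ p w)


/-! ### Rotational symmetry -/

/-- The action of `A ∈ SO(n)` on `ℝⁿ⁺¹ = ℝ × ℝⁿ`, `(x, y) ↦ (x, A y)`. -/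
def rotate {n : ℕ} (A : Matrix.specialOrthogonalGroup (Fin n) ℝ) (p : Ambient n) : Ambient n :=
  WithLp.toLp 2 (Fin.cons (p 0)
    (Matrix.mulVec (A : Matrix (Fin n) (Fin n) ℝ) fun i => p i.succ) : Fin (n + 1) → ℝ)

/-- `Σ` is invariant under the action of `SO(n)`. -/
def IsRotationallyInvariant {n : ℕ} (Sig : Set (Ambient n)) : Prop :=
  ∀ A : Matrix.specialOrthogonalGroup (Fin n) ℝ, rotate A '' Sig = Sig

/-- The distance `|y|` of `(x, y)` from the `x`-axis. -/
def axisDist {n : ℕ} (p : Ambient n) : ℝ :=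
  ‖(WithLp.toLp 2 fun i : Fin n => p i.succ : EuclideanSpace ℝ (Fin n))‖

/-! ### Profile curves -/

/-- A curve `s ↦ (x s, r s, θ s)`, `0 ≤ s < S`. The values of the functions outside `[0, S)` play
no role. -/
structure PhaseCurve where
  S : EReal
  x : ℝ → ℝ
  r : ℝ → ℝ
  θ : ℝ → ℝ

/-- `Γ : [0, S) → ℍ × ℝ` solves, with `Γ 0 = (0, δ, 0)`, the system
`x' = cos θ`, `r' = sin θ`, `θ' = ((n - 1) / r - r) cos θ + x sin θ + λ`. -/
structure PhaseCurve.IsSolution (Γ : PhaseCurve) (n : ℕ) (lam δ : ℝ) : Prop where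
  x_zero : Γ.x 0 = 0
  r_zero : Γ.r 0 = δ
  θ_zero : Γ.θ 0 = 0
  r_pos : ∀ s : ℝ, 0 ≤ s → (s : EReal) < Γ.S → 0 < Γ.r s
  x_deriv : ∀ s : ℝ, 0 ≤ s → (s : EReal) < Γ.S →
    HasDerivWithinAt Γ.x (Real.cos (Γ.θ s)) (Set.Ici 0) s
  r_deriv : ∀ s : ℝ, 0 ≤ s → (s : EReal) < Γ.S →
    HasDerivWithinAt Γ.r (Real.sin (Γ.θ s)) (Set.Ici 0) s
  θ_deriv : ∀ s : ℝ, 0 ≤ s → (s : EReal) < Γ.S →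
    HasDerivWithinAt Γ.θ
      ((((n : ℝ) - 1) / Γ.r s - Γ.r s) * Real.cos (Γ.θ s) + Γ.x s * Real.sin (Γ.θ s) + lam)
      (Set.Ici 0) s

/-- `Γ` is the right maximally extended solution `Γ_δ`. -/
def PhaseCurve.IsMaximalSolution (Γ : PhaseCurve) (n : ℕ) (lam δ : ℝ) : Prop :=
  0 < Γ.S ∧ Γ.IsSolution n lam δ ∧ ∀ Γ' : PhaseCurve, Γ'.IsSolution n lam δ → Γ'.S ≤ Γ.S

/-- The first `s` in `(0, S)` with `P s`, and `S` if there is none. -/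
def PhaseCurve.firstTime (Γ : PhaseCurve) (P : ℝ → Prop) : EReal :=
  sInf ({t : EReal | ∃ s : ℝ, 0 < s ∧ (s : EReal) < Γ.S ∧ P s ∧ t = (s : EReal)} ∪ {Γ.S})

/-- The first time at which `θ = 0` or `θ = π`. -/
def PhaseCurve.s₁ (Γ : PhaseCurve) : EReal :=
  Γ.firstTime fun s => Γ.θ s = 0 ∨ Γ.θ s = Real.pi

/-- The first time at which `θ = 0` or `θ = π / 2`. -/
def PhaseCurve.s₃ (Γ : PhaseCurve) : EReal :=
  Γ.firstTime fun s => Γ.θ s = 0 ∨ Γ.θ s = Real.pi / 2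

/-- The first time at which `x = 0`. -/
def PhaseCurve.s₄ (Γ : PhaseCurve) : EReal :=
  Γ.firstTime fun s => Γ.x s = 0

/-- `R_λ`, the radius at which the horizontal line `r = R_λ` is a profile curve. -/
def cylinderRadius (n : ℕ) (lam : ℝ) : ℝ :=
  (lam + Real.sqrt (lam ^ 2 + 4 * ((n : ℝ) - 1))) / 2

/-- `δ ∈ (0, R_λ)` is of type 1.1: `s₃ < s₁` and `s₄ < s₁`. -/
def IsType11 (n : ℕ) (lam δ : ℝ) : Prop :=
  0 < δ ∧ δ < cylinderRadius n lam ∧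
    ∃ Γ : PhaseCurve, Γ.IsMaximalSolution n lam δ ∧ Γ.s₃ < Γ.s₁ ∧ Γ.s₄ < Γ.s₁

/-- `δ ∈ (0, R_λ)` is of type 1.2: `s₃ < s₁` and `s₄ = s₁`. -/
def IsType12 (n : ℕ) (lam δ : ℝ) : Prop :=
  0 < δ ∧ δ < cylinderRadius n lam ∧
    ∃ Γ : PhaseCurve, Γ.IsMaximalSolution n lam δ ∧ Γ.s₃ < Γ.s₁ ∧ Γ.s₄ = Γ.s₁

/-- `δ ∈ (0, R_λ)` is of type 1.3: `s₃ < s₁` and `s₄ > s₁`. -/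
def IsType13 (n : ℕ) (lam δ : ℝ) : Prop :=
  0 < δ ∧ δ < cylinderRadius n lam ∧
    ∃ Γ : PhaseCurve, Γ.IsMaximalSolution n lam δ ∧ Γ.s₃ < Γ.s₁ ∧ Γ.s₁ < Γ.s₄

/-- `γ = (x, r)`, `0 ≤ s ≤ ℓ`, is a smooth simple closed curve in the half plane `r > 0`: `γ` is
injective on `[0, ℓ)`, and at `s = ℓ` the solution returns to its starting point with the tangent
angle increased by `2 π` (so that `γ` is smooth also where it closes up). -/
def PhaseCurve.IsSimpleClosed (Γ : PhaseCurve) (ℓ : ℝ) : Prop :=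
  0 < ℓ ∧ (ℓ : EReal) < Γ.S ∧
    Γ.x ℓ = Γ.x 0 ∧ Γ.r ℓ = Γ.r 0 ∧ Γ.θ ℓ = Γ.θ 0 + 2 * Real.pi ∧
    Set.InjOn (fun s => (Γ.x s, Γ.r s)) (Set.Ico 0 ℓ)

/-- The set `{(x(s), r(s) α) : 0 ≤ s ≤ ℓ, α ∈ Sⁿ⁻¹}` swept out by rotating `γ` about the
`x`-axis. -/
def PhaseCurve.revolution (Γ : PhaseCurve) (ℓ : ℝ) (n : ℕ) : Set (Ambient n) :=
  {p | ∃ s ∈ Set.Icc 0 ℓ, p 0 = Γ.x s ∧ axisDist p = Γ.r s}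

/-- `X` parametrizes an embedded, rotationally invariant `λ`-hypersurface diffeomorphic to
`S¹ × Sⁿ⁻¹` whose profile curve is the simple closed curve `γ_δ(s)`, `0 ≤ s ≤ 2 s₁(δ)`. -/
def IsTorusWithProfile {n : ℕ} [NeZero n] (lam δ : ℝ) (X : Torus n → Ambient n) : Prop :=
  IsTorusEmbedding X ∧ IsLambdaHypersurface lam X ∧ IsRotationallyInvariant (Set.range X) ∧
    ∃ (Γ : PhaseCurve) (L : ℝ), Γ.IsMaximalSolution n lam δ ∧ Γ.s₁ = (L : EReal) ∧
      Γ.IsSimpleClosed (2 * L) ∧ Set.range X = Γ.revolution (2 * L) n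

end LambdaHypersurface

end

open LambdaHypersurface

noncomputable section

namespace LambdaHypersurface

open Set Filter Real

/-! ### The profile curve equation -/

/-! Write `m = n - 1`. The system is invariant under `(x, r, θ) ↦ (-x, r, -θ)` combined with
reversal of time. Hence a curve that starts horizontally on the axis `x = 0` and is next horizontal,
with `θ = π`, again on this axis closes up after reflection. It is simple because `r` is strictly
increasing along its right half. Finding such curves is a shooting problem in `δ`.

Call a curve crossing if `x` returns to `0` while `θ` is still in `(0, π)`; this is type 1.1.
Crossing is an open condition in `(λ, δ)` (`Crosses.persists`). For `λ < 0` a limit of crossing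
curves that does not itself cross must reach `θ = π` exactly at `x = 0` (`turnsAt_of_limit`). So the
endpoints of the set of crossing parameters give closed curves, provided that the following hold.
Some `δs` below the cylinder radius `√m` turns at a point with `x > 0`; this is proved for `λ = 0`
near the cylinder (`exists_turnsAt_near_cylinder`) and persists for small `λ`. For `λ = 0` all small
`δ` cross (`Arc.returning`), so any prescribed small `δ` crosses once `|λ|` is small. For a fixed `λ
< 0` all sufficiently small `δ` fail to cross (`Arc.not_returning`), which keeps the infimum
positive.

Two identities drive the estimates. The curvature `turn`, multiplied by the Gaussian weight, is
monotone on either side of the vertical, and therefore a curve that becomes vertical is convex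
(`turn_pos_of_vertical`). The quantity `r ^ m * exp (-r ^ 2 / 2) * cos θ` has a derivative without
the singular term `m / r`; it controls the slope from the thin neck outwards. For `λ = 0` a
Wronskian argument bounds the curvature from below and shows that the curve does become vertical.

The two tori differ in size. The second parameter stays in a compact range, where the time of
turning is bounded. The first parameter can be forced to be so small that its curve travels
arbitrarily far from the axis before turning (`Arc.far`). An isometry would bound the extrinsic
diameter of the first torus by the intrinsic diameter of the second. -/

/-- The right-hand side of the equation for `θ'`. -/
def turn (m : ℕ) (lam a b t : ℝ) : ℝ := ((m : ℝ) / b - b) * cos t + a * sin t + lam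

/-- The vector field of the profile curve equation. -/
def field (m : ℕ) (lam : ℝ) (p : ℝ × ℝ × ℝ) : ℝ × ℝ × ℝ :=
  (cos p.2.2, sin p.2.2, turn m lam p.1 p.2.1 p.2.2)

/-- Truncation of `x` to `[-B, B]` and of `r` to `[B⁻¹, B]`. -/
def clamp (B : ℝ) (p : ℝ × ℝ × ℝ) : ℝ × ℝ × ℝ :=
  (max (-B) (min B p.1), max B⁻¹ (min B p.2.1), p.2.2)

/-- The truncated field is bounded and globally Lipschitz, so it has global solutions and Gronwall
applies. On curves that stay in `InBox B` it agrees with the original field; existence, uniqueness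
and continuous dependence all pass through it. -/
def clampedField (m : ℕ) (lam B : ℝ) (p : ℝ × ℝ × ℝ) : ℝ × ℝ × ℝ := field m lam (clamp B p)

lemma abs_clamp_sub_le (l u a b : ℝ) : |max l (min u a) - max l (min u b)| ≤ |a - b| := by
  grind

/-- The requirement `1 ≤ K` serves the Gronwall estimate in `continuous_dependence`, where one
divides by `K`. -/
lemma exists_lipschitzWith_clampedField (m : ℕ) (lam : ℝ) {B : ℝ} (hB : 1 ≤ B) :
    ∃ K : NNReal, 1 ≤ K ∧ LipschitzWith K (clampedField m lam B) := by
  have hm : (0 : ℝ) ≤ m := Nat.cast_nonneg m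
  refine ⟨Real.toNNReal (m * B ^ 2 + 1 + (m * B + B) + 1 + B), ?_, ?_⟩
  · rw [← NNReal.coe_le_coe, Real.coe_toNNReal _ (by positivity)]
    push_cast
    nlinarith [mul_nonneg hm (sq_nonneg B), mul_nonneg hm (by linarith : (0 : ℝ) ≤ B)]
  refine LipschitzWith.of_dist_le_mul fun p q => ?_
  rw [Real.coe_toNNReal _ (by positivity)]
  set d := dist p q with hd
  have h1 : |p.1 - q.1| ≤ d := by
    rw [hd, Prod.dist_eq, Real.dist_eq]; exact le_max_left _ _
  have h2 : |p.2.1 - q.2.1| ≤ d := by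
    rw [hd, Prod.dist_eq, Prod.dist_eq, Real.dist_eq, Real.dist_eq]
    exact le_trans (le_max_left _ _) (le_max_right _ _)
  have h3 : |p.2.2 - q.2.2| ≤ d := by
    rw [hd, Prod.dist_eq, Prod.dist_eq, Real.dist_eq, Real.dist_eq, Real.dist_eq]
    exact le_trans (le_max_right _ _) (le_max_right _ _)
  have hd0 : 0 ≤ d := dist_nonneg
  have hc : |cos p.2.2 - cos q.2.2| ≤ d := (Real.abs_cos_sub_cos_le _ _).trans h3
  have hs : |sin p.2.2 - sin q.2.2| ≤ d := (Real.abs_sin_sub_sin_le _ _).trans h3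
  have hB0 : 0 < B := by linarith
  have hBi : B⁻¹ ≤ B := (inv_le_one_of_one_le₀ hB).trans hB
  have hL : d ≤ (m * B ^ 2 + 1 + (m * B + B) + 1 + B) * d := by
    have : (0 : ℝ) ≤ m * B ^ 2 + (m * B + B) + 1 + B := by positivity
    nlinarith
  simp only [clampedField, field, clamp, Prod.dist_eq, Real.dist_eq]
  refine max_le (hc.trans hL) (max_le (hs.trans hL) ?_)
  have ha : |max (-B) (min B p.1) - max (-B) (min B q.1)| ≤ d :=
    (abs_clamp_sub_le _ _ _ _).trans h1
  have hb : |max B⁻¹ (min B p.2.1) - max B⁻¹ (min B q.2.1)| ≤ d :=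
    (abs_clamp_sub_le _ _ _ _).trans h2
  have ha' : |max (-B) (min B q.1)| ≤ B := by
    rw [abs_le]; constructor
    · exact le_max_left _ _
    · exact max_le (by linarith) (min_le_left _ _)
  have hb1 : ∀ y, B⁻¹ ≤ max B⁻¹ (min B y) := fun y => le_max_left _ _
  have hb2 : ∀ y, max B⁻¹ (min B y) ≤ B := fun y => max_le hBi (min_le_left _ _)
  have hBi0 : 0 < B⁻¹ := by positivity
  have hinv : ∀ y, (max B⁻¹ (min B y))⁻¹ ≤ B := fun y => by
    have := inv_anti₀ hBi0 (hb1 y)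
    rwa [inv_inv] at this
  generalize max (-B) (min B p.1) = a at *
  generalize max (-B) (min B q.1) = a' at *
  have hbp := hb1 p.2.1
  have hbq := hb1 q.2.1
  have hbp2 := hb2 p.2.1
  have hbq2 := hb2 q.2.1
  have hip := hinv p.2.1
  have hiq := hinv q.2.1
  generalize max B⁻¹ (min B p.2.1) = b at *
  generalize max B⁻¹ (min B q.2.1) = b' at *
  have hb0 : 0 < b := by linarith
  have hb0' : 0 < b' := by linarith
  have e1 : |(m / b - b) - (m / b' - b')| ≤ (m * B ^ 2 + 1) * d := by
    have : (m / b - b) - (m / b' - b') = -((m * (b⁻¹ * b'⁻¹) + 1) * (b - b')) := by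
      field_simp; ring
    rw [this, abs_neg, abs_mul, abs_of_nonneg (by positivity)]
    have : b⁻¹ * b'⁻¹ ≤ B ^ 2 := by
      rw [sq]; exact mul_le_mul hip hiq (by positivity) hB0.le
    gcongr
  have e2 : |m / b' - b'| ≤ m * B + B := by
    refine (abs_sub _ _).trans ?_
    rw [abs_of_nonneg (by positivity), abs_of_pos hb0', div_eq_mul_inv]
    gcongr
  have hcp := Real.abs_cos_le_one p.2.2
  have hsp := Real.abs_sin_le_one p.2.2
  -- One variable is changed at a time; on the truncated range every factor is bounded in terms of
  -- `B`.
  have key : turn m lam a b p.2.2 - turn m lam a' b' q.2.2 =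
      ((m / b - b) - (m / b' - b')) * cos p.2.2 + (m / b' - b') * (cos p.2.2 - cos q.2.2)
        + (a - a') * sin p.2.2 + a' * (sin p.2.2 - sin q.2.2) := by
    simp only [turn]; ring
  rw [key]
  refine (abs_add_le _ _).trans ?_
  refine (add_le_add ((abs_add_le _ _).trans (add_le_add (abs_add_le _ _) le_rfl)) le_rfl).trans ?_
  simp only [abs_mul]
  have t1 := mul_le_mul e1 hcp (abs_nonneg _) (by positivity)
  have t2 := mul_le_mul e2 hc (abs_nonneg _) (by positivity)
  have t3 := mul_le_mul ha hsp (abs_nonneg _) hd0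
  have t4 := mul_le_mul ha' hs (abs_nonneg _) hB0.le
  linarith

lemma exists_norm_clampedField_le (m : ℕ) (lam : ℝ) {B : ℝ} (hB : 1 ≤ B) :
    ∃ C : NNReal, ∀ p, ‖clampedField m lam B p‖ ≤ C := by
  have hB0 : 0 < B := by linarith
  have hBi : B⁻¹ ≤ B := (inv_le_one_of_one_le₀ hB).trans hB
  refine ⟨Real.toNNReal (1 + (m * B + B) + B + |lam|), fun p => ?_⟩
  rw [Real.coe_toNNReal _ (by positivity)]
  have hpos : (0 : ℝ) ≤ (m * B + B) + B + |lam| := by positivity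
  have hc := Real.abs_cos_le_one p.2.2
  have hs := Real.abs_sin_le_one p.2.2
  simp only [clampedField, field, clamp, Prod.norm_def, Real.norm_eq_abs]
  refine max_le (by linarith) (max_le (by linarith) ?_)
  have ha : |max (-B) (min B p.1)| ≤ B := by
    rw [abs_le]
    exact ⟨le_max_left _ _, max_le (by linarith) (min_le_left _ _)⟩
  have hb1 : B⁻¹ ≤ max B⁻¹ (min B p.2.1) := le_max_left _ _
  have hb2 : max B⁻¹ (min B p.2.1) ≤ B := max_le hBi (min_le_left _ _)
  have hBi0 : 0 < B⁻¹ := by positivity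
  have hi := inv_anti₀ hBi0 hb1
  rw [inv_inv] at hi
  generalize max (-B) (min B p.1) = a at *
  generalize max B⁻¹ (min B p.2.1) = b at *
  have hb0 : 0 < b := by linarith
  have e2 : |m / b - b| ≤ m * B + B := by
    refine (abs_sub _ _).trans ?_
    rw [abs_of_nonneg (by positivity), abs_of_pos hb0, div_eq_mul_inv]
    gcongr
  rw [turn]
  refine (abs_add_le _ _).trans ?_
  refine (add_le_add (abs_add_le _ _) le_rfl).trans ?_
  simp only [abs_mul]
  have t1 := mul_le_mul e2 hc (abs_nonneg _) (by positivity)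
  have t2 := mul_le_mul ha hs (abs_nonneg _) hB0.le
  linarith

/-- A bounded Lipschitz vector field has global integral curves. -/
theorem exists_global_solution {E : Type*} [NormedAddCommGroup E] [NormedSpace ℝ E]
    [CompleteSpace E] {v : E → E} {K C : NNReal} (hv : LipschitzWith K v)
    (hC : ∀ p, ‖v p‖ ≤ C) (p₀ : E) :
    ∃ Z : ℝ → E, Z 0 = p₀ ∧ ∀ t, HasDerivAt Z (v (Z t)) t := by
  have hloc : ∀ N : ℕ, ∃ α : ℝ → E, α 0 = p₀ ∧
      ∀ t ∈ Ioo (-((N : ℝ) + 1)) (N + 1), HasDerivAt α (v (α t)) t := by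
    intro N
    have h0 : (0 : ℝ) ∈ Icc (-((N : ℝ) + 1)) (N + 1) := by constructor <;> linarith [N.cast_nonneg (α := ℝ)]
    have hp : IsPicardLindelof (fun _ => v) (⟨0, h0⟩ : Icc (-((N : ℝ) + 1)) (N + 1)) p₀
        (C * (N + 1)) 0 C K :=
      { lipschitzOnWith := fun _ _ => hv.lipschitzOnWith
        continuousOn := fun _ _ => continuousOn_const
        norm_le := fun _ _ x _ => hC x
        mul_max_le := by simp }
    obtain ⟨α, h1, h2⟩ := hp.exists_eq_forall_mem_Icc_hasDerivWithinAt₀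
    exact ⟨α, h1, fun t ht => (h2 t (Ioo_subset_Icc_self ht)).hasDerivAt (Icc_mem_nhds ht.1 ht.2)⟩
  choose α hα0 hα using hloc
  have hagree : ∀ N M : ℕ, N ≤ M → EqOn (α N) (α M) (Ioo (-((N : ℝ) + 1)) (N + 1)) := by
    intro N M hNM
    have hNM' : (N : ℝ) ≤ M := by exact_mod_cast hNM
    refine ODE_solution_unique_of_mem_Ioo (v := fun _ => v) (s := fun _ => univ) (K := K)
      (t₀ := 0) (fun _ _ => hv.lipschitzOnWith) ?_ (fun t ht => ⟨hα N t ht, trivial⟩)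
      (fun t ht => ⟨hα M t ⟨by linarith [ht.1], by linarith [ht.2]⟩, trivial⟩)
      ((hα0 N).trans (hα0 M).symm)
    constructor <;> linarith [N.cast_nonneg (α := ℝ)]
  -- The solution with index `N` lives on radius `N + 1`, so `t` is an interior point of the
  -- interval belonging to `⌈|t|⌉₊`, and near `t` one fixed index can be used instead.
  refine ⟨fun t => α ⌈|t|⌉₊ t, by simp [hα0], fun t => ?_⟩
  have hev : (fun t => α ⌈|t|⌉₊ t) =ᶠ[𝓝 t] α (⌈|t|⌉₊ + 1) := by
    have : ∀ᶠ t' in 𝓝 t, |t'| < |t| + 1 :=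
      (continuous_abs.tendsto t).eventually (gt_mem_nhds (by linarith))
    filter_upwards [this] with t' ht'
    refine hagree _ _ ?_ ?_
    · refine Nat.ceil_le.2 ?_
      push_cast
      linarith [Nat.le_ceil |t|]
    · have := Nat.le_ceil |t'|
      constructor <;> linarith [neg_abs_le t', le_abs_self t']
  have hmem : t ∈ Ioo (-(((⌈|t|⌉₊ + 1 : ℕ) : ℝ) + 1)) ((⌈|t|⌉₊ + 1 : ℕ) + 1) := by
    have := Nat.le_ceil |t|
    push_cast
    constructor <;> linarith [neg_abs_le t, le_abs_self t]
  have := (hα _ t hmem).congr_of_eventuallyEq hev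
  rwa [← hev.eq_of_nhds] at this

lemma exists_clamped_solution (m : ℕ) (lam : ℝ) {B : ℝ} (hB : 1 ≤ B) (p₀ : ℝ × ℝ × ℝ) :
    ∃ Z : ℝ → ℝ × ℝ × ℝ, Z 0 = p₀ ∧ ∀ t, HasDerivAt Z (clampedField m lam B (Z t)) t := by
  obtain ⟨K, -, hK⟩ := exists_lipschitzWith_clampedField m lam hB
  obtain ⟨C, hC⟩ := exists_norm_clampedField_le m lam hB
  exact exists_global_solution hK hC p₀

/-- The state lies strictly inside the region where truncation has no effect. -/
def InBox (B : ℝ) (p : ℝ × ℝ × ℝ) : Prop := |p.1| < B ∧ B⁻¹ < p.2.1 ∧ p.2.1 < B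

lemma clamp_eq_of_inBox {B : ℝ} {p : ℝ × ℝ × ℝ} (h : InBox B p) : clamp B p = p := by
  obtain ⟨h1, h2, h3⟩ := h
  rw [abs_lt] at h1
  simp only [clamp]
  rw [min_eq_right h1.2.le, max_eq_right h1.1.le, min_eq_right h3.le, max_eq_right h2.le]

lemma isOpen_inBox (B : ℝ) : IsOpen {p | InBox B p} := by
  have h1 : IsOpen {p : ℝ × ℝ × ℝ | |p.1| < B} := isOpen_lt (by fun_prop) continuous_const
  have h2 : IsOpen {p : ℝ × ℝ × ℝ | B⁻¹ < p.2.1} := isOpen_lt continuous_const (by fun_prop)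
  have h3 : IsOpen {p : ℝ × ℝ × ℝ | p.2.1 < B} := isOpen_lt (by fun_prop) continuous_const
  exact h1.inter (h2.inter h3)

/-- `(x, r, θ)` solves the profile curve equation on `[0, T]`, with initial value `(0, δ, 0)`. -/
structure Traj (m : ℕ) (lam δ T : ℝ) (x r θ : ℝ → ℝ) : Prop where
  x_zero : x 0 = 0
  r_zero : r 0 = δ
  θ_zero : θ 0 = 0
  r_pos : ∀ s ∈ Icc 0 T, 0 < r s
  dx : ∀ s ∈ Icc 0 T, HasDerivWithinAt x (cos (θ s)) (Ici 0) s
  dr : ∀ s ∈ Icc 0 T, HasDerivWithinAt r (sin (θ s)) (Ici 0) s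
  dθ : ∀ s ∈ Icc 0 T, HasDerivWithinAt θ (turn m lam (x s) (r s) (θ s)) (Ici 0) s

namespace Traj

variable {m : ℕ} {lam δ T : ℝ} {x r θ : ℝ → ℝ}

lemma mono (h : Traj m lam δ T x r θ) {T' : ℝ} (hT : T' ≤ T) : Traj m lam δ T' x r θ where
  x_zero := h.x_zero
  r_zero := h.r_zero
  θ_zero := h.θ_zero
  r_pos s hs := h.r_pos s ⟨hs.1, hs.2.trans hT⟩
  dx s hs := h.dx s ⟨hs.1, hs.2.trans hT⟩
  dr s hs := h.dr s ⟨hs.1, hs.2.trans hT⟩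
  dθ s hs := h.dθ s ⟨hs.1, hs.2.trans hT⟩

lemma continuousOn_x (h : Traj m lam δ T x r θ) : ContinuousOn x (Icc 0 T) := fun s hs =>
  (h.dx s hs).continuousWithinAt.mono Icc_subset_Ici_self

lemma continuousOn_r (h : Traj m lam δ T x r θ) : ContinuousOn r (Icc 0 T) := fun s hs =>
  (h.dr s hs).continuousWithinAt.mono Icc_subset_Ici_self

lemma continuousOn_θ (h : Traj m lam δ T x r θ) : ContinuousOn θ (Icc 0 T) := fun s hs =>
  (h.dθ s hs).continuousWithinAt.mono Icc_subset_Ici_self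

lemma continuousOn_turn (h : Traj m lam δ T x r θ) :
    ContinuousOn (fun s => turn m lam (x s) (r s) (θ s)) (Icc 0 T) := by
  have h1 := h.continuousOn_x
  have h2 := h.continuousOn_r
  have h3 := h.continuousOn_θ
  have h4 : ContinuousOn (fun s => (m : ℝ) / r s) (Icc 0 T) :=
    continuousOn_const.div h2 fun s hs => (h.r_pos s hs).ne'
  have h5 : ContinuousOn (fun s => cos (θ s)) (Icc 0 T) := continuous_cos.comp_continuousOn h3
  have h6 : ContinuousOn (fun s => sin (θ s)) (Icc 0 T) := continuous_sin.comp_continuousOn h3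
  exact (((h4.sub h2).mul h5).add (h1.mul h6)).add continuousOn_const

lemma exists_box (h : Traj m lam δ T x r θ) :
    ∃ B₀ : ℝ, 1 ≤ B₀ ∧ ∀ B, B₀ ≤ B → ∀ s ∈ Icc 0 T, InBox B (x s, r s, θ s) := by
  rcases (Icc (0 : ℝ) T).eq_empty_or_nonempty with he | hne
  · exact ⟨1, le_rfl, fun B _ s hs => by rw [he] at hs; exact hs.elim⟩
  obtain ⟨b, hb, hbm⟩ := isCompact_Icc.exists_isMinOn hne h.continuousOn_r
  obtain ⟨C₁, hC₁⟩ := isCompact_Icc.exists_bound_of_continuousOn h.continuousOn_x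
  obtain ⟨C₂, hC₂⟩ := isCompact_Icc.exists_bound_of_continuousOn h.continuousOn_r
  have hb0 := h.r_pos b hb
  refine ⟨1 + |C₁| + |C₂| + (r b)⁻¹, by have := inv_pos.2 hb0; linarith [abs_nonneg C₁, abs_nonneg C₂],
    fun B hB s hs => ?_⟩
  have hi := inv_pos.2 hb0
  have a1 := abs_nonneg C₁
  have a2 := abs_nonneg C₂
  have h1 := hC₁ s hs
  have h2 := hC₂ s hs
  rw [Real.norm_eq_abs] at h1 h2
  refine ⟨by linarith [le_abs_self C₁], ?_, by linarith [le_abs_self C₂, le_abs_self (r s)]⟩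
  have h3 : r b ≤ r s := hbm hs
  refine lt_of_lt_of_le ?_ h3
  rw [inv_lt_comm₀ (by linarith) hb0]
  linarith

lemma hasDerivWithinAt_state (h : Traj m lam δ T x r θ) {B : ℝ} {s : ℝ} (hs : s ∈ Icc 0 T)
    (hB : InBox B (x s, r s, θ s)) :
    HasDerivWithinAt (fun s => (x s, r s, θ s)) (clampedField m lam B (x s, r s, θ s)) (Ici 0) s := by
  rw [clampedField, clamp_eq_of_inBox hB]
  exact (h.dx s hs).prodMk ((h.dr s hs).prodMk (h.dθ s hs))

lemma continuousOn_state (h : Traj m lam δ T x r θ) :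
    ContinuousOn (fun s => (x s, r s, θ s)) (Icc 0 T) :=
  h.continuousOn_x.prodMk (h.continuousOn_r.prodMk h.continuousOn_θ)

lemma eqOn_clamped (h : Traj m lam δ T x r θ) {B : ℝ} (hB : 1 ≤ B)
    (hbox : ∀ s ∈ Icc 0 T, InBox B (x s, r s, θ s)) {Z : ℝ → ℝ × ℝ × ℝ} (hZ0 : Z 0 = (0, δ, 0))
    (hZ : ∀ t, HasDerivAt Z (clampedField m lam B (Z t)) t) :
    EqOn (fun s => (x s, r s, θ s)) Z (Icc 0 T) := by
  obtain ⟨K, -, hK⟩ := exists_lipschitzWith_clampedField m lam hB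
  refine ODE_solution_unique (v := fun _ => clampedField m lam B) (K := K) (fun _ => hK)
    h.continuousOn_state
    (fun t ht => (h.hasDerivWithinAt_state (Ico_subset_Icc_self ht)
      (hbox t (Ico_subset_Icc_self ht))).mono (Ici_subset_Ici.2 ht.1))
    (fun t _ => (hZ t).continuousAt.continuousWithinAt)
    (fun t _ => (hZ t).hasDerivWithinAt) ?_
  simp [h.x_zero, h.r_zero, h.θ_zero, hZ0]

lemma of_clamped {B : ℝ} (hB : 1 ≤ B) {Z : ℝ → ℝ × ℝ × ℝ} (hZ0 : Z 0 = (0, δ, 0))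
    (hZ : ∀ t, HasDerivAt Z (clampedField m lam B (Z t)) t)
    (hbox : ∀ s ∈ Icc 0 T, InBox B (Z s)) :
    Traj m lam δ T (fun s => (Z s).1) (fun s => (Z s).2.1) (fun s => (Z s).2.2) := by
  have hd : ∀ s ∈ Icc 0 T, HasDerivAt Z (field m lam (Z s)) s := fun s hs => by
    have := hZ s
    rwa [clampedField, clamp_eq_of_inBox (hbox s hs)] at this
  have h2 : ∀ s ∈ Icc 0 T, HasDerivAt (fun s => (Z s).2) (field m lam (Z s)).2 s :=
    fun s hs => (ContinuousLinearMap.snd ℝ ℝ (ℝ × ℝ)).hasFDerivAt.comp_hasDerivAt s (hd s hs)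
  exact
  { x_zero := by simp [hZ0]
    r_zero := by simp [hZ0]
    θ_zero := by simp [hZ0]
    r_pos := fun s hs => lt_trans (by positivity) (hbox s hs).2.1
    dx := fun s hs => by
      have := ((ContinuousLinearMap.fst ℝ ℝ (ℝ × ℝ)).hasFDerivAt.comp_hasDerivAt s (hd s hs))
      exact this.hasDerivWithinAt
    dr := fun s hs => by
      have := ((ContinuousLinearMap.fst ℝ ℝ ℝ).hasFDerivAt.comp_hasDerivAt s (h2 s hs))
      exact this.hasDerivWithinAt
    dθ := fun s hs => by
      have := ((ContinuousLinearMap.snd ℝ ℝ ℝ).hasFDerivAt.comp_hasDerivAt s (h2 s hs))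
      exact this.hasDerivWithinAt }

lemma eqOn (h : Traj m lam δ T x r θ) {x' r' θ' : ℝ → ℝ} (h' : Traj m lam δ T x' r' θ') :
    EqOn (fun s => (x s, r s, θ s)) (fun s => (x' s, r' s, θ' s)) (Icc 0 T) := by
  obtain ⟨B₁, hB₁, hb₁⟩ := h.exists_box
  obtain ⟨B₂, hB₂, hb₂⟩ := h'.exists_box
  have hB : 1 ≤ max B₁ B₂ := hB₁.trans (le_max_left _ _)
  obtain ⟨Z, hZ0, hZ⟩ := exists_clamped_solution m lam hB (0, δ, 0)
  exact (h.eqOn_clamped hB (hb₁ _ (le_max_left _ _)) hZ0 hZ).trans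
    (h'.eqOn_clamped hB (hb₂ _ (le_max_right _ _)) hZ0 hZ).symm

lemma exists_extension_of_clamped {B : ℝ} (hB : 1 ≤ B) {Z : ℝ → ℝ × ℝ × ℝ} (hZ0 : Z 0 = (0, δ, 0))
    (hZ : ∀ t, HasDerivAt Z (clampedField m lam B (Z t)) t)
    (hbox : ∀ s ∈ Icc 0 T, InBox B (Z s)) (hT : 0 ≤ T) :
    ∃ T' > T, Traj m lam δ T' (fun s => (Z s).1) (fun s => (Z s).2.1) (fun s => (Z s).2.2) := by
  have hc : Continuous Z := continuous_iff_continuousAt.2 fun t => (hZ t).continuousAt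
  have hop : IsOpen {s | InBox B (Z s)} := (isOpen_inBox B).preimage hc
  obtain ⟨ε, hε, hball⟩ := Metric.isOpen_iff.1 hop T (hbox T ⟨hT, le_rfl⟩)
  refine ⟨T + ε / 2, by linarith, of_clamped hB hZ0 hZ fun s hs => ?_⟩
  rcases le_or_gt s T with hsT | hsT
  · exact hbox s ⟨hs.1, hsT⟩
  · refine hball ?_
    rw [Metric.mem_ball, Real.dist_eq, abs_of_pos (by linarith)]
    linarith [hs.2]

/-- A compact piece of a solution lies in an open box, and the global truncated solution continuing
it stays there slightly longer. This is why a solution on the closed interval `[0, T]` gives the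
strict inequality `T < S` for the maximal one. -/
lemma exists_extension (h : Traj m lam δ T x r θ) (hT : 0 ≤ T) :
    ∃ T' > T, ∃ x' r' θ' : ℝ → ℝ, Traj m lam δ T' x' r' θ' := by
  obtain ⟨B, hB, hb⟩ := h.exists_box
  obtain ⟨Z, hZ0, hZ⟩ := exists_clamped_solution m lam hB (0, δ, 0)
  have heq := h.eqOn_clamped hB (hb B le_rfl) hZ0 hZ
  obtain ⟨T', hT', hZ'⟩ := exists_extension_of_clamped hB hZ0 hZ
    (fun s hs => by rw [← heq hs]; exact hb B le_rfl s hs) hT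
  exact ⟨T', hT', _, _, _, hZ'⟩

lemma isSolution (h : Traj m lam δ T x r θ) :
    (PhaseCurve.mk (T : EReal) x r θ).IsSolution (m + 1) lam δ where
  x_zero := h.x_zero
  r_zero := h.r_zero
  θ_zero := h.θ_zero
  r_pos s h0 hs := h.r_pos s ⟨h0, (EReal.coe_lt_coe_iff.1 hs).le⟩
  x_deriv s h0 hs := h.dx s ⟨h0, (EReal.coe_lt_coe_iff.1 hs).le⟩
  r_deriv s h0 hs := h.dr s ⟨h0, (EReal.coe_lt_coe_iff.1 hs).le⟩
  θ_deriv s h0 hs := by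
    have := h.dθ s ⟨h0, (EReal.coe_lt_coe_iff.1 hs).le⟩
    simpa [turn] using this

end Traj

namespace PhaseCurve

variable {m : ℕ} {lam δ T : ℝ} {Γ : PhaseCurve}

lemma IsSolution.traj (h : Γ.IsSolution (m + 1) lam δ) (hT : (T : EReal) < Γ.S) :
    Traj m lam δ T Γ.x Γ.r Γ.θ := by
  have hlt : ∀ s ∈ Icc 0 T, (s : EReal) < Γ.S := fun s hs =>
    (EReal.coe_le_coe_iff.2 hs.2).trans_lt hT
  exact
  { x_zero := h.x_zero
    r_zero := h.r_zero
    θ_zero := h.θ_zero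
    r_pos := fun s hs => h.r_pos s hs.1 (hlt s hs)
    dx := fun s hs => h.x_deriv s hs.1 (hlt s hs)
    dr := fun s hs => h.r_deriv s hs.1 (hlt s hs)
    dθ := fun s hs => by
      have := h.θ_deriv s hs.1 (hlt s hs)
      simpa [turn] using this }

lemma IsMaximalSolution.traj (h : Γ.IsMaximalSolution (m + 1) lam δ) (hT : (T : EReal) < Γ.S) :
    Traj m lam δ T Γ.x Γ.r Γ.θ := h.2.1.traj hT

lemma IsMaximalSolution.lt_S (h : Γ.IsMaximalSolution (m + 1) lam δ) {x r θ : ℝ → ℝ}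
    (ht : Traj m lam δ T x r θ) (hT : 0 ≤ T) : (T : EReal) < Γ.S := by
  obtain ⟨T', hT', x', r', θ', ht'⟩ := ht.exists_extension hT
  exact (EReal.coe_lt_coe_iff.2 hT').trans_le (h.2.2 _ ht'.isSolution)

lemma IsMaximalSolution.eq_of_traj (h : Γ.IsMaximalSolution (m + 1) lam δ) {x r θ : ℝ → ℝ}
    (ht : Traj m lam δ T x r θ) {s : ℝ} (hs : s ∈ Icc 0 T) :
    Γ.x s = x s ∧ Γ.r s = r s ∧ Γ.θ s = θ s := by
  have := (h.traj (h.lt_S ht (hs.1.trans hs.2))).eqOn ht hs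
  simpa using this

lemma IsMaximalSolution.pos (h : Γ.IsMaximalSolution (m + 1) lam δ) : 0 < δ := by
  have := h.2.1.r_pos 0 le_rfl (by simpa using h.1)
  rwa [h.2.1.r_zero] at this

theorem exists_isMaximalSolution (m : ℕ) (lam : ℝ) {δ : ℝ} (hδ : 0 < δ) :
    ∃ Γ : PhaseCurve, Γ.IsMaximalSolution (m + 1) lam δ := by
  classical
  set A : Set PhaseCurve := {Γ | Γ.IsSolution (m + 1) lam δ} with hA
  have huniq : ∀ Γ₁ ∈ A, ∀ Γ₂ ∈ A, ∀ s : ℝ, 0 ≤ s → (s : EReal) < Γ₁.S → (s : EReal) < Γ₂.S →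
      Γ₁.x s = Γ₂.x s ∧ Γ₁.r s = Γ₂.r s ∧ Γ₁.θ s = Γ₂.θ s := by
    intro Γ₁ h₁ Γ₂ h₂ s hs hs₁ hs₂
    simpa using (IsSolution.traj h₁ hs₁).eqOn (IsSolution.traj h₂ hs₂) ⟨hs, le_rfl⟩
  have hex : ∀ s : ℝ, (s : EReal) < sSup (PhaseCurve.S '' A) → ∃ Γ ∈ A, (s : EReal) < Γ.S := by
    intro s hs
    obtain ⟨_, ⟨Γ, hΓ, rfl⟩, h⟩ := lt_sSup_iff.1 hs
    exact ⟨Γ, hΓ, h⟩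
  -- At each time some solution living beyond it is chosen; by uniqueness the choice is immaterial.
  -- The default value occurs only at times that no solution passes.
  let c : ℝ → PhaseCurve := fun s => if h : ∃ Γ ∈ A, (s : EReal) < Γ.S then h.choose else ⟨0, 0, 0, 0⟩
  have hc : ∀ s : ℝ, ∀ Γ ∈ A, 0 ≤ s → (s : EReal) < Γ.S →
      (c s).x s = Γ.x s ∧ (c s).r s = Γ.r s ∧ (c s).θ s = Γ.θ s := by
    intro s Γ hΓ hs hsΓ
    have h : ∃ Γ ∈ A, (s : EReal) < Γ.S := ⟨Γ, hΓ, hsΓ⟩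
    have hcs : c s = h.choose := dif_pos h
    rw [hcs]
    exact huniq _ h.choose_spec.1 _ hΓ s hs h.choose_spec.2 hsΓ
  let Γ : PhaseCurve := ⟨sSup (PhaseCurve.S '' A), fun s => (c s).x s, fun s => (c s).r s,
    fun s => (c s).θ s⟩
  obtain ⟨B, hB, hBδ⟩ : ∃ B : ℝ, 1 ≤ B ∧ InBox B (0, δ, 0) := by
    have hi := inv_pos.2 hδ
    refine ⟨1 + δ + δ⁻¹, by linarith, ?_, ?_, ?_⟩
    · simp only [abs_zero]; linarith
    · show _ < δ
      rw [inv_lt_comm₀ (by linarith) hδ]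
      linarith
    · show δ < _
      linarith
  have hpos : 0 < Γ.S := by
    obtain ⟨Z, hZ0, hZ⟩ := exists_clamped_solution m lam hB (0, δ, 0)
    obtain ⟨T', hT', hZ'⟩ := Traj.exists_extension_of_clamped hB hZ0 hZ (T := 0)
      (fun s hs => by
        have : s = 0 := le_antisymm hs.2 hs.1
        rw [this, hZ0]; exact hBδ) le_rfl
    have h1 : (0 : EReal) < (T' : EReal) := by exact_mod_cast hT'
    exact h1.trans_le (le_sSup ⟨_, hZ'.isSolution, rfl⟩)
  have hev : ∀ s : ℝ, ∀ Γ' ∈ A, 0 ≤ s → (s : EReal) < Γ'.S → ∀ᶠ t in 𝓝[Ici 0] s,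
      Γ.x t = Γ'.x t ∧ Γ.r t = Γ'.r t ∧ Γ.θ t = Γ'.θ t := by
    intro s Γ' hΓ' hs hs'
    have h1 : ∀ᶠ t : ℝ in 𝓝[Ici 0] s, (t : EReal) < Γ'.S :=
      (continuous_coe_real_ereal.tendsto s).eventually (gt_mem_nhds hs') |>.filter_mono
        nhdsWithin_le_nhds
    filter_upwards [h1, self_mem_nhdsWithin] with t ht ht0
    exact hc t Γ' hΓ' ht0 ht
  refine ⟨Γ, hpos, ?_, fun Γ' h' => le_sSup ⟨Γ', h', rfl⟩⟩
  obtain ⟨Γ₀, hΓ₀, h0⟩ := hex 0 (by simpa using hpos)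
  have hc0 := hc 0 Γ₀ hΓ₀ le_rfl h0
  refine ⟨hc0.1.trans hΓ₀.x_zero, hc0.2.1.trans hΓ₀.r_zero, hc0.2.2.trans hΓ₀.θ_zero, ?_, ?_, ?_, ?_⟩
  all_goals
    intro s hs hsS
    obtain ⟨Γ', hΓ', hs'⟩ := hex s hsS
    have hcs : Γ.x s = Γ'.x s ∧ Γ.r s = Γ'.r s ∧ Γ.θ s = Γ'.θ s := hc s Γ' hΓ' hs hs'
    have he := hev s Γ' hΓ' hs hs'
  · rw [hcs.2.1]; exact hΓ'.r_pos s hs hs'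
  · rw [hcs.2.2]
    exact (hΓ'.x_deriv s hs hs').congr_of_eventuallyEq (he.mono fun t h => h.1) hcs.1
  · rw [hcs.2.2]
    exact (hΓ'.r_deriv s hs hs').congr_of_eventuallyEq (he.mono fun t h => h.2.1) hcs.2.1
  · rw [hcs.2.2, hcs.1, hcs.2.1]
    exact (hΓ'.θ_deriv s hs hs').congr_of_eventuallyEq (he.mono fun t h => h.2.2) hcs.2.2

end PhaseCurve

/-! ### Monotonicity from one-sided derivatives -/

lemma monotoneOn_of_deriv_nonneg {f f' : ℝ → ℝ} {a b : ℝ} (ha : 0 ≤ a)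
    (hf : ∀ s ∈ Icc a b, HasDerivWithinAt f (f' s) (Ici 0) s)
    (h : ∀ s ∈ Ioo a b, 0 ≤ f' s) : MonotoneOn f (Icc a b) := by
  refine monotoneOn_of_hasDerivWithinAt_nonneg (f' := f') (convex_Icc a b)
    (fun s hs => (hf s hs).continuousWithinAt.mono fun t ht => ha.trans ht.1)
    (fun s hs => ?_) (fun s hs => ?_)
  · exact (hf s (interior_subset hs)).mono fun t ht => ha.trans (interior_subset ht).1
  · rw [interior_Icc] at hs; exact h s hs

lemma antitoneOn_of_deriv_nonpos {f f' : ℝ → ℝ} {a b : ℝ} (ha : 0 ≤ a)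
    (hf : ∀ s ∈ Icc a b, HasDerivWithinAt f (f' s) (Ici 0) s)
    (h : ∀ s ∈ Ioo a b, f' s ≤ 0) : AntitoneOn f (Icc a b) := by
  refine antitoneOn_of_hasDerivWithinAt_nonpos (f' := f') (convex_Icc a b)
    (fun s hs => (hf s hs).continuousWithinAt.mono fun t ht => ha.trans ht.1)
    (fun s hs => ?_) (fun s hs => ?_)
  · exact (hf s (interior_subset hs)).mono fun t ht => ha.trans (interior_subset ht).1
  · rw [interior_Icc] at hs; exact h s hs

lemma strictMonoOn_of_deriv_pos' {f f' : ℝ → ℝ} {a b : ℝ} (ha : 0 ≤ a)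
    (hf : ∀ s ∈ Icc a b, HasDerivWithinAt f (f' s) (Ici 0) s)
    (h : ∀ s ∈ Ioo a b, 0 < f' s) : StrictMonoOn f (Icc a b) := by
  refine strictMonoOn_of_hasDerivWithinAt_pos (f' := f') (convex_Icc a b)
    (fun s hs => (hf s hs).continuousWithinAt.mono fun t ht => ha.trans ht.1)
    (fun s hs => ?_) (fun s hs => ?_)
  · exact (hf s (interior_subset hs)).mono fun t ht => ha.trans (interior_subset ht).1
  · rw [interior_Icc] at hs; exact h s hs

lemma strictAntiOn_of_deriv_neg' {f f' : ℝ → ℝ} {a b : ℝ} (ha : 0 ≤ a)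
    (hf : ∀ s ∈ Icc a b, HasDerivWithinAt f (f' s) (Ici 0) s)
    (h : ∀ s ∈ Ioo a b, f' s < 0) : StrictAntiOn f (Icc a b) := by
  refine strictAntiOn_of_hasDerivWithinAt_neg (f' := f') (convex_Icc a b)
    (fun s hs => (hf s hs).continuousWithinAt.mono fun t ht => ha.trans ht.1)
    (fun s hs => ?_) (fun s hs => ?_)
  · exact (hf s (interior_subset hs)).mono fun t ht => ha.trans (interior_subset ht).1
  · rw [interior_Icc] at hs; exact h s hs

/-! ### A priori bounds, continuation and continuous dependence. -/

namespace Traj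

variable {m : ℕ} {lam δ T : ℝ} {x r θ : ℝ → ℝ}

lemma x_le (h : Traj m lam δ T x r θ) {s : ℝ} (hs : s ∈ Icc 0 T) : x s ≤ s := by
  have := antitoneOn_of_deriv_nonpos (f := fun s => x s - s) le_rfl
    (fun s hs => (h.dx s hs).sub (hasDerivWithinAt_id s _))
    (fun s _ => by linarith [cos_le_one (θ s)]) ⟨le_rfl, hs.1.trans hs.2⟩ hs hs.1
  simp only [h.x_zero] at this
  linarith

lemma neg_le_x (h : Traj m lam δ T x r θ) {s : ℝ} (hs : s ∈ Icc 0 T) : -s ≤ x s := by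
  have := monotoneOn_of_deriv_nonneg (f := fun s => x s + s) le_rfl
    (fun s hs => (h.dx s hs).add (hasDerivWithinAt_id s _))
    (fun s _ => by linarith [neg_one_le_cos (θ s)]) ⟨le_rfl, hs.1.trans hs.2⟩ hs hs.1
  simp only [h.x_zero] at this
  linarith

lemma r_le (h : Traj m lam δ T x r θ) {s : ℝ} (hs : s ∈ Icc 0 T) : r s ≤ δ + s := by
  have := antitoneOn_of_deriv_nonpos (f := fun s => r s - s) le_rfl
    (fun s hs => (h.dr s hs).sub (hasDerivWithinAt_id s _))
    (fun s _ => by linarith [sin_le_one (θ s)]) ⟨le_rfl, hs.1.trans hs.2⟩ hs hs.1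
  simp only [h.r_zero] at this
  linarith

end Traj

namespace PhaseCurve

variable {m : ℕ} {lam δ T : ℝ} {Γ : PhaseCurve}

/-- A maximal solution that stays away from the axis exists for all times. -/
theorem IsMaximalSolution.S_eq_top (h : Γ.IsMaximalSolution (m + 1) lam δ) {ε : ℝ} (hε : 0 < ε)
    (hr : ∀ s : ℝ, 0 ≤ s → (s : EReal) < Γ.S → ε ≤ Γ.r s) : Γ.S = ⊤ := by
  by_contra hne
  obtain ⟨S, hS⟩ : ∃ S : ℝ, Γ.S = S :=
    ⟨Γ.S.toReal, (EReal.coe_toReal hne (h.1.trans_le' bot_le).ne').symm⟩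
  have hS0 : 0 < S := by
    have := h.1
    rw [hS] at this
    exact_mod_cast this
  have hi := inv_pos.2 hε
  have hδ := h.pos
  set B := 1 + δ + S + ε⁻¹ with hBdef
  have hB : 1 ≤ B := by linarith
  have hBε : B⁻¹ < ε := by rw [inv_lt_comm₀ (by linarith) hε]; linarith
  -- If `S` is finite, unit speed bounds `x` and `r` while `ε ≤ r`, so the truncated solution agrees
  -- with `Γ` before `S`. The non-strict bounds survive at time `S` itself, and the solution extends
  -- beyond `S`.
  obtain ⟨Z, hZ0, hZ⟩ := exists_clamped_solution m lam hB (0, δ, 0)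
  have hc : Continuous Z := continuous_iff_continuousAt.2 fun t => (hZ t).continuousAt
  have hlt : ∀ s, s < S → (s : EReal) < Γ.S := fun s hs => by
    rw [hS]; exact_mod_cast hs
  have hbox : ∀ s, 0 ≤ s → s < S → |Γ.x s| ≤ S ∧ ε ≤ Γ.r s ∧ Γ.r s ≤ δ + S := by
    intro s hs hsS
    have ht := h.traj (hlt s hsS)
    have h1 := ht.x_le ⟨hs, le_rfl⟩
    have h2 := ht.neg_le_x ⟨hs, le_rfl⟩
    have h3 := ht.r_le ⟨hs, le_rfl⟩
    exact ⟨abs_le.2 ⟨by linarith, by linarith⟩, hr s hs (hlt s hsS), by linarith⟩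
  have hin : ∀ p : ℝ × ℝ × ℝ, |p.1| ≤ S ∧ ε ≤ p.2.1 ∧ p.2.1 ≤ δ + S → InBox B p := fun p hp =>
    ⟨by linarith [hp.1], by linarith [hp.2.1], by linarith [hp.2.2]⟩
  have heq : ∀ s ∈ Ico 0 S, (Γ.x s, Γ.r s, Γ.θ s) = Z s := fun s hs =>
    (h.traj (hlt s hs.2)).eqOn_clamped hB
      (fun t ht => hin _ (hbox t ht.1 (ht.2.trans_lt hs.2))) hZ0 hZ ⟨hs.1, le_rfl⟩
  have hclosed : IsClosed {s | |(Z s).1| ≤ S ∧ ε ≤ (Z s).2.1 ∧ (Z s).2.1 ≤ δ + S} := by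
    have h1 : IsClosed {s | |(Z s).1| ≤ S} := isClosed_le (by fun_prop) continuous_const
    have h2 : IsClosed {s | ε ≤ (Z s).2.1} := isClosed_le continuous_const (by fun_prop)
    have h3 : IsClosed {s | (Z s).2.1 ≤ δ + S} := isClosed_le (by fun_prop) continuous_const
    exact h1.inter (h2.inter h3)
  have hsub : Icc 0 S ⊆ {s | |(Z s).1| ≤ S ∧ ε ≤ (Z s).2.1 ∧ (Z s).2.1 ≤ δ + S} := by
    rw [← closure_Ico hS0.ne]
    refine closure_minimal (fun s hs => ?_) hclosed
    have := hbox s hs.1 hs.2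
    rw [mem_ofPred_eq, ← heq s hs]
    exact this
  have := h.lt_S (Traj.of_clamped hB hZ0 hZ fun s hs => hin _ (hsub hs)) hS0.le
  rw [hS] at this
  exact lt_irrefl _ this

/-- Solutions depend continuously on `δ` and `λ`, uniformly on compact time intervals. -/
theorem IsMaximalSolution.continuous_dependence (h : Γ.IsMaximalSolution (m + 1) lam δ)
    (hT : (T : EReal) < Γ.S) (hT0 : 0 ≤ T) {η : ℝ} (hη : 0 < η) :
    ∃ ν > 0, ∀ lam' δ' : ℝ, ∀ Γ' : PhaseCurve, |lam' - lam| < ν → |δ' - δ| < ν →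
      Γ'.IsMaximalSolution (m + 1) lam' δ' → (T : EReal) < Γ'.S ∧
        ∀ s ∈ Icc 0 T, |Γ'.x s - Γ.x s| < η ∧ |Γ'.r s - Γ.r s| < η ∧ |Γ'.θ s - Γ.θ s| < η := by
  have ht := h.traj hT
  obtain ⟨B₀, hB₀, hb₀⟩ := ht.exists_box
  set B := B₀ + 1 with hBdef
  have hB : 1 ≤ B := by linarith
  have hbox : ∀ s ∈ Icc 0 T, InBox B (Γ.x s, Γ.r s, Γ.θ s) := fun s hs => hb₀ B (by linarith) s hs
  have hgap : B⁻¹ < B₀⁻¹ := inv_strictAnti₀ (by linarith) (by linarith)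
  -- Besides giving the accuracy `η`, this margin keeps the perturbed curve inside the box `B` when
  -- `Γ` lies in the smaller box `B₀ = B - 1`.
  set μ := min η (min 1 (B₀⁻¹ - B⁻¹)) with hμ
  have hμ0 : 0 < μ := lt_min hη (lt_min one_pos (by linarith))
  have hμ1 : μ ≤ η := min_le_left _ _
  have hμ2 : μ ≤ 1 := (min_le_right _ _).trans (min_le_left _ _)
  have hμ3 : μ ≤ B₀⁻¹ - B⁻¹ := (min_le_right _ _).trans (min_le_right _ _)
  obtain ⟨K, hK1, hK⟩ := exists_lipschitzWith_clampedField m lam hB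
  have hK1' : (1 : ℝ) ≤ K := by exact_mod_cast hK1
  -- The truncated fields for `lam` and `lam'` differ only in the last component, and there by
  -- `|lam' - lam|`. Since `1 ≤ K`, Gronwall bounds the distance by `(|δ' - δ| + |lam' - lam|) * exp
  -- (K * T)`.
  refine ⟨μ / (2 * exp (K * T)), by positivity, fun lam' δ' Γ' hl hd h' => ?_⟩
  obtain ⟨Z, hZ0, hZ⟩ := exists_clamped_solution m lam' hB (0, δ', 0)
  have hdist : ∀ s ∈ Icc 0 T, dist (Z s) (Γ.x s, Γ.r s, Γ.θ s) < μ := by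
    intro s hs
    have hle := dist_le_of_approx_trajectories_ODE (v := fun _ => clampedField m lam B) (K := K)
      (f := Z) (g := fun s => (Γ.x s, Γ.r s, Γ.θ s)) (a := 0) (b := T)
      (f' := fun t => clampedField m lam' B (Z t))
      (g' := fun t => clampedField m lam B (Γ.x t, Γ.r t, Γ.θ t))
      (εf := |lam' - lam|) (εg := 0) (δ := |δ' - δ|) (fun _ => hK)
      (fun t _ => (hZ t).continuousAt.continuousWithinAt)
      (fun t _ => (hZ t).hasDerivWithinAt)
      (fun t _ => by
        simp [clampedField, field, turn, Prod.dist_eq, Real.dist_eq])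
      ht.continuousOn_state
      (fun t ht' => (ht.hasDerivWithinAt_state (Ico_subset_Icc_self ht')
        (hbox t (Ico_subset_Icc_self ht'))).mono (Ici_subset_Ici.2 ht'.1))
      (fun t _ => by rw [dist_self])
      (by simp [hZ0, h.2.1.x_zero, h.2.1.r_zero, h.2.1.θ_zero, Prod.dist_eq, Real.dist_eq])
      s hs
    refine hle.trans_lt ?_
    rw [gronwallBound_of_K_ne_0 (by linarith)]
    simp only [sub_zero, add_zero]
    have hexp : exp (K * s) ≤ exp (K * T) :=
      exp_le_exp.2 (mul_le_mul_of_nonneg_left hs.2 (by linarith))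
    have hexp1 : 1 ≤ exp (K * s) := one_le_exp (mul_nonneg (by linarith) hs.1)
    have hE : 0 < exp (K * T) := exp_pos _
    have a1 : |δ' - δ| * exp (K * s) ≤ |δ' - δ| * exp (K * T) := by gcongr
    have a2 : |lam' - lam| / K * (exp (K * s) - 1) ≤ |lam' - lam| * exp (K * T) := by
      refine mul_le_mul (div_le_self (abs_nonneg _) hK1') (by linarith) (by linarith) (abs_nonneg _)
    rw [lt_div_iff₀ (by positivity)] at hl hd
    nlinarith
  have hcomp : ∀ s ∈ Icc 0 T, |(Z s).1 - Γ.x s| < μ ∧ |(Z s).2.1 - Γ.r s| < μ ∧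
      |(Z s).2.2 - Γ.θ s| < μ := by
    intro s hs
    have := hdist s hs
    simpa [Prod.dist_eq, Real.dist_eq] using this
  have hZbox : ∀ s ∈ Icc 0 T, InBox B (Z s) := by
    intro s hs
    obtain ⟨c1, c2, -⟩ := hcomp s hs
    obtain ⟨b1, b2, b3⟩ := hb₀ B₀ le_rfl s hs
    simp only [abs_lt] at b1 c1 c2
    refine ⟨abs_lt.2 ⟨by linarith, by linarith⟩, ?_, ?_⟩
    · simp only at b2; linarith
    · simp only at b3; linarith
  have htZ := Traj.of_clamped hB hZ0 hZ hZbox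
  refine ⟨h'.lt_S htZ hT0, fun s hs => ?_⟩
  obtain ⟨e1, e2, e3⟩ := h'.eq_of_traj htZ hs
  obtain ⟨c1, c2, c3⟩ := hcomp s hs
  rw [e1, e2, e3]
  exact ⟨by linarith, by linarith, by linarith⟩

end PhaseCurve

end LambdaHypersurface
end

/-! ### Weighted curvature and convex arcs. -/

noncomputable section

namespace LambdaHypersurface

open Set Filter Real

namespace Traj

variable {m : ℕ} {lam δ T : ℝ} {x r θ : ℝ → ℝ}

lemma dcos (h : Traj m lam δ T x r θ) {s : ℝ} (hs : s ∈ Icc 0 T) :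
    HasDerivWithinAt (fun s => cos (θ s)) (-sin (θ s) * turn m lam (x s) (r s) (θ s)) (Ici 0) s :=
  (h.dθ s hs).cos

lemma dsin (h : Traj m lam δ T x r θ) {s : ℝ} (hs : s ∈ Icc 0 T) :
    HasDerivWithinAt (fun s => sin (θ s)) (cos (θ s) * turn m lam (x s) (r s) (θ s)) (Ici 0) s :=
  (h.dθ s hs).sin

/-- The terms `± sin θ cos θ` cancel, leaving a linear first order equation for the curvature whose
integrating factor is `weight`. -/
lemma dturn (h : Traj m lam δ T x r θ) {s : ℝ} (hs : s ∈ Icc 0 T) :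
    HasDerivWithinAt (fun s => turn m lam (x s) (r s) (θ s))
      ((x s * cos (θ s) + r s * sin (θ s) - m * sin (θ s) / r s) * turn m lam (x s) (r s) (θ s)
        - m * sin (θ s) * cos (θ s) / r s ^ 2) (Ici 0) s := by
  have hr := (h.r_pos s hs).ne'
  have h1 := (((((hasDerivWithinAt_const s (Ici 0) (m : ℝ)).div (h.dr s hs) hr).sub (h.dr s hs)).mul
    (h.dcos hs)).add ((h.dx s hs).mul (h.dsin hs))).add_const lam
  refine h1.congr_deriv ?_
  simp only [Pi.sub_apply, Pi.div_apply]
  generalize turn m lam (x s) (r s) (θ s) = k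
  field_simp
  ring

/-- The Gaussian weight `r ^ m exp (-(x² + r²) / 2)`. -/
def weight (m : ℕ) (a b : ℝ) : ℝ := b ^ m * exp (-(a ^ 2 + b ^ 2) / 2)

lemma weight_pos {m : ℕ} {a b : ℝ} (hb : 0 < b) : 0 < weight m a b := by
  unfold weight; positivity

lemma dpow (h : Traj m lam δ T x r θ) {s : ℝ} (hs : s ∈ Icc 0 T) :
    HasDerivWithinAt (fun s => r s ^ m) (r s ^ m * (m * sin (θ s) / r s)) (Ici 0) s := by
  have hr := (h.r_pos s hs).ne'
  refine ((h.dr s hs).pow m).congr_deriv ?_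
  rcases m with _ | m
  · simp
  · simp only [Nat.add_sub_cancel, pow_succ]
    field_simp

lemma dweight (h : Traj m lam δ T x r θ) {s : ℝ} (hs : s ∈ Icc 0 T) :
    HasDerivWithinAt (fun s => weight m (x s) (r s))
      (weight m (x s) (r s) * (m * sin (θ s) / r s - (x s * cos (θ s) + r s * sin (θ s))))
      (Ici 0) s := by
  have h1 : HasDerivWithinAt (fun s => -(x s ^ 2 + r s ^ 2) / 2)
      (-(x s * cos (θ s) + r s * sin (θ s))) (Ici 0) s := by
    refine ((((h.dx s hs).pow 2).add ((h.dr s hs).pow 2)).neg.div_const 2).congr_deriv ?_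
    norm_num; ring
  refine ((h.dpow hs).mul h1.exp).congr_deriv ?_
  unfold weight
  ring

/-- The weighted curvature decreases while `θ < π / 2` and increases while `θ > π / 2`. -/
lemma dweight_mul_turn (h : Traj m lam δ T x r θ) {s : ℝ} (hs : s ∈ Icc 0 T) :
    HasDerivWithinAt (fun s => weight m (x s) (r s) * turn m lam (x s) (r s) (θ s))
      (-(weight m (x s) (r s) * (m * sin (θ s) * cos (θ s) / r s ^ 2))) (Ici 0) s := by
  refine ((h.dweight hs).mul (h.dturn hs)).congr_deriv ?_
  ring

/-- The factor `r ^ m * exp (-r ^ 2 / 2)` is the integrating factor in `r` for the term `(m / r - r)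
cos θ`. What remains has no singularity at the axis, so this quantity controls the slope uniformly
as `δ → 0`. -/
lemma pow_mul_exp_hasDeriv (h : Traj m lam δ T x r θ) {s : ℝ} (hs : s ∈ Icc 0 T) :
    HasDerivWithinAt (fun s => r s ^ m * exp (-(r s) ^ 2 / 2) * cos (θ s))
      (-(r s ^ m * exp (-(r s) ^ 2 / 2) * sin (θ s) * (x s * sin (θ s) + lam))) (Ici 0) s := by
  have hr := (h.r_pos s hs).ne'
  have h1 : HasDerivWithinAt (fun s => -(r s) ^ 2 / 2) (-(r s * sin (θ s))) (Ici 0) s := by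
    refine (((h.dr s hs).pow 2).neg.div_const 2).congr_deriv ?_
    norm_num; ring
  refine (((h.dpow hs).mul h1.exp).mul (h.dcos hs)).congr_deriv ?_
  simp only [Pi.mul_apply]
  unfold turn
  field_simp
  ring

/-- A solution with horizontal curvature vector cannot become vertical: the line `x = -λ` is the only
vertical solution. -/
lemma turn_ne_zero_of_vertical (h : Traj m lam δ T x r θ) {t a : ℝ} (hat : a < t) (ha : 0 ≤ a)
    (ht : t ≤ T) (hθ : θ t = π / 2) (hlt : ∀ s ∈ Ioo a t, θ s ≠ π / 2) : x t + lam ≠ 0 := by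
  intro hx
  obtain ⟨B, hB, hb⟩ := h.exists_box
  obtain ⟨K, -, hK⟩ := exists_lipschitzWith_clampedField m lam hB
  have htm : t ∈ Icc 0 T := ⟨by linarith, ht⟩
  -- The line `x = -λ`, run upwards at unit speed, is a solution with the same state at time `t`.
  -- Backward uniqueness would give `θ = π / 2` shortly before `t`.
  let g : ℝ → ℝ × ℝ × ℝ := fun s => (-lam, r t + (s - t), π / 2)
  have hg : Continuous g := by fun_prop
  have hgt : g t = (x t, r t, θ t) := by
    simp only [g, hθ, sub_self, add_zero]; congr 1; linarith
  have hop : IsOpen {s | InBox B (g s)} := (isOpen_inBox B).preimage hg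
  obtain ⟨ε, hε, hball⟩ := Metric.isOpen_iff.1 hop t
    (by rw [mem_ofPred_eq, hgt]; exact hb B le_rfl t htm)
  set b := max ((a + t) / 2) (t - ε / 2) with hbdef
  have hbt : b < t := max_lt (by linarith) (by linarith)
  have hab : a < b := lt_of_lt_of_le (by linarith) (le_max_left _ _)
  have hbε : t - ε / 2 ≤ b := le_max_right _ _
  have hsub : ∀ s ∈ Icc b t, s ∈ Icc 0 T := fun s hs => ⟨by linarith [hs.1], hs.2.trans ht⟩
  have hgd : ∀ s, HasDerivAt g (0, 1, 0) s := fun s =>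
    (hasDerivAt_const s _).prodMk ((((hasDerivAt_id s).sub_const t).const_add (r t)).prodMk
      (hasDerivAt_const s _))
  have heq := ODE_solution_unique_of_mem_Icc_left (v := fun _ => clampedField m lam B) (K := K)
    (s := fun _ => univ) (a := b) (b := t) (f := fun s => (x s, r s, θ s)) (g := g)
    (fun _ _ => hK.lipschitzOnWith) (h.continuousOn_state.mono hsub)
    (fun s hs => by
      have hs' := hsub s (Ioc_subset_Icc_self hs)
      exact ((h.hasDerivWithinAt_state hs' (hb B le_rfl s hs')).hasDerivAt
        (Ici_mem_nhds (by linarith [hs.1]))).hasDerivWithinAt)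
    (fun _ _ => trivial) hg.continuousOn
    (fun s hs => by
      have hin : InBox B (g s) := hball (by
        rw [Metric.mem_ball, Real.dist_eq, abs_sub_comm, abs_of_nonneg (by linarith [hs.2])]
        linarith [hs.1])
      have : clampedField m lam B (g s) = (0, 1, 0) := by
        rw [clampedField, clamp_eq_of_inBox hin]
        simp [g, field, turn]
      rw [this]
      exact (hgd s).hasDerivWithinAt)
    (fun _ _ => trivial) hgt.symm
  have := heq ⟨le_rfl, hbt.le⟩
  simp only [g, Prod.mk.injEq] at this
  exact hlt b ⟨hab, hbt⟩ this.2.2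

/-- The curvature is positive as long as the curve is a graph over the `r`-axis, provided that it
becomes vertical. -/
theorem turn_pos_of_vertical (h : Traj m lam δ T x r θ) (hm : 1 ≤ m)
    (hθ : ∀ s ∈ Ioo 0 T, θ s ∈ Ioo 0 π) (hv : ∃ t ∈ Icc 0 T, θ t = π / 2) :
    ∀ s ∈ Icc 0 T, 0 < turn m lam (x s) (r s) (θ s) := by
  have hm0 : (0 : ℝ) < m := by exact_mod_cast hm
  obtain ⟨t, ⟨htT, ht⟩, hleast⟩ : ∃ t, IsLeast {t | t ∈ Icc 0 T ∧ θ t = π / 2} t := by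
    refine IsCompact.exists_isLeast ?_ hv
    have := h.continuousOn_θ.preimage_isClosed_of_isClosed isClosed_Icc
      (isClosed_singleton (x := π / 2))
    exact isCompact_Icc.of_isClosed_subset this fun s hs => hs.1
  have hpi := pi_pos
  have ht0 : 0 < t := by
    refine lt_of_le_of_ne htT.1 fun he => ?_
    rw [← he, h.θ_zero] at ht
    linarith
  have hne : ∀ s ∈ Ico 0 t, θ s ≠ π / 2 := fun s hs he =>
    absurd (hleast ⟨⟨hs.1, hs.2.le.trans htT.2⟩, he⟩) (not_le.2 hs.2)
  have hlt : ∀ s ∈ Ico 0 t, θ s < π / 2 := by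
    intro s hs
    by_contra hge
    have hsub : Icc 0 s ⊆ Icc 0 T := Icc_subset_Icc_right (hs.2.le.trans htT.2)
    obtain ⟨u, hu, hu'⟩ := intermediate_value_Icc hs.1 (h.continuousOn_θ.mono hsub)
      (show π / 2 ∈ Icc (θ 0) (θ s) by rw [h.θ_zero]; exact ⟨by linarith, not_lt.1 hge⟩)
    exact hne u ⟨hu.1, hu.2.trans_lt hs.2⟩ hu'
  have hwd := fun s hs => h.dweight_mul_turn (s := s) hs
  have hsub : ∀ s ∈ Icc 0 t, s ∈ Icc 0 T := fun s hs => ⟨hs.1, hs.2.trans htT.2⟩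
  -- Up to the first vertical time `t` the weighted curvature decreases, so positivity at `t` yields
  -- positivity before.
  have hanti : AntitoneOn (fun s => weight m (x s) (r s) * turn m lam (x s) (r s) (θ s))
      (Icc 0 t) := by
    refine antitoneOn_of_deriv_nonpos le_rfl (fun s hs => hwd s (hsub s hs)) fun s hs => ?_
    have hr := h.r_pos s (hsub s (Ioo_subset_Icc_self hs))
    have h1 := hθ s ⟨hs.1, hs.2.trans_le htT.2⟩
    have h2 := hlt s (Ioo_subset_Ico_self hs)
    have h3 : 0 < sin (θ s) := sin_pos_of_mem_Ioo h1
    have h4 : 0 < cos (θ s) := cos_pos_of_mem_Ioo ⟨by linarith [h1.1], h2⟩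
    have := weight_pos (m := m) (a := x s) hr
    simp only [neg_nonpos]
    positivity
  have hkc := h.continuousOn_turn
  -- As `θ < π / 2` before `t`, a negative curvature at `t` would make `θ` decrease to `π / 2`,
  -- which is impossible. The value zero is then excluded by uniqueness.
  have hkt0 : 0 ≤ turn m lam (x t) (r t) (θ t) := by
    by_contra hneg
    rw [not_le] at hneg
    have hev : ∀ᶠ s in 𝓝[Icc 0 T] t, turn m lam (x s) (r s) (θ s) < 0 :=
      (hkc t htT).eventually (gt_mem_nhds hneg)
    obtain ⟨ε, hε, hball⟩ := Metric.mem_nhdsWithin_iff.1 hev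
    have hmem : ∀ s ∈ Icc (max 0 (t - ε / 2)) t, s ∈ Icc 0 T := fun s hs =>
      ⟨(le_max_left _ _).trans hs.1, hs.2.trans htT.2⟩
    have hlt' : max 0 (t - ε / 2) < t := max_lt ht0 (by linarith)
    have := strictAntiOn_of_deriv_neg' (f := θ) (le_max_left 0 (t - ε / 2))
      (fun s hs => h.dθ s (hmem s hs)) (fun s hs => hball ⟨by
        have := (le_max_right 0 (t - ε / 2)).trans hs.1.le
        rw [Metric.mem_ball, Real.dist_eq, abs_sub_comm, abs_of_pos (by linarith [hs.2])]
        linarith, hmem s (Ioo_subset_Icc_self hs)⟩) ⟨le_rfl, hlt'.le⟩ ⟨hlt'.le, le_rfl⟩ hlt'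
    rw [ht] at this
    exact absurd (hlt _ ⟨le_max_left _ _, hlt'⟩) (not_lt.2 this.le)
  have hkt : 0 < turn m lam (x t) (r t) (θ t) := by
    refine lt_of_le_of_ne hkt0 fun he => ?_
    refine h.turn_ne_zero_of_vertical ht0 le_rfl htT.2 ht
      (fun s hs => hne s (Ioo_subset_Ico_self hs)) ?_
    rw [turn, ht] at he
    simpa using he.symm
  have hwt : 0 < weight m (x t) (r t) * turn m lam (x t) (r t) (θ t) :=
    mul_pos (weight_pos (h.r_pos t htT)) hkt
  intro s hs
  rcases le_total s t with hst | hts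
  · have := hanti ⟨hs.1, hst⟩ ⟨ht0.le, le_rfl⟩ hst
    exact pos_of_mul_pos_right (hwt.trans_le this) (weight_pos (h.r_pos s hs)).le
  by_contra hneg
  rw [not_lt] at hneg
  -- Up to the first failure `u` of positivity after `t`, the angle exceeds `π / 2` and the weighted
  -- curvature increases from its positive value at `t`.
  obtain ⟨u, ⟨huT, hu⟩, huleast⟩ :
      ∃ u, IsLeast {u | u ∈ Icc t T ∧ turn m lam (x u) (r u) (θ u) ≤ 0} u := by
    refine IsCompact.exists_isLeast ?_ ⟨s, ⟨hts, hs.2⟩, hneg⟩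
    have hc : ContinuousOn (fun s => turn m lam (x s) (r s) (θ s)) (Icc t T) :=
      hkc.mono (Icc_subset_Icc_left ht0.le)
    have := hc.preimage_isClosed_of_isClosed isClosed_Icc (isClosed_Iic (a := (0 : ℝ)))
    exact isCompact_Icc.of_isClosed_subset this fun s hs => hs.1
  have htu : t < u := by
    refine lt_of_le_of_ne huT.1 fun he => ?_
    rw [← he] at hu
    linarith
  have hpos : ∀ v ∈ Ico t u, 0 < turn m lam (x v) (r v) (θ v) := fun v hv => by
    by_contra hv'
    exact absurd (huleast ⟨⟨hv.1, hv.2.le.trans huT.2⟩, not_lt.1 hv'⟩) (not_le.2 hv.2)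
  have hsub' : ∀ v ∈ Icc t u, v ∈ Icc 0 T := fun v hv => ⟨ht0.le.trans hv.1, hv.2.trans huT.2⟩
  have hθm := strictMonoOn_of_deriv_pos' (f := θ) ht0.le (fun v hv => h.dθ v (hsub' v hv))
    (fun v hv => hpos v (Ioo_subset_Ico_self hv))
  have hmono : MonotoneOn (fun s => weight m (x s) (r s) * turn m lam (x s) (r s) (θ s))
      (Icc t u) := by
    refine monotoneOn_of_deriv_nonneg ht0.le (fun v hv => hwd v (hsub' v hv)) fun v hv => ?_
    have hr := h.r_pos v (hsub' v (Ioo_subset_Icc_self hv))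
    have h1 := hθ v ⟨by linarith [hv.1], hv.2.trans_le huT.2⟩
    have h2 : π / 2 < θ v := by
      rw [← ht]; exact hθm ⟨le_rfl, htu.le⟩ (Ioo_subset_Icc_self hv) hv.1
    have h3 : 0 < sin (θ v) := sin_pos_of_mem_Ioo h1
    have h4 : cos (θ v) < 0 := cos_neg_of_pi_div_two_lt_of_lt h2 (by linarith [h1.2])
    have hw := weight_pos (m := m) (a := x v) hr
    rw [neg_nonneg]
    refine mul_nonpos_of_nonneg_of_nonpos hw.le (div_nonpos_of_nonpos_of_nonneg ?_ (by positivity))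
    exact mul_nonpos_of_nonneg_of_nonpos (by positivity) h4.le
  have := hmono ⟨le_rfl, htu.le⟩ ⟨htu.le, le_rfl⟩ htu.le
  have h5 := mul_nonpos_of_nonneg_of_nonpos (weight_pos (m := m) (a := x u) (h.r_pos u (hsub' u ⟨htu.le, le_rfl⟩))).le hu
  simp only at this
  linarith

end Traj

/-- A strictly convex solution arc that is a graph over the `r`-axis. -/
structure Arc (m : ℕ) (lam δ T : ℝ) (x r θ : ℝ → ℝ) : Prop extends Traj m lam δ T x r θ where
  T_pos : 0 < T
  turn_pos : ∀ s ∈ Icc 0 T, 0 < turn m lam (x s) (r s) (θ s)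
  θ_le : θ T ≤ π

namespace Arc

variable {m : ℕ} {lam δ T : ℝ} {x r θ : ℝ → ℝ}

lemma θ_strictMono (h : Arc m lam δ T x r θ) : StrictMonoOn θ (Icc 0 T) :=
  strictMonoOn_of_deriv_pos' le_rfl h.dθ fun s hs => h.turn_pos s (Ioo_subset_Icc_self hs)

lemma restrict (h : Arc m lam δ T x r θ) {T' : ℝ} (h0 : 0 < T') (hT : T' ≤ T) :
    Arc m lam δ T' x r θ where
  toTraj := h.toTraj.mono hT
  T_pos := h0
  turn_pos s hs := h.turn_pos s ⟨hs.1, hs.2.trans hT⟩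
  θ_le := (h.θ_strictMono.monotoneOn ⟨h0.le, hT⟩ ⟨h.T_pos.le, le_rfl⟩ hT).trans h.θ_le

lemma zero_mem (h : Arc m lam δ T x r θ) : (0 : ℝ) ∈ Icc 0 T := ⟨le_rfl, h.T_pos.le⟩

lemma end_mem (h : Arc m lam δ T x r θ) : T ∈ Icc 0 T := ⟨h.T_pos.le, le_rfl⟩

lemma θ_mem_Icc (h : Arc m lam δ T x r θ) {s : ℝ} (hs : s ∈ Icc 0 T) : θ s ∈ Icc 0 π := by
  constructor
  · have := h.θ_strictMono.monotoneOn h.zero_mem hs hs.1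
    rwa [h.θ_zero] at this
  · exact (h.θ_strictMono.monotoneOn hs h.end_mem hs.2).trans h.θ_le

lemma θ_pos (h : Arc m lam δ T x r θ) {s : ℝ} (hs : s ∈ Ioc 0 T) : 0 < θ s := by
  have := h.θ_strictMono h.zero_mem (Ioc_subset_Icc_self hs) hs.1
  rwa [h.θ_zero] at this

lemma θ_mem_Ioo (h : Arc m lam δ T x r θ) {s : ℝ} (hs : s ∈ Ioo 0 T) : θ s ∈ Ioo 0 π :=
  ⟨h.θ_pos (Ioo_subset_Ioc_self hs),
    (h.θ_strictMono (Ioo_subset_Icc_self hs) h.end_mem hs.2).trans_le h.θ_le⟩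

lemma sin_nonneg (h : Arc m lam δ T x r θ) {s : ℝ} (hs : s ∈ Icc 0 T) : 0 ≤ sin (θ s) :=
  sin_nonneg_of_mem_Icc (h.θ_mem_Icc hs)

lemma sin_pos (h : Arc m lam δ T x r θ) {s : ℝ} (hs : s ∈ Ioo 0 T) : 0 < sin (θ s) :=
  sin_pos_of_mem_Ioo (h.θ_mem_Ioo hs)

lemma r_strictMono (h : Arc m lam δ T x r θ) : StrictMonoOn r (Icc 0 T) :=
  strictMonoOn_of_deriv_pos' le_rfl h.dr fun _ hs => h.sin_pos hs

lemma le_r (h : Arc m lam δ T x r θ) {s : ℝ} (hs : s ∈ Icc 0 T) : δ ≤ r s := by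
  have := h.r_strictMono.monotoneOn h.zero_mem hs hs.1
  rwa [h.r_zero] at this

lemma δ_pos (h : Arc m lam δ T x r θ) : 0 < δ := by
  have := h.r_pos 0 h.zero_mem
  rwa [h.r_zero] at this

lemma exists_r_eq (h : Arc m lam δ T x r θ) {b : ℝ} (hb : δ ≤ b) (hbT : b ≤ r T) :
    ∃ t ∈ Icc 0 T, r t = b :=
  intermediate_value_Icc h.T_pos.le h.continuousOn_r ⟨by rwa [h.r_zero], hbT⟩

lemma exists_θ_eq (h : Arc m lam δ T x r θ) {b : ℝ} (hb : 0 ≤ b) (hbT : b ≤ θ T) :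
    ∃ t ∈ Icc 0 T, θ t = b :=
  intermediate_value_Icc h.T_pos.le h.continuousOn_θ ⟨by rwa [h.θ_zero], hbT⟩

lemma cos_nonpos (h : Arc m lam δ T x r θ) {a s : ℝ} (ha : a ∈ Icc 0 T) (hθ : π / 2 ≤ θ a)
    (hs : s ∈ Icc a T) : cos (θ s) ≤ 0 := by
  have hs' : s ∈ Icc 0 T := ⟨ha.1.trans hs.1, hs.2⟩
  have h1 := h.θ_strictMono.monotoneOn ha hs' hs.1
  have h2 := (h.θ_mem_Icc hs').2
  exact cos_nonpos_of_pi_div_two_le_of_le (hθ.trans h1) (by linarith [pi_pos])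

lemma cos_nonneg (h : Arc m lam δ T x r θ) {a s : ℝ} (ha : a ∈ Icc 0 T) (hθ : θ a ≤ π / 2)
    (hs : s ∈ Icc 0 a) : 0 ≤ cos (θ s) := by
  have hs' : s ∈ Icc 0 T := ⟨hs.1, hs.2.trans ha.2⟩
  have h1 := h.θ_strictMono.monotoneOn hs' ha hs.2
  have h2 := (h.θ_mem_Icc hs').1
  exact cos_nonneg_of_mem_Icc ⟨by linarith [pi_pos], h1.trans hθ⟩

lemma x_strictMono (h : Arc m lam δ T x r θ) {a : ℝ} (ha : a ∈ Icc 0 T) (hθ : θ a ≤ π / 2) :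
    StrictMonoOn x (Icc 0 a) := by
  refine strictMonoOn_of_deriv_pos' le_rfl (fun s hs => h.dx s ⟨hs.1, hs.2.trans ha.2⟩) fun s hs => ?_
  have hs' : s ∈ Icc 0 T := ⟨hs.1.le, hs.2.le.trans ha.2⟩
  have h1 := h.θ_strictMono hs' ha hs.2
  exact cos_pos_of_mem_Ioo ⟨by linarith [pi_pos, (h.θ_mem_Icc hs').1], by linarith⟩

lemma x_strictAnti (h : Arc m lam δ T x r θ) {a : ℝ} (ha : a ∈ Icc 0 T) (hθ : π / 2 ≤ θ a) :
    StrictAntiOn x (Icc a T) := by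
  refine strictAntiOn_of_deriv_neg' ha.1 (fun s hs => h.dx s ⟨ha.1.trans hs.1, hs.2⟩) fun s hs => ?_
  have hs' : s ∈ Icc 0 T := ⟨ha.1.trans hs.1.le, hs.2.le⟩
  have h1 := h.θ_strictMono ha hs' hs.1
  exact cos_neg_of_pi_div_two_lt_of_lt (by linarith) (by linarith [pi_pos, (h.θ_mem_Icc hs').2])

lemma x_pos (h : Arc m lam δ T x r θ) (hx : 0 ≤ x T) {s : ℝ} (hs : s ∈ Ioo 0 T) : 0 < x s := by
  have hs' := Ioo_subset_Icc_self hs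
  rcases le_total (θ s) (π / 2) with hle | hle
  · have := h.x_strictMono hs' hle ⟨le_rfl, hs.1.le⟩ ⟨hs.1.le, le_rfl⟩ hs.1
    rwa [h.x_zero] at this
  · exact hx.trans_lt (h.x_strictAnti hs' hle ⟨le_rfl, hs.2.le⟩ ⟨hs.2.le, le_rfl⟩ hs.2)

lemma x_nonneg (h : Arc m lam δ T x r θ) (hx : 0 ≤ x T) {s : ℝ} (hs : s ∈ Icc 0 T) : 0 ≤ x s := by
  rcases hs.1.eq_or_lt with h0 | h0
  · rw [← h0, h.x_zero]
  rcases hs.2.eq_or_lt with h1 | h1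
  · rwa [h1]
  · exact (h.x_pos hx ⟨h0, h1⟩).le

/-- Once the arc is far from the axis and has turned past the vertical, it turns horizontal within a
short distance. -/
theorem le_x_of_turning (h : Arc m lam δ T x r θ) (hlam : lam ≤ 0) {a t : ℝ} (ha : a ∈ Icc 0 T)
    (hθ : π / 2 ≤ θ a) (hx : -lam ≤ x a) (hK : 0 < r a - m / r a + lam) (ht : t ∈ Icc a T) :
    x a - π / 2 / (r a - m / r a + lam) ≤ x t := by
  set K := r a - m / r a + lam with hKdef
  have hsub : ∀ s ∈ Icc a T, s ∈ Icc 0 T := fun s hs => ⟨ha.1.trans hs.1, hs.2⟩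
  have hra := h.r_pos a ha
  -- This is the support function of the convex arc relative to its point at time `a`. It starts at
  -- `0`, and its derivative is the curvature times `(x - x a) cos θ + (r - r a) sin θ`, both of
  -- whose terms are nonnegative.
  have hg : ∀ s ∈ Icc a T, 0 ≤ (x s - x a) * sin (θ s) - (r s - r a) * cos (θ s) := by
    intro s hs
    have hmono := monotoneOn_of_deriv_nonneg
      (f := fun s => (x s - x a) * sin (θ s) - (r s - r a) * cos (θ s)) ha.1
      (fun s hs => ((((h.dx s (hsub s hs)).sub_const (x a)).mul (h.dsin (hsub s hs))).sub
        (((h.dr s (hsub s hs)).sub_const (r a)).mul (h.dcos (hsub s hs)))))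
      (fun s hs => by
        have hs' := Ioo_subset_Icc_self hs
        have h1 := h.turn_pos s (hsub s hs')
        have h2 : x s ≤ x a := (h.x_strictAnti ha hθ).antitoneOn ⟨le_rfl, ha.2⟩ hs' hs'.1
        have h3 : r a ≤ r s := h.r_strictMono.monotoneOn ha (hsub s hs') hs'.1
        have h4 := h.cos_nonpos ha hθ hs'
        have h5 := h.sin_nonneg (hsub s hs')
        have h6 := mul_nonneg (mul_nonneg_of_nonpos_of_nonpos (sub_nonpos.2 h2) h4) h1.le
        have h7 := mul_nonneg (mul_nonneg (sub_nonneg.2 h3) h5) h1.le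
        linarith) ⟨le_rfl, ha.2⟩ hs hs.1
    simpa using hmono
  -- The inequality `1 - sin θ ≤ -cos θ` on `[π / 2, π]` absorbs the negative `λ` and gives `θ' ≥ K
  -- * (-cos θ) = -K * x'`. Since `θ` can gain at most `π / 2`, the coordinate `x` loses at most `π
  -- / 2 / K`.
  have hmono := monotoneOn_of_deriv_nonneg (f := fun s => x s + θ s / K) ha.1
    (fun s hs => (h.dx s (hsub s hs)).add ((h.dθ s (hsub s hs)).div_const K))
    (fun s hs => by
      have hs' := Ioo_subset_Icc_self hs
      have h3 : r a ≤ r s := h.r_strictMono.monotoneOn ha (hsub s hs') hs'.1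
      have h4 := h.cos_nonpos ha hθ hs'
      have h5 := h.sin_nonneg (hsub s hs')
      have h6 := hg s hs'
      have h7 : 1 - sin (θ s) ≤ -cos (θ s) := by
        nlinarith [sin_sq_add_cos_sq (θ s), sin_le_one (θ s), neg_one_le_cos (θ s)]
      have hrs := h.r_pos s (hsub s hs')
      have h8 : (m : ℝ) / r s ≤ m / r a := by gcongr
      have h9 : K * -cos (θ s) ≤ turn m lam (x s) (r s) (θ s) := by
        have e : turn m lam (x s) (r s) (θ s) = (m / r s) * cos (θ s)
          + ((x s - x a) * sin (θ s) - (r s - r a) * cos (θ s)) + (x a + lam) * sin (θ s)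
            + r a * -cos (θ s) + lam * (1 - sin (θ s)) := by
          rw [turn]; ring
        rw [e, hKdef]
        nlinarith [mul_nonneg (by linarith : 0 ≤ x a + lam) h5,
          mul_le_mul_of_nonneg_right h8 (by linarith : 0 ≤ -cos (θ s)),
          mul_le_mul_of_nonneg_left h7 (by linarith : 0 ≤ -lam)]
      have : -cos (θ s) ≤ turn m lam (x s) (r s) (θ s) / K := by
        rw [le_div_iff₀ hK]; linarith
      linarith) ⟨le_rfl, ha.2⟩ ht ht.1
  simp only at hmono
  have h1 := (h.θ_mem_Icc (hsub t ht)).2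
  have h2 : (θ t - θ a) / K ≤ π / 2 / K := by
    gcongr; linarith
  rw [sub_div] at h2
  linarith

end Arc

end LambdaHypersurface
end

/-! ### Crossing the axis `x = 0` versus turning horizontal. -/

noncomputable section

namespace LambdaHypersurface

open Set Filter Real

namespace PhaseCurve

variable {m : ℕ} {lam δ T : ℝ} {Γ : PhaseCurve}

/-- `x` vanishes before `θ` reaches `0` or `π`. -/
def Crosses (Γ : PhaseCurve) : Prop :=
  ∃ T : ℝ, 0 < T ∧ (T : EReal) < Γ.S ∧ (∀ s ∈ Ioc 0 T, Γ.θ s ∈ Ioo 0 π) ∧ Γ.x T = 0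

/-- `θ` reaches `π` at time `L`, at a point with `x ≥ 0`. -/
def TurnsAt (Γ : PhaseCurve) (L : ℝ) : Prop :=
  0 < L ∧ (L : EReal) < Γ.S ∧ (∀ s ∈ Ioo 0 L, Γ.θ s ∈ Ioo 0 π) ∧ Γ.θ L = π ∧ 0 ≤ Γ.x L

lemma exists_gt_lt_S (hT : (T : EReal) < Γ.S) : ∃ T' : ℝ, T < T' ∧ (T' : EReal) < Γ.S := by
  obtain ⟨T', h1, h2⟩ := EReal.lt_iff_exists_real_btwn.1 hT
  exact ⟨T', EReal.coe_lt_coe_iff.1 h1, h2⟩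

lemma IsMaximalSolution.arc_of_vertical (h : Γ.IsMaximalSolution (m + 1) lam δ) (hm : 1 ≤ m)
    (hT0 : 0 < T) (hT : (T : EReal) < Γ.S) (hθ : ∀ s ∈ Ioo 0 T, Γ.θ s ∈ Ioo 0 π)
    (hv : ∃ t ∈ Icc 0 T, Γ.θ t = π / 2) : Arc m lam δ T Γ.x Γ.r Γ.θ where
  toTraj := h.traj hT
  T_pos := hT0
  turn_pos := (h.traj hT).turn_pos_of_vertical hm hθ hv
  θ_le := by
    have hc := (h.traj hT).continuousOn_θ
    have : T ∈ closure (Ioo 0 T) := by rw [closure_Ioo hT0.ne]; exact ⟨hT0.le, le_rfl⟩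
    have h2 : ContinuousWithinAt Γ.θ (Ioo 0 T) T :=
      (hc T ⟨hT0.le, le_rfl⟩).mono Ioo_subset_Icc_self
    have := h2.mem_closure this (t := Iic π) (fun s hs => (hθ s hs).2.le)
    simpa using this

lemma IsMaximalSolution.θ_pos_near_zero (h : Γ.IsMaximalSolution (m + 1) lam δ)
    (hk : 0 < turn m lam 0 δ 0) :
    ∃ ε : ℝ, 0 < ε ∧ (ε : EReal) < Γ.S ∧ ∀ s ∈ Ioc 0 ε, 0 < Γ.θ s := by
  obtain ⟨T, hT0, hT⟩ := exists_gt_lt_S (T := 0) (by simpa using h.1)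
  have ht := h.traj hT
  have h0 : 0 < turn m lam (Γ.x 0) (Γ.r 0) (Γ.θ 0) := by
    rwa [ht.x_zero, ht.r_zero, ht.θ_zero]
  have hev : ∀ᶠ s in 𝓝[Icc 0 T] 0, 0 < turn m lam (Γ.x s) (Γ.r s) (Γ.θ s) :=
    (ht.continuousOn_turn 0 ⟨le_rfl, hT0.le⟩).eventually (lt_mem_nhds h0)
  obtain ⟨ε, hε, hball⟩ := Metric.mem_nhdsWithin_iff.1 hev
  have hε' : 0 < min (ε / 2) T := lt_min (by linarith) hT0
  refine ⟨min (ε / 2) T, hε', (EReal.coe_le_coe_iff.2 (min_le_right _ _)).trans_lt hT, ?_⟩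
  have hmem : ∀ s ∈ Icc 0 (min (ε / 2) T), s ∈ Icc 0 T := fun s hs =>
    ⟨hs.1, hs.2.trans (min_le_right _ _)⟩
  have hmono := strictMonoOn_of_deriv_pos' (f := Γ.θ) le_rfl (fun s hs => ht.dθ s (hmem s hs))
    (fun s hs => hball ⟨by
      rw [Metric.mem_ball, Real.dist_eq, sub_zero, abs_of_pos hs.1]
      linarith [hs.2, min_le_left (ε / 2) T], hmem s (Ioo_subset_Icc_self hs)⟩)
  intro s hs
  have := hmono ⟨le_rfl, hε'.le⟩ (Ioc_subset_Icc_self hs) hs.1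
  rwa [ht.θ_zero] at this

/-- If `θ` does not take the values `0` and `π` on `(0, T]`, then it stays between them. -/
lemma IsMaximalSolution.θ_mem_of_ne (h : Γ.IsMaximalSolution (m + 1) lam δ)
    (hk : 0 < turn m lam 0 δ 0) (hT : (T : EReal) < Γ.S)
    (hne : ∀ s ∈ Ioc 0 T, Γ.θ s ≠ 0 ∧ Γ.θ s ≠ π) : ∀ s ∈ Ioc 0 T, Γ.θ s ∈ Ioo 0 π := by
  intro s hs
  obtain ⟨ε, hε, hεS, hεpos⟩ := h.θ_pos_near_zero hk
  have hc := (h.traj hT).continuousOn_θ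
  have h0 := (h.traj hT).θ_zero
  have hsub : Icc 0 s ⊆ Icc 0 T := Icc_subset_Icc_right hs.2
  constructor
  · by_contra hneg
    rw [not_lt] at hneg
    have hlt : min ε s ≤ s := min_le_right _ _
    have hpos : 0 < min ε s := lt_min hε hs.1
    have h1 := hεpos (min ε s) ⟨hpos, min_le_left _ _⟩
    obtain ⟨u, hu, hu'⟩ := intermediate_value_Icc' hlt
      (hc.mono (fun v hv => ⟨hpos.le.trans hv.1, hv.2.trans hs.2⟩)) ⟨hneg, h1.le⟩
    exact (hne u ⟨hpos.trans_le hu.1, hu.2.trans hs.2⟩).1 hu'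
  · by_contra hge
    rw [not_lt] at hge
    obtain ⟨u, hu, hu'⟩ := intermediate_value_Icc hs.1.le (hc.mono hsub)
      (show π ∈ Icc (Γ.θ 0) (Γ.θ s) by rw [h0]; exact ⟨pi_pos.le, hge⟩)
    refine (hne u ⟨lt_of_le_of_ne hu.1 fun he => ?_, hu.2.trans hs.2⟩).2 hu'
    rw [← he, h0] at hu'
    exact pi_pos.ne hu'

lemma firstTime_le {P : ℝ → Prop} {s : ℝ} (h0 : 0 < s) (hs : (s : EReal) < Γ.S) (hP : P s) :
    Γ.firstTime P ≤ s := sInf_le (Or.inl ⟨s, h0, hs, hP, rfl⟩)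

lemma firstTime_le_S (P : ℝ → Prop) : Γ.firstTime P ≤ Γ.S := sInf_le (Or.inr rfl)

lemma le_firstTime {P : ℝ → Prop} (hT : (T : EReal) ≤ Γ.S) (hP : ∀ s ∈ Ioo 0 T, ¬ P s) :
    (T : EReal) ≤ Γ.firstTime P := by
  refine le_sInf ?_
  rintro _ (⟨s, h0, -, hPs, rfl⟩ | rfl)
  · by_contra hlt
    rw [not_le, EReal.coe_lt_coe_iff] at hlt
    exact hP s ⟨h0, hlt⟩ hPs
  · exact hT

lemma exists_of_firstTime_lt {P : ℝ → Prop} {c : EReal} (hc : c ≤ Γ.S) (h : Γ.firstTime P < c) :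
    ∃ s : ℝ, 0 < s ∧ (s : EReal) < Γ.S ∧ P s ∧ (s : EReal) < c := by
  obtain ⟨_, ⟨s, h0, hs, hPs, rfl⟩ | rfl, hlt⟩ := sInf_lt_iff.1 h
  · exact ⟨s, h0, hs, hPs, hlt⟩
  · exact absurd hc (not_le.2 hlt)

lemma not_of_lt_firstTime {P : ℝ → Prop} {s t : ℝ} (ht : (t : EReal) < Γ.firstTime P)
    (hs : s ∈ Ioc 0 t) : ¬ P s := fun hP => by
  have hsS : (s : EReal) < Γ.S :=
    (EReal.coe_le_coe_iff.2 hs.2).trans_lt (ht.trans_le (firstTime_le_S P))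
  exact absurd ((firstTime_le hs.1 hsS hP).trans (EReal.coe_le_coe_iff.2 hs.2)) (not_le.2 ht)

/-- As long as `θ < π / 2` the coordinate `x` strictly increases from `0`, so a later value `x ≤ 0`
forces a vertical tangent in between. -/
lemma IsMaximalSolution.exists_vertical (h : Γ.IsMaximalSolution (m + 1) lam δ) (hT0 : 0 < T)
    (hT : (T : EReal) < Γ.S) (hθ : ∀ s ∈ Ioo 0 T, Γ.θ s ∈ Ioo 0 π) (hx : Γ.x T ≤ 0) :
    ∃ t ∈ Ioo 0 T, Γ.θ t = π / 2 := by
  have ht := h.traj hT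
  by_contra hno
  have hlt : ∀ s ∈ Ioo 0 T, Γ.θ s < π / 2 := by
    intro s hs
    by_contra hge
    obtain ⟨u, hu, hu'⟩ := intermediate_value_Icc hs.1.le
      (ht.continuousOn_θ.mono (Icc_subset_Icc_right hs.2.le))
      (show π / 2 ∈ Icc (Γ.θ 0) (Γ.θ s) by
        rw [ht.θ_zero]; exact ⟨by linarith [pi_pos], not_lt.1 hge⟩)
    refine hno ⟨u, ⟨lt_of_le_of_ne hu.1 fun he => ?_, hu.2.trans_lt hs.2⟩, hu'⟩
    rw [← he, ht.θ_zero] at hu'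
    linarith [pi_pos]
  have := strictMonoOn_of_deriv_pos' (f := Γ.x) le_rfl ht.dx (fun s hs =>
    cos_pos_of_mem_Ioo ⟨by linarith [(hθ s hs).1, pi_pos], hlt s hs⟩)
    ⟨le_rfl, hT0.le⟩ ⟨hT0.le, le_rfl⟩ hT0
  rw [ht.x_zero] at this
  linarith

/-- This replaces the type 1.1 condition on first times by a statement about one finite time, which
is stable under perturbation. In the converse direction `s₃ < s₁` holds because a curve returning to
`x = 0` has been vertical before. -/
lemma IsMaximalSolution.crosses_iff (h : Γ.IsMaximalSolution (m + 1) lam δ)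
    (hk : 0 < turn m lam 0 δ 0) : (Γ.s₃ < Γ.s₁ ∧ Γ.s₄ < Γ.s₁) ↔ Γ.Crosses := by
  constructor
  · rintro ⟨-, h4⟩
    obtain ⟨T, hT0, hT, hx, hlt⟩ := exists_of_firstTime_lt (firstTime_le_S _) h4
    refine ⟨T, hT0, hT, h.θ_mem_of_ne hk hT fun s hs => ?_, hx⟩
    simpa [not_or] using not_of_lt_firstTime hlt hs
  · rintro ⟨T, hT0, hT, hθ, hx⟩
    have ht := h.traj hT
    obtain ⟨t, ht', hθt⟩ := h.exists_vertical hT0 hT (fun s hs => hθ s (Ioo_subset_Ioc_self hs)) hx.le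
    obtain ⟨T₁, hT₁, hT₁S⟩ := exists_gt_lt_S hT
    have hc : ContinuousWithinAt Γ.θ (Icc 0 T₁) T :=
      (h.traj hT₁S).continuousOn_θ T ⟨hT0.le, hT₁.le⟩
    have hev : ∀ᶠ s in 𝓝[Icc 0 T₁] T, Γ.θ s ∈ Ioo 0 π :=
      hc.eventually (isOpen_Ioo.mem_nhds (hθ T ⟨hT0, le_rfl⟩))
    obtain ⟨ε, hε, hball⟩ := Metric.mem_nhdsWithin_iff.1 hev
    set T₂ := min T₁ (T + ε) with hT₂
    have hTT₂ : T < T₂ := lt_min hT₁ (by linarith)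
    have hs₁ : (T₂ : EReal) ≤ Γ.s₁ := by
      refine le_firstTime ((EReal.coe_le_coe_iff.2 (min_le_left _ _)).trans hT₁S.le) fun s hs => ?_
      have hmem : Γ.θ s ∈ Ioo 0 π := by
        rcases le_or_gt s T with hle | hgt
        · exact hθ s ⟨hs.1, hle⟩
        · refine hball ⟨?_, hs.1.le, hs.2.le.trans (min_le_left _ _)⟩
          rw [Metric.mem_ball, Real.dist_eq, abs_of_pos (by linarith)]
          linarith [hs.2, min_le_right T₁ (T + ε)]
      rintro (h0 | h0)
      · exact hmem.1.ne' h0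
      · exact hmem.2.ne h0
    have hlt : (T : EReal) < Γ.s₁ := (EReal.coe_lt_coe_iff.2 hTT₂).trans_le hs₁
    refine ⟨?_, (firstTime_le hT0 hT hx).trans_lt hlt⟩
    have htT : (t : EReal) < T := EReal.coe_lt_coe_iff.2 ht'.2
    exact (firstTime_le ht'.1 (htT.trans hT) (Or.inr hθt)).trans_lt (htT.trans hlt)

lemma IsMaximalSolution.Crosses.exists_arc (h : Γ.IsMaximalSolution (m + 1) lam δ) (hm : 1 ≤ m)
    (hc : Γ.Crosses) :
    ∃ T : ℝ, (T : EReal) < Γ.S ∧ Arc m lam δ T Γ.x Γ.r Γ.θ ∧ π / 2 < Γ.θ T ∧ Γ.θ T < π ∧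
      Γ.x T = 0 := by
  obtain ⟨T, hT0, hT, hθ, hx⟩ := hc
  have hθ' : ∀ s ∈ Ioo 0 T, Γ.θ s ∈ Ioo 0 π := fun s hs => hθ s (Ioo_subset_Ioc_self hs)
  obtain ⟨t, ht, hθt⟩ := h.exists_vertical hT0 hT hθ' hx.le
  have ha := h.arc_of_vertical hm hT0 hT hθ' ⟨t, Ioo_subset_Icc_self ht, hθt⟩
  refine ⟨T, hT, ha, ?_, (hθ T ⟨hT0, le_rfl⟩).2, hx⟩
  rw [← hθt]
  exact ha.θ_strictMono (Ioo_subset_Icc_self ht) ha.end_mem ht.2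

lemma TurnsAt.arc {L : ℝ} (hL : Γ.TurnsAt L) (h : Γ.IsMaximalSolution (m + 1) lam δ) (hm : 1 ≤ m) :
    Arc m lam δ L Γ.x Γ.r Γ.θ := by
  obtain ⟨hL0, hLS, hθ, hπ, hx⟩ := hL
  have ht := h.traj hLS
  refine h.arc_of_vertical hm hL0 hLS hθ ?_
  exact intermediate_value_Icc hL0.le ht.continuousOn_θ
    (by rw [ht.θ_zero, hπ]; constructor <;> linarith [pi_pos])

/-- A curve that becomes vertical either crosses the axis `x = 0` before it turns horizontal, or turns
horizontal at a point with `x ≥ 0`. -/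
theorem IsMaximalSolution.crosses_or_turnsAt (h : Γ.IsMaximalSolution (m + 1) lam δ) (hm : 1 ≤ m)
    {t : ℝ} (ht0 : 0 < t) (htS : (t : EReal) < Γ.S)
    (hθ : ∀ s ∈ Ioo 0 t, Γ.θ s ∈ Ioo 0 π) (ht : Γ.θ t = π / 2) :
    Γ.Crosses ∨ ∃ L, t < L ∧ Γ.TurnsAt L := by
  have hpi := pi_pos
  have hcross : ∀ T : ℝ, t < T → (T : EReal) < Γ.S → (∀ s ∈ Ioo 0 T, Γ.θ s ∈ Ioo 0 π) →
      Γ.x T < 0 → Γ.Crosses := by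
    intro T hT hTS hθT hx
    have ha := h.arc_of_vertical hm (ht0.trans hT) hTS hθT ⟨t, ⟨ht0.le, hT.le⟩, ht⟩
    have hxt := ha.x_strictMono (a := t) ⟨ht0.le, hT.le⟩ ht.le ⟨le_rfl, ht0.le⟩ ⟨ht0.le, le_rfl⟩ ht0
    rw [ha.x_zero] at hxt
    obtain ⟨u, hu, hu'⟩ := intermediate_value_Ioo' hT.le
      (ha.continuousOn_x.mono (Icc_subset_Icc_left ht0.le)) ⟨hx, hxt⟩
    exact ⟨u, ht0.trans hu.1, (EReal.coe_lt_coe_iff.2 hu.2).trans hTS,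
      fun s hs => hθT s ⟨hs.1, hs.2.trans_lt hu.2⟩, hu'⟩
  by_cases hex : ∃ s : ℝ, t < s ∧ (s : EReal) < Γ.S ∧ (Γ.θ s = 0 ∨ Γ.θ s = π)
  · obtain ⟨s, hts, hsS, hs⟩ := hex
    have htr := h.traj hsS
    obtain ⟨L, ⟨hL, hLθ⟩, hleast⟩ : ∃ L, IsLeast {L | L ∈ Icc t s ∧ Γ.θ L ∈ ({0, π} : Set ℝ)} L := by
      refine IsCompact.exists_isLeast ?_ ⟨s, ⟨hts.le, le_rfl⟩, hs⟩
      have := (htr.continuousOn_θ.mono (Icc_subset_Icc_left ht0.le)).preimage_isClosed_of_isClosed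
        isClosed_Icc (Set.toFinite ({0, π} : Set ℝ)).isClosed
      exact isCompact_Icc.of_isClosed_subset this fun s hs => hs.1
    have htL : t < L := by
      refine lt_of_le_of_ne hL.1 fun he => ?_
      rw [← he, ht] at hLθ
      rcases hLθ with h0 | h0
      · linarith
      · rw [mem_singleton_iff] at h0; linarith
    have hLS : (L : EReal) < Γ.S := (EReal.coe_le_coe_iff.2 hL.2).trans_lt hsS
    have hθL : ∀ u ∈ Ioo 0 L, Γ.θ u ∈ Ioo 0 π := by
      intro u hu
      rcases lt_trichotomy u t with hlt | heq | hgt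
      · exact hθ u ⟨hu.1, hlt⟩
      · rw [heq, ht]; constructor <;> linarith
      · have hnot : ∀ v ∈ Icc t u, Γ.θ v ∉ ({0, π} : Set ℝ) := fun v hv hv' =>
          absurd (hleast ⟨⟨hv.1, hv.2.trans (hu.2.le.trans hL.2)⟩, hv'⟩)
            (not_le.2 (hv.2.trans_lt hu.2))
        have hcu : ContinuousOn Γ.θ (Icc t u) := htr.continuousOn_θ.mono fun v hv =>
          ⟨ht0.le.trans hv.1, hv.2.trans (hu.2.le.trans hL.2)⟩
        constructor
        · by_contra hneg
          obtain ⟨v, hv, hv'⟩ := intermediate_value_Icc' hgt.le hcu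
            (show (0 : ℝ) ∈ Icc (Γ.θ u) (Γ.θ t) by rw [ht]; exact ⟨not_lt.1 hneg, by linarith⟩)
          exact hnot v hv (Or.inl hv')
        · by_contra hneg
          obtain ⟨v, hv, hv'⟩ := intermediate_value_Icc hgt.le hcu
            (show π ∈ Icc (Γ.θ t) (Γ.θ u) by rw [ht]; exact ⟨by linarith, not_lt.1 hneg⟩)
          exact hnot v hv (Or.inr hv')
    have ha := h.arc_of_vertical hm (ht0.trans htL) hLS hθL ⟨t, ⟨ht0.le, htL.le⟩, ht⟩
    have hmono := ha.θ_strictMono ⟨ht0.le, htL.le⟩ ha.end_mem htL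
    rw [ht] at hmono
    have hLπ : Γ.θ L = π := by
      rcases hLθ with h0 | h0
      · linarith
      · exact h0
    rcases lt_or_ge (Γ.x L) 0 with hx | hx
    · exact Or.inl (hcross L htL hLS hθL hx)
    · exact Or.inr ⟨L, htL, ht0.trans htL, hLS, hθL, hLπ, hx⟩
  -- If `θ` never reaches `0` or `π`, the curve stays convex with `r ≥ δ` and exists for all time.
  -- After `t + 1` the value `cos θ` is at most a negative constant, so `x` eventually becomes
  -- negative.
  · left
    have hθall : ∀ T : ℝ, t < T → (T : EReal) < Γ.S → ∀ s ∈ Ioo 0 T, Γ.θ s ∈ Ioo 0 π := by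
      intro T hT hTS u hu
      rcases lt_trichotomy u t with hlt | heq | hgt
      · exact hθ u ⟨hu.1, hlt⟩
      · rw [heq, ht]; constructor <;> linarith
      · have hcu : ContinuousOn Γ.θ (Icc t u) := (h.traj hTS).continuousOn_θ.mono fun v hv =>
          ⟨ht0.le.trans hv.1, hv.2.trans hu.2.le⟩
        have hnot : ∀ v ∈ Icc t u, Γ.θ v ≠ 0 ∧ Γ.θ v ≠ π := by
          intro v hv
          rcases hv.1.eq_or_lt with he | hlt
          · rw [← he, ht]; constructor <;> linarith
          · have hvS : (v : EReal) < Γ.S :=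
              (EReal.coe_lt_coe_iff.2 (hv.2.trans_lt hu.2)).trans hTS
            exact ⟨fun h0 => hex ⟨v, hlt, hvS, Or.inl h0⟩, fun h0 => hex ⟨v, hlt, hvS, Or.inr h0⟩⟩
        constructor
        · by_contra hneg
          obtain ⟨v, hv, hv'⟩ := intermediate_value_Icc' hgt.le hcu
            (show (0 : ℝ) ∈ Icc (Γ.θ u) (Γ.θ t) by rw [ht]; exact ⟨not_lt.1 hneg, by linarith⟩)
          exact (hnot v hv).1 hv'
        · by_contra hneg
          obtain ⟨v, hv, hv'⟩ := intermediate_value_Icc hgt.le hcu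
            (show π ∈ Icc (Γ.θ t) (Γ.θ u) by rw [ht]; exact ⟨by linarith, not_lt.1 hneg⟩)
          exact (hnot v hv).2 hv'
    have harc : ∀ T : ℝ, t < T → (T : EReal) < Γ.S → Arc m lam δ T Γ.x Γ.r Γ.θ := fun T hT hTS =>
      h.arc_of_vertical hm (ht0.trans hT) hTS (hθall T hT hTS) ⟨t, ⟨ht0.le, hT.le⟩, ht⟩
    have hS : Γ.S = ⊤ := by
      refine h.S_eq_top h.pos fun s hs hsS => ?_
      obtain ⟨T, hT, hTS⟩ := exists_gt_lt_S (T := max s t)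
        (by rcases max_choice s t with he | he <;> rw [he] <;> assumption)
      exact (harc T ((le_max_right _ _).trans_lt hT) hTS).le_r
        ⟨hs, (le_max_left _ _).trans hT.le⟩
    have hlt : ∀ T : ℝ, (T : EReal) < Γ.S := fun T => by rw [hS]; exact EReal.coe_lt_top T
    have hc1 : cos (Γ.θ (t + 1)) < 0 := by
      have ha := harc (t + 2) (by linarith) (hlt _)
      have h1 := ha.θ_strictMono ⟨ht0.le, by linarith⟩ (show t + 1 ∈ Icc 0 (t + 2) by
        constructor <;> linarith) (by linarith)
      have h2 := (ha.θ_mem_Icc (show t + 1 ∈ Icc 0 (t + 2) by constructor <;> linarith)).2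
      exact cos_neg_of_pi_div_two_lt_of_lt (by linarith) (by linarith)
    set c := cos (Γ.θ (t + 1)) with hc
    -- From `x (t + 1) ≤ t + 1` and `x' ≤ c` this choice gives `x T ≤ (t + 1) - (t + 2) < 0`.
    set T := t + 1 + (t + 2) / (-c) with hTdef
    have hdiv : 0 < (t + 2) / (-c) := by apply div_pos <;> linarith
    have hT : t + 1 < T := by linarith
    have ha := harc T (by linarith) (hlt T)
    have hanti := antitoneOn_of_deriv_nonpos (f := fun s => Γ.x s - c * s) (a := t + 1) (b := T)
      (by linarith)
      (fun s hs => (ha.dx s ⟨by linarith [hs.1], hs.2⟩).sub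
        (((hasDerivWithinAt_id s (Ici 0)).const_mul c)))
      (fun s hs => by
        have h1 := ha.θ_strictMono.monotoneOn (show t + 1 ∈ Icc 0 T by constructor <;> linarith)
          (show s ∈ Icc 0 T from ⟨by linarith [hs.1], hs.2.le⟩) hs.1.le
        have h2 := ha.θ_mem_Icc (show s ∈ Icc 0 T from ⟨by linarith [hs.1], hs.2.le⟩)
        have h3 := ha.θ_mem_Icc (show t + 1 ∈ Icc 0 T by constructor <;> linarith)
        have := cos_le_cos_of_nonneg_of_le_pi h3.1 h2.2 h1
        simp only [mul_one]
        linarith) ⟨le_rfl, hT.le⟩ ⟨hT.le, le_rfl⟩ hT.le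
    have hx1 := ha.x_le (show t + 1 ∈ Icc 0 T by constructor <;> linarith)
    refine hcross T (by linarith) (hlt T) (hθall T (by linarith) (hlt T)) ?_
    simp only at hanti
    have e : c * T = c * (t + 1) - (t + 2) := by
      have hc0 : c ≠ 0 := hc1.ne
      rw [hTdef, div_neg, mul_add, mul_neg, mul_div_cancel₀ _ hc0]; ring
    linarith

end PhaseCurve

end LambdaHypersurface
end

/-! ### Stability of crossing and turning, and limits of crossing curves. -/

noncomputable section

namespace LambdaHypersurface

open Set Filter Real

lemma continuousAt_turn (m : ℕ) {q : ℝ × ℝ × ℝ × ℝ} (hq : q.2.2.1 ≠ 0) :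
    ContinuousAt (fun q : ℝ × ℝ × ℝ × ℝ => turn m q.1 q.2.1 q.2.2.1 q.2.2.2) q := by
  unfold turn
  have : ContinuousAt (fun q : ℝ × ℝ × ℝ × ℝ => (m : ℝ) / q.2.2.1) q :=
    continuousAt_const.div (by fun_prop) hq
  fun_prop

lemma turn_initial (m : ℕ) (lam δ : ℝ) : turn m lam 0 δ 0 = m / δ - δ + lam := by
  simp [turn]

/-- The number `R_λ` is the positive root of `m / δ - δ + λ`, which is the initial curvature. -/
lemma lt_cylinderRadius_iff (m : ℕ) {lam δ : ℝ} (hδ : 0 < δ) :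
    δ < cylinderRadius (m + 1) lam ↔ 0 < turn m lam 0 δ 0 := by
  rw [turn_initial, cylinderRadius]
  push_cast
  rw [add_sub_cancel_right, lt_div_iff₀ two_pos, ← sub_lt_iff_lt_add']
  have h0 : (0 : ℝ) ≤ lam ^ 2 + 4 * m := by positivity
  have e : (m : ℝ) / δ - δ + lam = (m - δ ^ 2 + lam * δ) / δ := by field_simp
  rw [e, div_pos_iff_of_pos_right hδ]
  constructor
  · intro h
    rcases lt_or_ge (δ * 2 - lam) 0 with hneg | hpos
    · have : (0 : ℝ) ≤ m := m.cast_nonneg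
      nlinarith
    · rw [Real.lt_sqrt hpos] at h
      nlinarith
  · intro h
    refine Real.lt_sqrt_of_sq_lt ?_
    nlinarith

namespace PhaseCurve

variable {m : ℕ} {lam δ T : ℝ} {Γ : PhaseCurve}

/-- Closeness of the curvature is added, by uniform continuity of `turn` near the compact image of
the curve, because positivity of the curvature is what keeps a perturbed curve an `Arc`. -/
theorem IsMaximalSolution.continuous_dependence_turn (h : Γ.IsMaximalSolution (m + 1) lam δ)
    (hT : (T : EReal) < Γ.S) (hT0 : 0 ≤ T) {η : ℝ} (hη : 0 < η) :
    ∃ ν > 0, ∀ lam' δ' : ℝ, ∀ Γ' : PhaseCurve, |lam' - lam| < ν → |δ' - δ| < ν →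
      Γ'.IsMaximalSolution (m + 1) lam' δ' → (T : EReal) < Γ'.S ∧
        ∀ s ∈ Icc 0 T, |Γ'.x s - Γ.x s| < η ∧ |Γ'.r s - Γ.r s| < η ∧ |Γ'.θ s - Γ.θ s| < η ∧
          |turn m lam' (Γ'.x s) (Γ'.r s) (Γ'.θ s) - turn m lam (Γ.x s) (Γ.r s) (Γ.θ s)| < η := by
  have ht := h.traj hT
  set φ : ℝ → ℝ × ℝ × ℝ × ℝ := fun s => (lam, Γ.x s, Γ.r s, Γ.θ s) with hφ
  have hcomp : IsCompact (φ '' Icc 0 T) :=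
    isCompact_Icc.image_of_continuousOn (continuousOn_const.prodMk ht.continuousOn_state)
  have huc := hcomp.uniformContinuousAt_of_continuousAt
    (fun q : ℝ × ℝ × ℝ × ℝ => turn m q.1 q.2.1 q.2.2.1 q.2.2.2)
    (by rintro _ ⟨s, hs, rfl⟩; exact continuousAt_turn m (ht.r_pos s hs).ne')
    (Metric.dist_mem_uniformity hη)
  obtain ⟨ε, hε, hεs⟩ := Metric.mem_uniformity_dist.1 huc
  obtain ⟨ν, hν, H⟩ := h.continuous_dependence hT hT0 (lt_min hη hε)
  refine ⟨min ν ε, lt_min hν hε, fun lam' δ' Γ' hl hd h' => ?_⟩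
  obtain ⟨h1, h2⟩ := H lam' δ' Γ' (hl.trans_le (min_le_left _ _)) (hd.trans_le (min_le_left _ _)) h'
  refine ⟨h1, fun s hs => ?_⟩
  obtain ⟨a1, a2, a3⟩ := h2 s hs
  rw [lt_min_iff] at a1 a2 a3
  refine ⟨a1.1, a2.1, a3.1, ?_⟩
  have hd : dist (φ s) (lam', Γ'.x s, Γ'.r s, Γ'.θ s) < ε := by
    rw [dist_comm]
    simp only [hφ, Prod.dist_eq, Real.dist_eq]
    exact max_lt (hl.trans_le (min_le_right _ _)) (max_lt a1.2 (max_lt a2.2 a3.2))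
  have := hεs hd (mem_image_of_mem φ hs)
  simp only [mem_ofPred_eq, Real.dist_eq] at this
  rw [abs_sub_comm]
  exact this

lemma TurnsAt.not_crosses {L : ℝ} (hL : Γ.TurnsAt L) (h : Γ.IsMaximalSolution (m + 1) lam δ)
    (hm : 1 ≤ m) : ¬ Γ.Crosses := by
  rintro ⟨T, hT0, hT, hθ, hx⟩
  rcases lt_or_ge T L with hlt | hge
  · exact ((hL.arc h hm).x_pos hL.2.2.2.2 ⟨hT0, hlt⟩).ne' hx
  · exact (hθ L ⟨hL.1, hge⟩).2.ne hL.2.2.2.1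

/-- Positivity of the curvature on `[0, T]` persists for some time. -/
lemma IsMaximalSolution.exists_turn_pos_gt (h : Γ.IsMaximalSolution (m + 1) lam δ)
    (ha : Arc m lam δ T Γ.x Γ.r Γ.θ) (hT : (T : EReal) < Γ.S) {ε : ℝ} (hε : 0 < ε) :
    ∃ T' : ℝ, T < T' ∧ T' < T + ε ∧ (T' : EReal) < Γ.S ∧
      ∀ s ∈ Icc 0 T', 0 < turn m lam (Γ.x s) (Γ.r s) (Γ.θ s) := by
  obtain ⟨T₁, hT₁, hT₁S⟩ := exists_gt_lt_S hT
  have ht := h.traj hT₁S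
  have hev : ∀ᶠ s in 𝓝[Icc 0 T₁] T, 0 < turn m lam (Γ.x s) (Γ.r s) (Γ.θ s) :=
    (ht.continuousOn_turn T ⟨ha.T_pos.le, hT₁.le⟩).eventually
      (lt_mem_nhds (ha.turn_pos T ha.end_mem))
  obtain ⟨μ, hμ, hball⟩ := Metric.mem_nhdsWithin_iff.1 hev
  refine ⟨min T₁ (T + min ε μ / 2), lt_min hT₁ ?_, ?_, ?_, fun s hs => ?_⟩
  · have := lt_min hε hμ; linarith
  · refine (min_le_right _ _).trans_lt ?_
    have := min_le_left ε μ; linarith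
  · exact (EReal.coe_le_coe_iff.2 (min_le_left _ _)).trans_lt hT₁S
  · rcases le_or_gt s T with hle | hgt
    · exact ha.turn_pos s ⟨hs.1, hle⟩
    · refine hball ⟨?_, hs.1, hs.2.trans (min_le_left _ _)⟩
      rw [Metric.mem_ball, Real.dist_eq, abs_of_pos (by linarith)]
      have h1 := hs.2.trans (min_le_right _ _)
      have := min_le_right ε μ
      linarith

lemma exists_forall_le_turn (ht : Traj m lam δ T Γ.x Γ.r Γ.θ) (hT : 0 ≤ T)
    (hk : ∀ s ∈ Icc 0 T, 0 < turn m lam (Γ.x s) (Γ.r s) (Γ.θ s)) :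
    ∃ κ > 0, ∀ s ∈ Icc 0 T, κ ≤ turn m lam (Γ.x s) (Γ.r s) (Γ.θ s) := by
  obtain ⟨u, hu, hmin⟩ := isCompact_Icc.exists_isMinOn ⟨0, le_rfl, hT⟩ ht.continuousOn_turn
  exact ⟨_, hk u hu, fun s hs => hmin hs⟩

/-- Crossing the axis `x = 0` is an open condition. -/
theorem Crosses.persists (hc : Γ.Crosses) (h : Γ.IsMaximalSolution (m + 1) lam δ) (hm : 1 ≤ m) :
    ∃ ν > 0, ∀ lam' δ' : ℝ, ∀ Γ' : PhaseCurve, |lam' - lam| < ν → |δ' - δ| < ν →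
      Γ'.IsMaximalSolution (m + 1) lam' δ' → Γ'.Crosses := by
  obtain ⟨T, hT, ha, hθ1, hθ2, hx⟩ := IsMaximalSolution.Crosses.exists_arc h hm hc
  obtain ⟨T₁, hT₁, hT₁S⟩ := exists_gt_lt_S hT
  have hev : ∀ᶠ s in 𝓝[Icc 0 T₁] T, Γ.θ s < π :=
    ((h.traj hT₁S).continuousOn_θ T ⟨ha.T_pos.le, hT₁.le⟩).eventually (gt_mem_nhds hθ2)
  obtain ⟨μ, hμ, hball⟩ := Metric.mem_nhdsWithin_iff.1 hev
  -- Going slightly past the crossing time makes `x < 0` and `θ < π` strict, with a uniform positive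
  -- lower bound on the curvature. Such strict conditions pass to nearby curves, which then cross by
  -- the intermediate value theorem.
  obtain ⟨T', hTT', hT'μ, hT'S, hk⟩ := h.exists_turn_pos_gt ha hT (ε := min μ (T₁ - T))
    (lt_min hμ (by linarith))
  have hT'0 : 0 < T' := ha.T_pos.trans hTT'
  have ht' := h.traj hT'S
  have hθT' : Γ.θ T' < π := by
    refine hball ⟨?_, hT'0.le, ?_⟩
    · rw [Metric.mem_ball, Real.dist_eq, abs_of_pos (by linarith)]
      linarith [min_le_left μ (T₁ - T)]
    · linarith [min_le_right μ (T₁ - T)]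
  have ha' : Arc m lam δ T' Γ.x Γ.r Γ.θ := ⟨ht', hT'0, hk, hθT'.le⟩
  have hxT' : Γ.x T' < 0 := by
    have := ha'.x_strictAnti ⟨ha.T_pos.le, hTT'.le⟩ hθ1.le ⟨le_rfl, hTT'.le⟩ ⟨hTT'.le, le_rfl⟩ hTT'
    linarith
  obtain ⟨κ, hκ, hκk⟩ := exists_forall_le_turn ht' hT'0.le hk
  obtain ⟨ν, hν, H⟩ := h.continuous_dependence_turn hT'S hT'0.le
    (lt_min hκ (lt_min (sub_pos.2 hθT') (neg_pos.2 hxT')))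
  refine ⟨ν, hν, fun lam' δ' Γ' hl hd h' => ?_⟩
  obtain ⟨hS', H'⟩ := H lam' δ' Γ' hl hd h'
  have hk' : ∀ s ∈ Icc 0 T', 0 < turn m lam' (Γ'.x s) (Γ'.r s) (Γ'.θ s) := fun s hs => by
    have h1 := (abs_lt.1 ((H' s hs).2.2.2.trans_le (min_le_left _ _))).1
    linarith [hκk s hs]
  have hend := H' T' ⟨hT'0.le, le_rfl⟩
  have hθ' : Γ'.θ T' < π := by
    have := (abs_lt.1 (hend.2.2.1.trans_le ((min_le_right _ _).trans (min_le_left _ _)))).2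
    linarith
  have hx' : Γ'.x T' < 0 := by
    have := (abs_lt.1 (hend.1.trans_le ((min_le_right _ _).trans (min_le_right _ _)))).2
    linarith
  have ha'' : Arc m lam' δ' T' Γ'.x Γ'.r Γ'.θ := ⟨h'.traj hS', hT'0, hk', hθ'.le⟩
  obtain ⟨t, ht, hθt⟩ := h'.exists_vertical hT'0 hS' (fun s hs => ha''.θ_mem_Ioo hs) hx'.le
  have hxt := ha''.x_strictMono (Ioo_subset_Icc_self ht) hθt.le ⟨le_rfl, ht.1.le⟩
    ⟨ht.1.le, le_rfl⟩ ht.1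
  rw [ha''.x_zero] at hxt
  obtain ⟨u, hu, hu'⟩ := intermediate_value_Ioo' ht.2.le
    (ha''.continuousOn_x.mono (Icc_subset_Icc_left ht.1.le)) ⟨hx', hxt⟩
  exact ⟨u, ht.1.trans hu.1, (EReal.coe_lt_coe_iff.2 hu.2).trans hS',
    fun s hs => ha''.θ_mem_Ioo ⟨hs.1, hs.2.trans_lt hu.2⟩, hu'⟩

/-- Nearby solutions also turn horizontal, at nearby points. -/
theorem TurnsAt.persists {L : ℝ} (hL : Γ.TurnsAt L) (h : Γ.IsMaximalSolution (m + 1) lam δ)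
    (hm : 1 ≤ m) {ε : ℝ} (hε : 0 < ε) :
    ∃ ν > 0, ∀ lam' δ' : ℝ, ∀ Γ' : PhaseCurve, |lam' - lam| < ν → |δ' - δ| < ν →
      Γ'.IsMaximalSolution (m + 1) lam' δ' → ∃ L', L' < L + ε ∧ |Γ'.x L' - Γ.x L| < ε ∧
        0 < L' ∧ (L' : EReal) < Γ'.S ∧ (∀ s ∈ Ioo 0 L', Γ'.θ s ∈ Ioo 0 π) ∧ Γ'.θ L' = π := by
  have ha := hL.arc h hm
  obtain ⟨T', hLT', hT'ε, hT'S, hk⟩ := h.exists_turn_pos_gt ha hL.2.1 (ε := ε / 2) (by linarith)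
  have hT'0 : 0 < T' := hL.1.trans hLT'
  have ht' := h.traj hT'S
  have hθm := strictMonoOn_of_deriv_pos' (f := Γ.θ) le_rfl ht'.dθ
    (fun s hs => hk s (Ioo_subset_Icc_self hs))
  set T₁ := max (L / 2) (L - ε / 2) with hT₁
  have hT₁L : T₁ < L := max_lt (by linarith [hL.1]) (by linarith)
  have hT₁0 : 0 < T₁ := lt_of_lt_of_le (by linarith [hL.1]) (le_max_left _ _)
  have hT₁ε : L - ε / 2 ≤ T₁ := le_max_right _ _
  have hθT' : π < Γ.θ T' := by
    rw [← hL.2.2.2.1]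
    exact hθm ⟨hL.1.le, hLT'.le⟩ ⟨hT'0.le, le_rfl⟩ hLT'
  have hθT₁ : Γ.θ T₁ < π := (hL.2.2.1 T₁ ⟨hT₁0, hT₁L⟩).2
  obtain ⟨κ, hκ, hκk⟩ := exists_forall_le_turn ht' hT'0.le hk
  obtain ⟨ν, hν, H⟩ := h.continuous_dependence_turn hT'S hT'0.le
    (lt_min (lt_min hκ (half_pos hε)) (lt_min (sub_pos.2 hθT') (sub_pos.2 hθT₁)))
  refine ⟨ν, hν, fun lam' δ' Γ' hl hd h' => ?_⟩
  obtain ⟨hS', H'⟩ := H lam' δ' Γ' hl hd h'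
  have htr := h'.traj hS'
  have hk' : ∀ s ∈ Icc 0 T', 0 < turn m lam' (Γ'.x s) (Γ'.r s) (Γ'.θ s) := fun s hs => by
    have h1 := (abs_lt.1 ((H' s hs).2.2.2.trans_le ((min_le_left _ _).trans (min_le_left _ _)))).1
    linarith [hκk s hs]
  have hθ1 : π < Γ'.θ T' := by
    have := (abs_lt.1 ((H' T' ⟨hT'0.le, le_rfl⟩).2.2.1.trans_le
      ((min_le_right _ _).trans (min_le_left _ _)))).1
    linarith
  have hθ2 : Γ'.θ T₁ < π := by
    have := (abs_lt.1 ((H' T₁ ⟨hT₁0.le, by linarith⟩).2.2.1.trans_le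
      ((min_le_right _ _).trans (min_le_right _ _)))).2
    linarith
  obtain ⟨L', hL', hL'π⟩ := intermediate_value_Ioo (by linarith : T₁ ≤ T')
    (htr.continuousOn_θ.mono (Icc_subset_Icc_left hT₁0.le)) ⟨hθ2, hθ1⟩
  have hL'0 : 0 < L' := hT₁0.trans hL'.1
  have hL'S : (L' : EReal) < Γ'.S := (EReal.coe_lt_coe_iff.2 hL'.2).trans hS'
  have ha' : Arc m lam' δ' L' Γ'.x Γ'.r Γ'.θ :=
    ⟨h'.traj hL'S, hL'0, fun s hs => hk' s ⟨hs.1, hs.2.trans hL'.2.le⟩, hL'π.le⟩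
  refine ⟨L', by linarith [hL'.2], ?_, hL'0, hL'S, fun s hs => ha'.θ_mem_Ioo hs, hL'π⟩
  have h1 := (H' L' ⟨hL'0.le, hL'.2.le⟩).1.trans_le ((min_le_left _ _).trans (min_le_right _ _))
  have h2 : |Γ.x L' - Γ.x L| ≤ |L' - L| := by
    have hmem : ∀ s, s ∈ Icc 0 T' → HasDerivWithinAt Γ.x (cos (Γ.θ s)) (Icc 0 T') s := fun s hs =>
      (ht'.dx s hs).mono Icc_subset_Ici_self
    have := (convex_Icc 0 T').norm_image_sub_le_of_norm_hasDerivWithin_le (C := 1) hmem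
      (fun s _ => by rw [Real.norm_eq_abs]; exact abs_cos_le_one _)
      (show L ∈ Icc 0 T' from ⟨hL.1.le, hLT'.le⟩) (show L' ∈ Icc 0 T' from ⟨hL'0.le, hL'.2.le⟩)
    simpa using this
  have h3 : |L' - L| ≤ ε / 2 := abs_le.2 ⟨by linarith [hL'.1], by linarith [hL'.2]⟩
  calc |Γ'.x L' - Γ.x L| = |(Γ'.x L' - Γ.x L') + (Γ.x L' - Γ.x L)| := by ring_nf
    _ ≤ _ := abs_add_le _ _
    _ < ε := by linarith

/-- A limit of solutions that cross the axis either crosses the axis or turns horizontal on it. -/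
theorem IsMaximalSolution.turnsAt_of_limit (h : Γ.IsMaximalSolution (m + 1) lam δ) (hm : 1 ≤ m)
    (hlam : lam < 0) (hk : 0 < turn m lam 0 δ 0)
    (hlim : ∀ ν > 0, ∃ δ' : ℝ, ∃ Γ' : PhaseCurve, |δ' - δ| < ν ∧
      Γ'.IsMaximalSolution (m + 1) lam δ' ∧ Γ'.Crosses) (hnot : ¬ Γ.Crosses) :
    ∃ L, Γ.TurnsAt L ∧ Γ.x L = 0 := by
  have hpi := pi_pos
  -- Crossing solutions close to `Γ` are still in their first phase as long as `Γ` is.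
  have hnear : ∀ T : ℝ, 0 ≤ T → (T : EReal) < Γ.S → (∀ s ∈ Icc 0 T, Γ.θ s < π / 2) →
      ∀ η > 0, ∃ δ' T' : ℝ, ∃ Γ' : PhaseCurve, T < T' ∧ Arc m lam δ' T' Γ'.x Γ'.r Γ'.θ ∧
        π / 2 < Γ'.θ T' ∧ Γ'.x T' = 0 ∧ Γ'.θ T < π / 2 ∧ |Γ'.r T - Γ.r T| < η ∧
        |turn m lam (Γ'.x T) (Γ'.r T) (Γ'.θ T) - turn m lam (Γ.x T) (Γ.r T) (Γ.θ T)| < η := by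
    intro T hT0 hTS hlt η hη
    have ht := h.traj hTS
    obtain ⟨u, hu, hmax⟩ := isCompact_Icc.exists_isMaxOn ⟨0, le_rfl, hT0⟩ ht.continuousOn_θ
    have hu' := hlt u hu
    obtain ⟨ν, hν, H⟩ := h.continuous_dependence_turn hTS hT0 (lt_min hη (sub_pos.2 hu'))
    obtain ⟨δ', Γ', hδ', h', hc'⟩ := hlim ν hν
    obtain ⟨T', hT'S, ha, hθ1, -, hx⟩ := IsMaximalSolution.Crosses.exists_arc h' hm hc'
    obtain ⟨hS', H'⟩ := H lam δ' Γ' (by simpa using hν) hδ' h'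
    have hθ' : ∀ s ∈ Icc 0 T, Γ'.θ s < π / 2 := fun s hs => by
      have h1 := (abs_lt.1 ((H' s hs).2.2.1.trans_le (min_le_right _ _))).2
      have h2 : Γ.θ s ≤ Γ.θ u := hmax hs
      linarith
    have hTT' : T < T' := by
      by_contra hle
      linarith [hθ' T' ⟨ha.T_pos.le, not_lt.1 hle⟩]
    have hend := H' T ⟨hT0, le_rfl⟩
    exact ⟨δ', T', Γ', hTT', ha, hθ1, hx, hθ' T ⟨hT0, le_rfl⟩,
      hend.2.1.trans_le (min_le_left _ _), hend.2.2.2.trans_le (min_le_left _ _)⟩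
  -- The approximating crossing curves have positive curvature, so the limit has nonnegative
  -- curvature as long as it stays below the vertical.
  have hk0 : ∀ T : ℝ, 0 ≤ T → (T : EReal) < Γ.S → (∀ s ∈ Icc 0 T, Γ.θ s < π / 2) →
      0 ≤ turn m lam (Γ.x T) (Γ.r T) (Γ.θ T) := by
    intro T hT0 hTS hlt
    by_contra hneg
    obtain ⟨δ', T', Γ', hTT', ha, -, -, -, -, hturn⟩ := hnear T hT0 hTS hlt _ (neg_pos.2 (not_le.1 hneg))
    have := ha.turn_pos T ⟨hT0, hTT'.le⟩
    linarith [(abs_lt.1 hturn).2]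
  have hmono : ∀ T : ℝ, 0 ≤ T → (T : EReal) < Γ.S → (∀ s ∈ Ico 0 T, Γ.θ s < π / 2) →
      MonotoneOn Γ.θ (Icc 0 T) := by
    intro T hT0 hTS hlt
    refine monotoneOn_of_deriv_nonneg le_rfl (h.traj hTS).dθ fun s hs => ?_
    exact hk0 s hs.1.le ((EReal.coe_lt_coe_iff.2 hs.2).trans hTS)
      fun u hu => hlt u ⟨hu.1, hu.2.trans_lt hs.2⟩
  obtain ⟨ε, hε, hεS, hεpos⟩ := h.θ_pos_near_zero hk
  have hpos : ∀ T : ℝ, 0 < T → (T : EReal) < Γ.S → (∀ s ∈ Ico 0 T, Γ.θ s < π / 2) →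
      Γ.θ (min ε T) ≤ Γ.θ T ∧ 0 < Γ.θ (min ε T) := by
    intro T hT0 hTS hlt
    have h1 : 0 < min ε T := lt_min hε hT0
    exact ⟨hmono T hT0.le hTS hlt ⟨h1.le, min_le_right _ _⟩ ⟨hT0.le, le_rfl⟩ (min_le_right _ _),
      hεpos _ ⟨h1, min_le_left _ _⟩⟩
  by_cases hex : ∃ t : ℝ, 0 ≤ t ∧ (t : EReal) < Γ.S ∧ Γ.θ t = π / 2
  · obtain ⟨t₁, ht₁, ht₁S, hθt₁⟩ := hex
    have htr := h.traj ht₁S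
    obtain ⟨t, ⟨htT, ht⟩, hleast⟩ : ∃ t, IsLeast {t | t ∈ Icc 0 t₁ ∧ Γ.θ t = π / 2} t := by
      refine IsCompact.exists_isLeast ?_ ⟨t₁, ⟨ht₁, le_rfl⟩, hθt₁⟩
      have := htr.continuousOn_θ.preimage_isClosed_of_isClosed isClosed_Icc
        (isClosed_singleton (x := π / 2))
      exact isCompact_Icc.of_isClosed_subset this fun s hs => hs.1
    have htS : (t : EReal) < Γ.S := (EReal.coe_le_coe_iff.2 htT.2).trans_lt ht₁S
    have ht0 : 0 < t := by
      refine lt_of_le_of_ne htT.1 fun he => ?_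
      rw [← he, htr.θ_zero] at ht
      linarith
    have hlt : ∀ s ∈ Ico 0 t, Γ.θ s < π / 2 := by
      intro s hs
      by_contra hge
      obtain ⟨u, hu, hu'⟩ := intermediate_value_Icc hs.1 (htr.continuousOn_θ.mono
        (Icc_subset_Icc_right (hs.2.le.trans htT.2)))
        (show π / 2 ∈ Icc (Γ.θ 0) (Γ.θ s) by rw [htr.θ_zero]; exact ⟨by linarith, not_lt.1 hge⟩)
      exact absurd (hleast ⟨⟨hu.1, hu.2.trans (hs.2.le.trans htT.2)⟩, hu'⟩)
        (not_le.2 (hu.2.trans_lt hs.2))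
    have hmem : ∀ s ∈ Ioo 0 t, Γ.θ s ∈ Ioo 0 π := by
      intro s hs
      obtain ⟨h1, h2⟩ := hpos s hs.1 ((EReal.coe_lt_coe_iff.2 hs.2).trans htS)
        fun u hu => hlt u ⟨hu.1, hu.2.trans hs.2⟩
      exact ⟨h2.trans_le h1, (hlt s ⟨hs.1.le, hs.2⟩).trans (by linarith)⟩
    rcases h.crosses_or_turnsAt hm ht0 htS hmem ht with hc | ⟨L, -, hL⟩
    · exact absurd hc hnot
    refine ⟨L, hL, ?_⟩
    by_contra hne
    -- If the limit turned at `x > 0`, so would the nearby curves, and a curve turning at `x > 0`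
    -- does not cross.
    have hxL : 0 < Γ.x L := lt_of_le_of_ne hL.2.2.2.2 (Ne.symm hne)
    obtain ⟨ν, hν, H⟩ := hL.persists h hm hxL
    obtain ⟨δ', Γ', hδ', h', hc'⟩ := hlim ν hν
    obtain ⟨L', -, hx', hL'0, hL'S, hθ', hL'π⟩ := H lam δ' Γ' (by simpa using hν) hδ' h'
    have : Γ'.TurnsAt L' := ⟨hL'0, hL'S, hθ', hL'π, by linarith [(abs_lt.1 hx').1]⟩
    exact this.not_crosses h' hm hc'
  -- If the limit never became vertical, it would be a global graph with `r → ∞`. A nearby crossing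
  -- curve would then become vertical very far out, with `x > -λ` by convexity, and by
  -- `le_x_of_turning` it could not come back to `x = 0`.
  · exfalso
    have hlt : ∀ T : ℝ, 0 ≤ T → (T : EReal) < Γ.S → Γ.θ T < π / 2 := by
      intro T hT0 hTS
      by_contra hge
      obtain ⟨u, hu, hu'⟩ := intermediate_value_Icc hT0 (h.traj hTS).continuousOn_θ
        (show π / 2 ∈ Icc (Γ.θ 0) (Γ.θ T) by
          rw [(h.traj hTS).θ_zero]; exact ⟨by linarith, not_lt.1 hge⟩)
      exact hex ⟨u, hu.1, (EReal.coe_le_coe_iff.2 hu.2).trans_lt hTS, hu'⟩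
    have hlt' : ∀ T : ℝ, (T : EReal) < Γ.S → ∀ s ∈ Ico 0 T, Γ.θ s < π / 2 := fun T hTS s hs =>
      hlt s hs.1 ((EReal.coe_lt_coe_iff.2 hs.2).trans hTS)
    have hθ0 : ∀ T : ℝ, 0 ≤ T → (T : EReal) < Γ.S → 0 ≤ Γ.θ T := by
      intro T hT0 hTS
      have := hmono T hT0 hTS (hlt' T hTS) ⟨le_rfl, hT0⟩ ⟨hT0, le_rfl⟩ hT0
      rwa [(h.traj hTS).θ_zero] at this
    have hrm : ∀ T : ℝ, 0 ≤ T → (T : EReal) < Γ.S → δ ≤ Γ.r T := by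
      intro T hT0 hTS
      have := monotoneOn_of_deriv_nonneg le_rfl (h.traj hTS).dr (fun s hs => by
        have hsS := (EReal.coe_lt_coe_iff.2 hs.2).trans hTS
        exact sin_nonneg_of_nonneg_of_le_pi (hθ0 s hs.1.le hsS)
          (by linarith [hlt s hs.1.le hsS])) ⟨le_rfl, hT0⟩ ⟨hT0, le_rfl⟩ hT0
      rwa [(h.traj hTS).r_zero] at this
    have hS : Γ.S = ⊤ := h.S_eq_top h.pos hrm
    have hltS : ∀ T : ℝ, (T : EReal) < Γ.S := fun T => by rw [hS]; exact EReal.coe_lt_top T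
    have hσ : 0 < sin (Γ.θ ε) :=
      sin_pos_of_pos_of_lt_pi (hεpos ε ⟨hε, le_rfl⟩) (by linarith [hlt ε hε.le hεS])
    set σ := sin (Γ.θ ε) with hσdef
    -- The value makes the turning rate `K = r - m / r + λ` at the vertical point at least `π /
    -- (-λ)`, so that `x` loses at most `-λ / 2` afterwards. One unit is spent on the approximation
    -- error in `r`.
    set R := m + 2 - lam + π / (-lam) with hR
    have hdiv : 0 < π / (-lam) := div_pos hpi (by linarith)
    have hRpos : 0 < R := by
      have : (0 : ℝ) ≤ m := m.cast_nonneg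
      linarith
    set T := ε + R / σ with hTdef
    have hεT : ε ≤ T := by have : 0 < R / σ := by positivity
                           linarith
    have hrT : R ≤ Γ.r T := by
      have := monotoneOn_of_deriv_nonneg (f := fun s => Γ.r s - σ * s) hε.le
        (fun s hs => ((h.traj (hltS T)).dr s ⟨hε.le.trans hs.1, hs.2⟩).sub
          ((hasDerivWithinAt_id s (Ici 0)).const_mul σ))
        (fun s hs => by
          have h1 := hmono T (by linarith) (hltS T) (hlt' T (hltS T)) ⟨hε.le, hεT⟩
            ⟨hε.le.trans hs.1.le, hs.2.le⟩ hs.1.le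
          have h2 := sin_le_sin_of_le_of_le_pi_div_two
            (by linarith [hεpos ε ⟨hε, le_rfl⟩]) (hlt s (hε.le.trans hs.1.le) (hltS s)).le h1
          simp only [mul_one]
          linarith) ⟨le_rfl, hεT⟩ ⟨hεT, le_rfl⟩ hεT
      simp only at this
      have e : σ * T = σ * ε + R := by rw [hTdef]; field_simp
      have := hrm ε hε.le hεS
      linarith [h.pos]
    obtain ⟨δ', T', Γ', hTT', ha, hθ1, hx, hθT, hr', -⟩ := hnear T (by linarith) (hltS T)
      (fun s hs => hlt s hs.1 (hltS s)) 1 one_pos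
    obtain ⟨a, haT, hθa⟩ := ha.exists_θ_eq (b := π / 2) (by linarith) hθ1.le
    have hTa : T < a := by
      by_contra hle
      have := ha.θ_strictMono.monotoneOn haT ⟨by linarith, hTT'.le⟩ (not_lt.1 hle)
      linarith
    have hra : R - 1 ≤ Γ'.r a := by
      have := ha.r_strictMono ⟨by linarith, hTT'.le⟩ haT hTa
      linarith [(abs_lt.1 hr').1]
    have hxa : -lam < Γ'.x a := by
      have := ha.turn_pos a haT
      rw [turn, hθa] at this
      simp at this
      linarith
    have hr1 : 1 ≤ Γ'.r a := by
      have : (0 : ℝ) ≤ m := m.cast_nonneg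
      linarith
    have hK : π / (-lam) < Γ'.r a - m / Γ'.r a + lam + 1 := by
      have : (m : ℝ) / Γ'.r a ≤ m := div_le_self m.cast_nonneg hr1
      linarith
    have hK' : π / (-lam) ≤ Γ'.r a - m / Γ'.r a + lam := by
      have : (m : ℝ) / Γ'.r a ≤ m := div_le_self m.cast_nonneg hr1
      linarith
    have hK0 : 0 < Γ'.r a - m / Γ'.r a + lam := hdiv.trans_le hK'
    have hle := ha.le_x_of_turning hlam.le haT hθa.ge hxa.le hK0 ⟨haT.2, le_rfl⟩
    rw [hx] at hle
    have : π / 2 / (Γ'.r a - m / Γ'.r a + lam) ≤ -lam / 2 := by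
      rw [div_le_iff₀ hK0]
      rw [div_le_iff₀ (by linarith)] at hK'
      nlinarith
    linarith

end PhaseCurve

end LambdaHypersurface
end

/-! ### Estimates for thin necks. -/

noncomputable section

namespace LambdaHypersurface

open Set Filter Real

namespace Arc

variable {m : ℕ} {lam δ T : ℝ} {x r θ : ℝ → ℝ}

/-- In `pow_mul_exp_hasDeriv` the term with `x ≥ 0` has a favourable sign. The rest is at most `-λ r
^ m r'`, which integrates to `-λ r ^ (m + 1) / (m + 1)`. -/
lemma pow_mul_exp_mul_cos_le (h : Arc m lam δ T x r θ) (hlam : lam ≤ 0)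
    (hx : 0 ≤ x T) {t : ℝ} (ht : t ∈ Icc 0 T) :
    r t ^ m * exp (-(r t) ^ 2 / 2) * cos (θ t) ≤ δ ^ m - lam * (r t ^ (m + 1) / (m + 1)) := by
  have hanti := antitoneOn_of_deriv_nonpos
    (f := fun s => r s ^ m * exp (-(r s) ^ 2 / 2) * cos (θ s) + lam * (r s ^ (m + 1) / (m + 1))) le_rfl
    (fun s hs => (h.pow_mul_exp_hasDeriv hs).add
      ((((h.dr s hs).pow (m + 1)).div_const ((m : ℝ) + 1)).const_mul lam))
    (fun s hs => by
      have hs' := Ioo_subset_Icc_self hs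
      have h1 := h.sin_nonneg hs'
      have h2 := h.x_nonneg hx hs'
      have hr := h.r_pos s hs'
      have h3 : exp (-(r s) ^ 2 / 2) ≤ 1 := exp_le_one_iff.2 (by nlinarith [sq_nonneg (r s)])
      have h4 : 0 < r s ^ m := by positivity
      have h5 := exp_pos (-(r s) ^ 2 / 2)
      have e : ((m + 1 : ℕ) : ℝ) * r s ^ (m + 1 - 1) * sin (θ s) / ((m : ℝ) + 1)
          = r s ^ m * sin (θ s) := by
        push_cast; field_simp
      rw [e]
      have h6 := mul_nonneg (mul_nonneg h4.le h1) (mul_nonneg (neg_nonneg.2 hlam) (sub_nonneg.2 h3))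
      have h7 := mul_nonneg (mul_nonneg (mul_nonneg h4.le h5.le) h1) (mul_nonneg h2 h1)
      nlinarith) h.zero_mem ht ht.1
  simp only [h.r_zero, h.θ_zero, cos_zero, mul_one] at hanti
  have hδ := h.δ_pos
  have h3 : exp (-δ ^ 2 / 2) ≤ 1 := exp_le_one_iff.2 (by nlinarith [sq_nonneg δ])
  have h4 : δ ^ m * exp (-δ ^ 2 / 2) ≤ δ ^ m := mul_le_of_le_one_right (by positivity) h3
  have h5 : lam * (δ ^ (m + 1) / (m + 1)) ≤ 0 :=
    mul_nonpos_of_nonpos_of_nonneg hlam (by positivity)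
  linarith

/-- Division of the previous bound by the weight. The weaker `δ / r` in place of `(δ / r) ^ m` is
enough and makes the later estimate logarithmic for every `m ≥ 1`. -/
lemma cos_le (h : Arc m lam δ T x r θ) (hm : 1 ≤ m) (hlam : lam ≤ 0) (hx : 0 ≤ x T) {t : ℝ}
    (ht : t ∈ Icc 0 T) :
    cos (θ t) ≤ exp (r t ^ 2 / 2) * (δ / r t - lam * (r t / (m + 1))) := by
  have h1 := h.pow_mul_exp_mul_cos_le hlam hx ht
  have hr := h.r_pos t ht
  have hδ := h.δ_pos
  have hle : δ / r t ≤ 1 := (div_le_one hr).2 (h.le_r ht)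
  have h2 : (δ / r t) ^ m ≤ δ / r t := pow_le_of_le_one (by positivity) hle (by omega)
  have e : cos (θ t) = exp (r t ^ 2 / 2) * (r t ^ m * exp (-(r t) ^ 2 / 2) * cos (θ t)) / r t ^ m := by
    have : exp (r t ^ 2 / 2) * exp (-(r t) ^ 2 / 2) = 1 := by
      rw [← exp_add]; ring_nf; exact exp_zero
    generalize exp (-(r t) ^ 2 / 2) = G at this ⊢
    field_simp
    linear_combination -cos (θ t) * this
  have h3 : exp (r t ^ 2 / 2) * (r t ^ m * exp (-(r t) ^ 2 / 2) * cos (θ t)) / r t ^ m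
      ≤ exp (r t ^ 2 / 2) * (δ ^ m - lam * (r t ^ (m + 1) / (m + 1))) / r t ^ m := by gcongr
  have h4 : exp (r t ^ 2 / 2) * (δ ^ m - lam * (r t ^ (m + 1) / (m + 1))) / r t ^ m
      = exp (r t ^ 2 / 2) * ((δ / r t) ^ m - lam * (r t / (m + 1))) := by
    rw [div_pow]; field_simp; ring
  rw [e]
  refine h3.trans (h4.le.trans ?_)
  gcongr

/-- At `r = 3 δ` the bound `cos_le` gives `cos θ ≤ 11 / 10 * (1 / 3 + 1 / 16) < 1 / 2`, so the angle
already exceeds `π / 3` there. -/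
lemma r_le_of_θ_le (h : Arc m lam δ T x r θ) (hm : 1 ≤ m) (hlam : lam ≤ 0) (hlam' : -1 ≤ lam)
    (hδ : δ ≤ 1 / 48) (hx : 0 ≤ x T) {t : ℝ} (ht : t ∈ Icc 0 T) (hθ : θ t ≤ π / 3) :
    r t ≤ 3 * δ := by
  by_contra hlt
  rw [not_le] at hlt
  have hδ0 := h.δ_pos
  obtain ⟨u, hu, hru⟩ := intermediate_value_Icc ht.1
    (h.continuousOn_r.mono (Icc_subset_Icc_right ht.2))
    (show 3 * δ ∈ Icc (r 0) (r t) by rw [h.r_zero]; exact ⟨by linarith, hlt.le⟩)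
  have hu' : u ∈ Icc 0 T := ⟨hu.1, hu.2.trans ht.2⟩
  have h1 := h.cos_le hm hlam hx hu'
  have h2 : θ u ≤ π / 3 := (h.θ_strictMono.monotoneOn hu' ht hu.2).trans hθ
  have h3 : 1 / 2 ≤ cos (θ u) := by
    rw [← cos_pi_div_three]
    exact cos_le_cos_of_nonneg_of_le_pi (h.θ_mem_Icc hu').1 (by linarith [pi_pos]) h2
  rw [hru] at h1
  have h4 : exp ((3 * δ) ^ 2 / 2) ≤ 11 / 10 := by
    have h5 : (3 * δ) ^ 2 / 2 ≤ 1 / 100 := by nlinarith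
    have h6 := one_sub_le_exp_neg (1 / 100 : ℝ)
    have h7 : exp (1 / 100 : ℝ) * exp (-(1 / 100)) = 1 := by rw [← exp_add]; simp
    have h8 := exp_le_exp.2 h5
    nlinarith [exp_pos (1 / 100 : ℝ)]
  have h5 : δ / (3 * δ) - lam * (3 * δ / (m + 1)) ≤ 1 / 3 + 1 / 16 := by
    have e1 : δ / (3 * δ) = 1 / 3 := by field_simp
    have e2 : 3 * δ / ((m : ℝ) + 1) ≤ 1 / 16 := by
      refine (div_le_self (by linarith) (by linarith [m.cast_nonneg (α := ℝ)])).trans (by linarith)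
    have e3 : 0 ≤ 3 * δ / ((m : ℝ) + 1) := by positivity
    rw [e1]; nlinarith
  have h6 : exp ((3 * δ) ^ 2 / 2) * (δ / (3 * δ) - lam * (3 * δ / (m + 1)))
      ≤ 11 / 10 * (1 / 3 + 1 / 16) := by
    refine (mul_le_mul_of_nonneg_left h5 (exp_pos _).le).trans ?_
    exact mul_le_mul_of_nonneg_right h4 (by norm_num)
  linarith

/-- While `θ ≤ π / 3` one has `r ≤ 3 δ`, hence `θ' ≥ 1 / (12 δ)`. The time spent is therefore at
most `4 π δ ≤ 13 δ`. -/
lemma le_of_θ_le (h : Arc m lam δ T x r θ) (hm : 1 ≤ m) (hlam : lam ≤ 0) (hlam' : -1 ≤ lam)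
    (hδ : δ ≤ 1 / 48) (hx : 0 ≤ x T) {t : ℝ} (ht : t ∈ Icc 0 T) (hθ : θ t ≤ π / 3) :
    t ≤ 13 * δ := by
  have hδ0 := h.δ_pos
  have hsub : ∀ s ∈ Icc 0 t, s ∈ Icc 0 T := fun s hs => ⟨hs.1, hs.2.trans ht.2⟩
  have hmono := monotoneOn_of_deriv_nonneg (f := fun s => θ s - 1 / (12 * δ) * s) le_rfl
    (fun s hs => (h.dθ s (hsub s hs)).sub ((hasDerivWithinAt_id s (Ici 0)).const_mul _))
    (fun s hs => by
      have hs' := hsub s (Ioo_subset_Icc_self hs)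
      have h2 : θ s ≤ π / 3 := (h.θ_strictMono.monotoneOn hs' ht hs.2.le).trans hθ
      have h3 : 1 / 2 ≤ cos (θ s) := by
        rw [← cos_pi_div_three]
        exact cos_le_cos_of_nonneg_of_le_pi (h.θ_mem_Icc hs').1 (by linarith [pi_pos]) h2
      have hr := h.r_le_of_θ_le hm hlam hlam' hδ hx hs' h2
      have hr0 := h.r_pos s hs'
      have h4 : 1 / (3 * δ) ≤ m / r s := by
        have : (1 : ℝ) ≤ m := by exact_mod_cast hm
        gcongr
      have h5 := mul_nonneg (h.x_nonneg hx hs') (h.sin_nonneg hs')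
      have h6 : 48 ≤ 1 / δ := by rw [le_div_iff₀ hδ0]; linarith
      have e1 : 1 / (3 * δ) = 1 / 3 * (1 / δ) := by field_simp
      have e2 : 1 / (12 * δ) = 1 / 12 * (1 / δ) := by field_simp
      rw [turn, e2]
      rw [e1] at h4
      simp only [mul_one]
      nlinarith) ⟨le_rfl, ht.1⟩ ⟨ht.1, le_rfl⟩ ht.1
  simp only [h.θ_zero] at hmono
  have h1 : 1 / (12 * δ) * t ≤ π / 3 := by linarith
  rw [one_div, inv_mul_le_iff₀ (by positivity)] at h1
  nlinarith [pi_lt_d2]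

/-- The initial phase `θ ≤ π / 3` contributes at most `13 δ`. Afterwards `sin θ ≥ 1 / 2` wherever
`cos θ > 0`, and `cos_le` becomes a bound on `dx / dr` whose integral is the function `F` below. -/
lemma x_le_log (h : Arc m lam δ T x r θ) (hm : 1 ≤ m) (hlam : lam ≤ 0) (hlam' : -1 ≤ lam)
    (hδ : δ ≤ 1 / 48) (hx : 0 ≤ x T) {t : ℝ} (ht : t ∈ Icc 0 T) :
    x t ≤ 13 * δ + 2 * exp (r T ^ 2 / 2) *
      (δ * (log (r T) - log δ) - lam * (r T ^ 2 / (2 * (m + 1)))) := by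
  have hδ0 := h.δ_pos
  set E := exp (r T ^ 2 / 2) with hE
  have hE0 : 0 < E := exp_pos _
  set F : ℝ → ℝ := fun b => δ * log b - lam * (b ^ 2 / (2 * (m + 1))) with hF
  have hm1 : (0 : ℝ) < 2 * (m + 1) := by positivity
  have hFmono : ∀ a b : ℝ, 0 < a → a ≤ b → F a ≤ F b := by
    intro a b ha hab
    have h1 := mul_le_mul_of_nonneg_left (log_le_log ha hab) hδ0.le
    have h2 : a ^ 2 / (2 * (m + 1)) ≤ b ^ 2 / (2 * ((m : ℝ) + 1)) := by gcongr
    have h3 := mul_le_mul_of_nonneg_left h2 (neg_nonneg.2 hlam)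
    simp only [hF]
    linarith
  have hrT := h.le_r h.end_mem
  have hFδ : δ * log δ ≤ F δ := by
    have : 0 ≤ -lam * (δ ^ 2 / (2 * (m + 1))) := mul_nonneg (by linarith) (by positivity)
    simp only [hF]; linarith
  have hgoal : δ * (log (r T) - log δ) - lam * (r T ^ 2 / (2 * (m + 1))) = F (r T) - δ * log δ := by
    simp only [hF]; ring
  rw [hgoal]
  have hnn : 0 ≤ F (r T) - δ * log δ := by linarith [hFmono δ (r T) hδ0 hrT]
  rcases le_or_gt (θ t) (π / 3) with hle | hgt
  · have h1 := h.le_of_θ_le hm hlam hlam' hδ hx ht hle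
    have h2 := h.x_le ht
    have : 0 ≤ 2 * E * (F (r T) - δ * log δ) := by positivity
    linarith
  obtain ⟨a, ha, hθa⟩ := intermediate_value_Icc ht.1
    (h.continuousOn_θ.mono (Icc_subset_Icc_right ht.2))
    (show π / 3 ∈ Icc (θ 0) (θ t) by rw [h.θ_zero]; exact ⟨by linarith [pi_pos], hgt.le⟩)
  have ha' : a ∈ Icc 0 T := ⟨ha.1, ha.2.trans ht.2⟩
  have hxa := (h.x_le ha').trans (h.le_of_θ_le hm hlam hlam' hδ hx ha' hθa.le)
  have hsub : ∀ s ∈ Icc a t, s ∈ Icc 0 T := fun s hs => ⟨ha.1.trans hs.1, hs.2.trans ht.2⟩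
  have hanti := antitoneOn_of_deriv_nonpos (f := fun s => x s - 2 * E * F (r s)) ha.1
    (f' := fun s => cos (θ s) - 2 * E * (δ / r s - lam * (r s / (m + 1))) * sin (θ s))
    (fun s hs => by
      have hs' := hsub s hs
      have hr := (h.r_pos s hs').ne'
      refine ((h.dx s hs').sub (((((h.dr s hs').log hr).const_mul δ).sub
        ((((h.dr s hs').pow 2).div_const (2 * ((m : ℝ) + 1))).const_mul lam)).const_mul (2 * E))).congr_deriv ?_
      field_simp
      norm_num
      ring)
    (fun s hs => by
      have hs' := hsub s (Ioo_subset_Icc_self hs)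
      have hr := h.r_pos s hs'
      have hb : 0 ≤ δ / r s - lam * (r s / (m + 1)) := by
        have : 0 ≤ -lam * (r s / (m + 1)) := mul_nonneg (by linarith) (by positivity)
        have : 0 < δ / r s := by positivity
        linarith
      have hs0 := h.sin_nonneg hs'
      rcases le_or_gt (cos (θ s)) 0 with hc | hc
      · have : 0 ≤ 2 * E * (δ / r s - lam * (r s / (m + 1))) * sin (θ s) := by positivity
        linarith
      · have h1 := h.cos_le hm hlam hx hs'
        have h2 : r s ≤ r T := h.r_strictMono.monotoneOn hs' h.end_mem hs'.2
        have h3 : exp (r s ^ 2 / 2) ≤ E := exp_le_exp.2 (by gcongr)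
        have h4 : cos (θ s) ≤ E * (δ / r s - lam * (r s / (m + 1))) :=
          h1.trans (mul_le_mul_of_nonneg_right h3 hb)
        have h5 : θ s < π / 2 := by
          by_contra hge
          exact absurd (h.cos_nonpos hs' (not_lt.1 hge) ⟨le_rfl, hs'.2⟩) (not_le.2 hc)
        have h6 : π / 3 ≤ θ s := by
          rw [← hθa]; exact h.θ_strictMono.monotoneOn ha' hs' hs.1.le
        have h7 : 1 / 2 ≤ sin (θ s) := by
          rw [← sin_pi_div_six]
          exact sin_le_sin_of_le_of_le_pi_div_two (by linarith [pi_pos]) h5.le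
            (by linarith [pi_pos])
        have h8 : 0 ≤ E * (δ / r s - lam * (r s / (m + 1))) := by positivity
        nlinarith) ⟨le_rfl, ha.2⟩ ⟨ha.2, le_rfl⟩ ha.2
  simp only at hanti
  have h1 := hFmono (r t) (r T) (h.r_pos t ht) (h.r_strictMono.monotoneOn ht h.end_mem ht.2)
  have h2 := hFmono δ (r a) hδ0 (h.le_r ha')
  have h3 : 2 * E * (F (r t) - F (r a)) ≤ 2 * E * (F (r T) - δ * log δ) := by
    have : F (r t) - F (r a) ≤ F (r T) - δ * log δ := by linarith
    gcongr
  linarith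

/-- Counterpart of `pow_mul_exp_mul_cos_le`: an upper bound `X` for `x` limits how fast the weighted
cosine can decrease, so the curve cannot lean back much while `x` is small. -/
lemma neg_le_cos (h : Arc m lam δ T x r θ) (hlam : lam ≤ 0) (hx : 0 ≤ x T) {X : ℝ}
    (hX : ∀ s ∈ Icc 0 T, x s ≤ X) {t : ℝ} (ht : t ∈ Icc 0 T) :
    δ ^ m * exp (-δ ^ 2 / 2) + X * (δ ^ (m + 1) / (m + 1)) ≤
      r t ^ m * exp (-(r t) ^ 2 / 2) * cos (θ t) + X * (r t ^ (m + 1) / (m + 1)) := by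
  have hmono := monotoneOn_of_deriv_nonneg
    (f := fun s => r s ^ m * exp (-(r s) ^ 2 / 2) * cos (θ s) + X * (r s ^ (m + 1) / (m + 1))) le_rfl
    (fun s hs => (h.pow_mul_exp_hasDeriv hs).add
      ((((h.dr s hs).pow (m + 1)).div_const ((m : ℝ) + 1)).const_mul X))
    (fun s hs => by
      have hs' := Ioo_subset_Icc_self hs
      have h1 := h.sin_nonneg hs'
      have h2 := h.x_nonneg hx hs'
      have hr := h.r_pos s hs'
      have h3 : exp (-(r s) ^ 2 / 2) ≤ 1 := exp_le_one_iff.2 (by nlinarith [sq_nonneg (r s)])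
      have h4 : 0 < r s ^ m := by positivity
      have h5 := exp_pos (-(r s) ^ 2 / 2)
      have e : ((m + 1 : ℕ) : ℝ) * r s ^ (m + 1 - 1) * sin (θ s) / ((m : ℝ) + 1)
          = r s ^ m * sin (θ s) := by
        push_cast; field_simp
      rw [e]
      have h6 : exp (-(r s) ^ 2 / 2) * (x s * sin (θ s) + lam) ≤ X := by
        have a1 : x s * sin (θ s) ≤ x s := mul_le_of_le_one_right h2 (sin_le_one _)
        have a2 := hX s hs'
        have a3 : exp (-(r s) ^ 2 / 2) * (x s * sin (θ s) + lam) ≤ exp (-(r s) ^ 2 / 2) * x s :=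
          mul_le_mul_of_nonneg_left (by linarith) h5.le
        have a4 : exp (-(r s) ^ 2 / 2) * x s ≤ x s := mul_le_of_le_one_left h2 h3
        linarith
      have h7 := mul_nonneg (mul_nonneg h4.le h1) (sub_nonneg.2 h6)
      nlinarith) h.zero_mem ht ht.1
  simpa [h.r_zero, h.θ_zero] using hmono

end Arc

lemma exists_small (A C : ℝ) {η : ℝ} (hη : 0 < η) :
    ∃ δ₀ > 0, ∀ δ, 0 < δ → δ ≤ δ₀ → A * δ - C * (δ * log δ) < η := by
  have hc : Continuous fun δ : ℝ => A * δ - C * (δ * log δ) := by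
    have := continuous_mul_log
    fun_prop
  have h0 : (fun δ : ℝ => A * δ - C * (δ * log δ)) 0 < η := by simpa using hη
  obtain ⟨ε, hε, hball⟩ := Metric.eventually_nhds_iff.1 (hc.continuousAt.eventually (gt_mem_nhds h0))
  refine ⟨ε / 2, by linarith, fun δ h1 h2 => hball ?_⟩
  rw [Real.dist_eq, sub_zero, abs_of_pos h1]
  linarith

/-- For small `δ` and `λ`, arcs stay close to the hyperplane `x = 0` on compact sets. -/
theorem Arc.small (m : ℕ) (hm : 1 ≤ m) {M η : ℝ} (hM : 1 ≤ M) (hη : 0 < η) :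
    ∃ δ₀ > 0, ∃ c₀ > 0, δ₀ ≤ 1 / 48 ∧ c₀ ≤ 1 ∧ ∀ (lam δ T : ℝ) (x r θ : ℝ → ℝ), Arc m lam δ T x r θ →
      lam ≤ 0 → -c₀ ≤ lam → δ ≤ δ₀ → 0 ≤ x T → r T ≤ M →
      ∀ t ∈ Icc 0 T, x t ≤ η ∧ -(1 / 2) ≤ cos (θ t) := by
  have hM0 : 0 < M := by linarith
  set E := exp (M ^ 2 / 2) with hE
  have hE0 : 0 < E := exp_pos _
  -- The second entry yields `cos θ ≥ -(η' * E * M) ≥ -1 / 2`.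
  set η' := min η (1 / (2 * M * E)) with hη'
  have hη'0 : 0 < η' := lt_min hη (by positivity)
  obtain ⟨δ₀, hδ₀, hsmall⟩ := exists_small (13 + 2 * E * log M) (2 * E) (half_pos hη'0)
  -- The contributions of `δ` and of `λ` to the logarithmic bound on `x` are each made at most `η' /
  -- 2`.
  refine ⟨min δ₀ (1 / 48), lt_min hδ₀ (by norm_num), min 1 (η' / (2 * E * M ^ 2)),
    lt_min one_pos (by positivity), min_le_right _ _, min_le_left _ _, ?_⟩
  intro lam δ T x r θ h hlam hlam' hδ hx hrT
  have hδ0 := h.δ_pos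
  have hl1 : -1 ≤ lam := le_trans (neg_le_neg (min_le_left _ _)) hlam'
  have hl2 : -lam ≤ η' / (2 * E * M ^ 2) := by
    have := min_le_right 1 (η' / (2 * E * M ^ 2)); linarith
  have hrT0 : 0 < r T := h.r_pos T h.end_mem
  have hm1 : (1 : ℝ) ≤ m := by exact_mod_cast hm
  have hX : ∀ t ∈ Icc 0 T, x t ≤ η' := by
    intro t ht
    have h1 := h.x_le_log hm hlam hl1 (hδ.trans (min_le_right _ _)) hx ht
    have h2 := hsmall δ hδ0 (hδ.trans (min_le_left _ _))
    have h3 : exp (r T ^ 2 / 2) ≤ E := exp_le_exp.2 (by gcongr)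
    have h4 : log (r T) ≤ log M := log_le_log hrT0 hrT
    have h5 : log δ ≤ log (r T) := log_le_log hδ0 (h.le_r h.end_mem)
    have h6 : r T ^ 2 / (2 * ((m : ℝ) + 1)) ≤ M ^ 2 / 2 := by
      have : r T ^ 2 ≤ M ^ 2 := by gcongr
      refine div_le_div₀ (by positivity) this (by norm_num) (by linarith)
    have h7 : δ * (log (r T) - log δ) - lam * (r T ^ 2 / (2 * (m + 1)))
        ≤ δ * (log M - log δ) + -lam * (M ^ 2 / 2) := by
      have a1 := mul_le_mul_of_nonneg_left h4 hδ0.le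
      have a2 := mul_le_mul_of_nonneg_left h6 (neg_nonneg.2 hlam)
      linarith
    have h8 : 0 ≤ δ * (log M - log δ) + -lam * (M ^ 2 / 2) := by
      have a1 := mul_nonneg hδ0.le (by linarith : 0 ≤ log M - log δ)
      have a2 := mul_nonneg (neg_nonneg.2 hlam) (by positivity : 0 ≤ M ^ 2 / 2)
      linarith
    have h9 : 2 * exp (r T ^ 2 / 2) * (δ * (log (r T) - log δ) - lam * (r T ^ 2 / (2 * (m + 1))))
        ≤ 2 * E * (δ * (log M - log δ) + -lam * (M ^ 2 / 2)) := by
      refine (mul_le_mul_of_nonneg_left h7 (by positivity)).trans ?_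
      exact mul_le_mul_of_nonneg_right (by linarith) h8
    have h10 : 2 * E * (-lam * (M ^ 2 / 2)) ≤ η' / 2 := by
      have := mul_le_mul_of_nonneg_left hl2 (by positivity : 0 ≤ E * M ^ 2)
      have e : E * M ^ 2 * (η' / (2 * E * M ^ 2)) = η' / 2 := by field_simp
      linarith
    linarith
  intro t ht
  refine ⟨(hX t ht).trans (min_le_left _ _), ?_⟩
  have h1 := h.neg_le_cos hlam hx hX ht
  have hr := h.r_pos t ht
  have hrM : r t ≤ M := (h.r_strictMono.monotoneOn ht h.end_mem ht.2).trans hrT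
  have h2 : 0 ≤ δ ^ m * exp (-δ ^ 2 / 2) + η' * (δ ^ (m + 1) / (m + 1)) := by positivity
  have h3 : r t ^ m * exp (-(r t) ^ 2 / 2) * cos (θ t) + η' * (r t ^ (m + 1) / (m + 1))
      = r t ^ m * exp (-(r t) ^ 2 / 2) * (cos (θ t) + η' * exp (r t ^ 2 / 2) * r t / (m + 1)) := by
    have : exp (r t ^ 2 / 2) * exp (-(r t) ^ 2 / 2) = 1 := by
      rw [← exp_add]; ring_nf; exact exp_zero
    generalize exp (-(r t) ^ 2 / 2) = G at this ⊢
    rw [pow_succ]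
    field_simp
    linear_combination -(η' * r t) * this
  rw [h3] at h1
  have h4 := nonneg_of_mul_nonneg_right (h2.trans h1) (by positivity)
  have h5 : η' * exp (r t ^ 2 / 2) * r t / (m + 1) ≤ η' * E * M := by
    refine (div_le_self (by positivity) (by linarith)).trans ?_
    have : exp (r t ^ 2 / 2) ≤ E := exp_le_exp.2 (by gcongr)
    gcongr
  have h6 : η' * E * M ≤ 1 / 2 := by
    have := mul_le_mul_of_nonneg_right (min_le_right η (1 / (2 * M * E))) (by positivity : 0 ≤ E * M)
    have e : 1 / (2 * M * E) * (E * M) = 1 / 2 := by field_simp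
    rw [e] at this
    linarith
  linarith

/-- For small `δ` and `λ`, the curves that turn horizontal do so far from the axis. -/
theorem Arc.far (m : ℕ) (hm : 1 ≤ m) (M : ℝ) :
    ∃ δ₀ > 0, ∃ c₀ > 0, ∀ (lam δ T : ℝ) (x r θ : ℝ → ℝ), Arc m lam δ T x r θ →
      lam ≤ 0 → -c₀ ≤ lam → δ ≤ δ₀ → 0 ≤ x T → θ T = π → M < r T := by
  obtain ⟨δ₀, hδ₀, c₀, hc₀, -, -, H⟩ := Arc.small m hm (le_max_left 1 M) one_pos
  refine ⟨δ₀, hδ₀, c₀, hc₀, fun lam δ T x r θ h hlam hlam' hδ hx hθ => ?_⟩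
  by_contra hle
  have := (H lam δ T x r θ h hlam hlam' hδ hx ((not_lt.1 hle).trans (le_max_right _ _)) T h.end_mem).2
  rw [hθ, cos_pi] at this
  norm_num at this

end LambdaHypersurface
end

/-! ### Negative `λ` and very small `δ`: no return. -/

noncomputable section

namespace LambdaHypersurface

open Set Filter Real

set_option maxHeartbeats 1000000 in
/-- For fixed `λ < 0` and small `δ`, the curve does not return to the axis `x = 0` as a graph. -/
theorem Arc.not_returning (m : ℕ) (hm : 1 ≤ m) {lam : ℝ} (hlam : lam < 0) (hlam' : -1 ≤ lam) :
    ∃ δ₀ > 0, ∀ (δ T : ℝ) (x r θ : ℝ → ℝ), Arc m lam δ T x r θ → δ ≤ δ₀ → π / 2 ≤ θ T →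
      0 ≤ x T → x T ≤ -lam → False := by
  have hm1 : (1 : ℝ) ≤ m := by exact_mod_cast hm
  -- The value leaves room in `(1 + ε ^ 2) * (m + ε ^ 2) ≤ m + 1 / 2`, on which the final
  -- contradiction rests.
  obtain ⟨ε, hε0, hεsq'⟩ : ∃ ε > 0, ε ^ 2 * ((m : ℝ) + 1) = 1 / 6 := by
    refine ⟨sqrt (1 / (6 * ((m : ℝ) + 1))), sqrt_pos.2 (by positivity), ?_⟩
    rw [sq_sqrt (by positivity)]
    field_simp
  have hε12 : ε ^ 2 ≤ 1 / 12 := by nlinarith [sq_nonneg ε]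
  have hε1 : ε ≤ 1 := by nlinarith
  obtain ⟨E, hE⟩ : ∃ E, E = exp (ε ^ 2 / 2) := ⟨_, rfl⟩
  have hE0 : 0 < E := hE ▸ exp_pos _
  have hE1 : E ≤ 1 + ε ^ 2 := by
    have h1 := one_sub_le_exp_neg (ε ^ 2 / 2)
    have h2 : E * exp (-(ε ^ 2 / 2)) = 1 := by rw [hE, ← exp_add]; simp
    refine le_of_mul_le_mul_right (a := 1 - ε ^ 2 / 2) ?_ (by linarith)
    have h3 := mul_le_mul_of_nonneg_left h1 hE0.le
    have h4 : 0 ≤ ε ^ 2 * (1 / 12 - ε ^ 2) := mul_nonneg (sq_nonneg _) (by linarith)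
    linarith [sq_nonneg ε]
  obtain ⟨δ₀, hδ₀, hsmall⟩ := exists_small (m * E / ε ^ 2 + 13) (2 * E)
    (show 0 < -lam / (2 * (m + 1)) from div_pos (by linarith) (by positivity))
  refine ⟨min δ₀ (min ε (1 / 48)), lt_min hδ₀ (lt_min hε0 (by norm_num)), ?_⟩
  intro δ T x r θ h hδ hθ hx0 hx
  have hδ0 := h.δ_pos
  have hδ1 := hδ.trans (min_le_left _ _)
  have hδ2 : δ ≤ ε := hδ.trans ((min_le_right _ _).trans (min_le_left _ _))
  have hδ3 : δ ≤ 1 / 48 := hδ.trans ((min_le_right _ _).trans (min_le_right _ _))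
  have hs := hsmall δ hδ0 hδ1
  have hlogδ : δ * log δ ≤ 0 := mul_nonpos_of_nonneg_of_nonpos hδ0.le
    (log_nonpos hδ0.le (by linarith))
  have hlogε : log ε ≤ 0 := log_nonpos hε0.le hε1
  have hl : -lam / (2 * ((m : ℝ) + 1)) ≤ -lam / 4 := by
    apply div_le_div_of_nonneg_left <;> linarith
  have hdiv : 0 ≤ m * E / ε ^ 2 * δ := by positivity
  have hxb : ∀ T' : ℝ, Arc m lam δ T' x r θ → r T' ≤ ε → 0 ≤ x T' →
      x T' ≤ 13 * δ - 2 * E * (δ * log δ) + E * -lam * (ε ^ 2 / (m + 1)) := by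
    intro T' h' hr' hx'
    have h1 := h'.x_le_log hm hlam.le hlam' hδ3 hx' h'.end_mem
    have hr0 := h'.r_pos T' h'.end_mem
    have h2 : exp (r T' ^ 2 / 2) ≤ E := hE ▸ exp_le_exp.2 (by gcongr)
    have h3 : log (r T') ≤ 0 := log_nonpos hr0.le (hr'.trans hε1)
    have h4 : log δ ≤ log (r T') := log_le_log hδ0 (h'.le_r h'.end_mem)
    have h5 : r T' ^ 2 / (2 * ((m : ℝ) + 1)) ≤ ε ^ 2 / (2 * (m + 1)) := by gcongr
    have h6 : δ * (log (r T') - log δ) - lam * (r T' ^ 2 / (2 * (m + 1)))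
        ≤ -(δ * log δ) + -lam * (ε ^ 2 / (2 * (m + 1))) := by
      have a1 := mul_nonpos_of_nonneg_of_nonpos hδ0.le h3
      have a2 := mul_le_mul_of_nonneg_left h5 (neg_nonneg.2 hlam.le)
      linarith
    have h7 : 0 ≤ -(δ * log δ) + -lam * (ε ^ 2 / (2 * (m + 1))) := by
      have : 0 ≤ -lam * (ε ^ 2 / (2 * (m + 1))) := mul_nonneg (by linarith) (by positivity)
      linarith
    have h8 := mul_le_mul h2 h6 (by
      have a1 := mul_nonneg hδ0.le (sub_nonneg.2 h4)
      have a2 : 0 ≤ -lam * (r T' ^ 2 / (2 * (m + 1))) := mul_nonneg (by linarith) (by positivity)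
      linarith) hE0.le
    have e : ε ^ 2 / (m + 1) = 2 * (ε ^ 2 / (2 * ((m : ℝ) + 1))) := by field_simp
    rw [e]
    linarith
  have hEε : E * (ε ^ 2 / (m + 1)) ≤ 1 / 2 := by
    have : ε ^ 2 / ((m : ℝ) + 1) ≤ ε ^ 2 := div_le_self (sq_nonneg _) (by linarith)
    have h2 : E ≤ 2 := by linarith
    have h3 := mul_le_mul h2 (this.trans hε12) (by positivity) zero_le_two
    linarith
  obtain ⟨a, ha, hθa⟩ := h.exists_θ_eq (b := π / 2) (by linarith [pi_pos]) hθ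
  -- At a vertical point the curvature is `x + λ`, so convexity puts this point to the right of the
  -- line `x = -λ`.
  have hxa : -lam < x a := by
    have := h.turn_pos a ha
    rw [turn, hθa] at this
    simp at this
    linarith
  have ha0 : 0 < a := by
    refine lt_of_le_of_ne ha.1 fun he => ?_
    rw [← he, h.θ_zero] at hθa
    linarith [pi_pos]
  have hA := h.restrict ha0 ha.2
  -- If the vertical is reached while `r ≤ ε`, the growth bound `hxb` keeps `x` below `-λ`.
  -- Otherwise the arc passes `r = ε` before the vertical, and the curvature computed there turns
  -- out to be negative.
  rcases le_or_gt (r a) ε with hle | hgt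
  · have h1 := hxb a hA hle (by linarith)
    have h2 := mul_le_mul_of_nonneg_left hEε (neg_nonneg.2 hlam.le)
    linarith
  obtain ⟨b, hb, hrb⟩ := hA.exists_r_eq hδ2 hgt.le
  have hb0 : 0 < b := by
    rcases hb.1.eq_or_lt with he | hlt
    · -- here `δ = ε`; move on by the bound at time `0`
      rw [← he, h.r_zero] at hrb
      exfalso
      have : m * E / ε ^ 2 * δ = m * E / ε := by rw [hrb]; field_simp
      have h2 : 1 ≤ m * E / ε := by
        rw [le_div_iff₀ hε0]
        have : 1 ≤ E := hE ▸ one_le_exp (by positivity)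
        have := mul_le_mul hm1 this zero_le_one (by positivity)
        linarith
      have : 0 ≤ E * (-(δ * log δ)) := mul_nonneg hE0.le (by linarith)
      linarith
    · exact hlt
  have hB := hA.restrict hb0 hb.2
  have hcb : 0 ≤ cos (θ b) := hA.cos_nonneg hA.end_mem hθa.le hb
  have hxb0 : 0 ≤ x b := hA.x_nonneg (by linarith) hb
  have h1 := hxb b hB hrb.le hxb0
  have h2 := hB.cos_le hm hlam.le hxb0 hB.end_mem
  have hk := hB.turn_pos b hB.end_mem
  rw [hrb, ← hE] at h2
  rw [turn, hrb] at hk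
  have h3 : x b * sin (θ b) ≤ x b := mul_le_of_le_one_right hxb0 (sin_le_one _)
  have h4 : ((m : ℝ) / ε - ε) * cos (θ b) ≤ m / ε * (E * (δ / ε - lam * (ε / (m + 1)))) := by
    have a1 : (m : ℝ) / ε * cos (θ b) ≤ m / ε * (E * (δ / ε - lam * (ε / (m + 1)))) :=
      mul_le_mul_of_nonneg_left h2 (by positivity)
    linarith [mul_nonneg hε0.le hcb]
  have h5 : m / ε * (E * (δ / ε - lam * (ε / (m + 1))))
      = m * E / ε ^ 2 * δ + E * -lam * (m / (m + 1)) := by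
    field_simp
    ring
  -- Up to terms vanishing with `δ`, the curvature at `r = ε` is at most `-λ` times the left side,
  -- plus `λ`. The gap `1 / (2 * (m + 1))` exceeds the `δ` terms by the choice of `δ₀`.
  have h6 : E * (m / (m + 1)) + E * (ε ^ 2 / (m + 1)) ≤ 1 - 1 / (2 * ((m : ℝ) + 1)) := by
    have e1 : E * (m / (m + 1)) + E * (ε ^ 2 / (m + 1)) = E * (m + ε ^ 2) / ((m : ℝ) + 1) := by
      field_simp
    have e2 : 1 - 1 / (2 * ((m : ℝ) + 1)) = (m + 1 / 2) / (m + 1) := by field_simp; ring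
    rw [e1, e2]
    gcongr
    have e3 := mul_le_mul_of_nonneg_right hE1 (by positivity : 0 ≤ (m : ℝ) + ε ^ 2)
    have e4 : ε ^ 2 * ε ^ 2 ≤ 1 / 12 * (1 / 12) :=
      mul_le_mul hε12 hε12 (sq_nonneg _) (by norm_num)
    linarith
  have h7 := mul_le_mul_of_nonneg_left h6 (neg_nonneg.2 hlam.le)
  have h8 : -lam * (1 / (2 * ((m : ℝ) + 1))) = -lam / (2 * (m + 1)) := by ring
  linarith

end LambdaHypersurface
end

/-! ### `λ = 0` and small `δ`: the curve crosses. -/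

noncomputable section

namespace LambdaHypersurface

open Set Filter Real

variable {m : ℕ} {δ T : ℝ} {x r θ : ℝ → ℝ}

/-- By concavity, `x` keeps half of its maximum for a while. -/
theorem Arc.le_two_mul_x (h : Arc m 0 δ T x r θ) {a b : ℝ} (ha : a ∈ Icc 0 T) (hab : a ≤ b)
    (hb : b ≤ T) (hθa : θ a = π / 2) (hsin : 0 < sin (θ b)) (hxT : 0 ≤ x T)
    (hr : 2 * r b ≤ r T) : x a ≤ 2 * x b := by
  have hbm : b ∈ Icc 0 T := ⟨ha.1.trans hab, hb⟩
  -- This linear function is constant along the tangent direction at time `b`, so on the convex arc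
  -- it is maximal at `b`. Its values at `a` and at `T` then bound `x a` by `x b`, since `r T` is at
  -- least twice `r b`.
  have hd : ∀ s ∈ Icc 0 T, HasDerivWithinAt (fun s => sin (θ b) * x s - cos (θ b) * r s)
      (sin (θ b - θ s)) (Ici 0) s := fun s hs => by
    refine (((h.dx s hs).const_mul _).sub ((h.dr s hs).const_mul _)).congr_deriv ?_
    rw [sin_sub]
  have h1 := monotoneOn_of_deriv_nonneg ha.1 (b := b)
    (fun s hs => hd s ⟨ha.1.trans hs.1, hs.2.trans hb⟩)
    (fun s hs => by
      have hs' : s ∈ Icc 0 T := ⟨ha.1.trans hs.1.le, hs.2.le.trans hb⟩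
      have b1 := h.θ_strictMono hs' hbm hs.2
      have b2 := (h.θ_mem_Icc hs').1
      have b3 := (h.θ_mem_Icc hbm).2
      exact sin_nonneg_of_nonneg_of_le_pi (by linarith) (by linarith))
    ⟨le_rfl, hab⟩ ⟨hab, le_rfl⟩ hab
  have h2 := antitoneOn_of_deriv_nonpos hbm.1 (b := T)
    (fun s hs => hd s ⟨hbm.1.trans hs.1, hs.2⟩)
    (fun s hs => by
      have hs' : s ∈ Icc 0 T := ⟨hbm.1.trans hs.1.le, hs.2.le⟩
      have b1 := h.θ_strictMono hbm hs' hs.1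
      have b2 := (h.θ_mem_Icc hs').2
      have b3 := (h.θ_mem_Icc hbm).1
      exact sin_nonpos_of_nonpos_of_neg_pi_le (by linarith) (by linarith))
    ⟨le_rfl, hb⟩ ⟨hb, le_rfl⟩ hb
  have hc3 : cos (θ b) ≤ 0 := h.cos_nonpos ha hθa.ge ⟨hab, hb⟩
  have h3 : 0 ≤ sin (θ b) * x T := mul_nonneg hsin.le hxT
  have h4 := mul_nonneg (neg_nonneg.2 hc3) (sub_nonneg.2 hr)
  have h6 := mul_nonneg (neg_nonneg.2 hc3) (h.r_pos a ha).le
  refine le_of_mul_le_mul_left ?_ hsin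
  linarith

/-- For `λ = 0` the weighted cosine has derivative `-r ^ m * exp (-r ^ 2 / 2) * x * sin θ ^ 2`. One
factor `sin θ` is bounded below by `1 / 2`, and the other one is `r'`. -/
theorem Arc.pow_mul_exp_mul_cos_drop (h : Arc m 0 δ T x r θ) {b d κ X : ℝ} (hb : 0 ≤ b)
    (hbd : b ≤ d) (hd : d ≤ T) (hκ : 0 ≤ κ) (hX : 0 ≤ X)
    (hw : ∀ s ∈ Ioo b d, κ ≤ r s ^ m * exp (-(r s) ^ 2 / 2))
    (hx : ∀ s ∈ Ioo b d, X ≤ x s) (hs : ∀ s ∈ Ioo b d, 1 / 2 ≤ sin (θ s)) :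
    r d ^ m * exp (-(r d) ^ 2 / 2) * cos (θ d) + κ * (X / 2) * (r d - r b) ≤
      r b ^ m * exp (-(r b) ^ 2 / 2) * cos (θ b) := by
  have hanti := antitoneOn_of_deriv_nonpos
    (f := fun s => r s ^ m * exp (-(r s) ^ 2 / 2) * cos (θ s) + κ * (X / 2) * r s) hb
    (fun s hs => (h.pow_mul_exp_hasDeriv ⟨hb.trans hs.1, hs.2.trans hd⟩).add
      ((h.dr s ⟨hb.trans hs.1, hs.2.trans hd⟩).const_mul _))
    (fun s hs' => by
      have h1 := hs s hs'
      have h2 := hx s hs'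
      have h6 : X * (1 / 2) ≤ x s * sin (θ s) := mul_le_mul h2 h1 (by norm_num) (hX.trans h2)
      have h7 : κ * (X * (1 / 2)) ≤ r s ^ m * exp (-(r s) ^ 2 / 2) * (x s * sin (θ s)) :=
        mul_le_mul (hw s hs') h6 (by positivity) (hκ.trans (hw s hs'))
      have h8 := mul_le_mul_of_nonneg_right h7 (by linarith : 0 ≤ sin (θ s))
      rw [add_zero]
      linarith) ⟨le_rfl, hbd⟩ ⟨hbd, le_rfl⟩ hbd
  simp only at hanti
  linarith

/-- In a thin neck, `x` grows at least logarithmically in `r`. -/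
theorem Arc.mul_log_le_x (h : Arc m 0 δ T x r θ) (hm : 1 ≤ m) (hθ : θ T ≤ π / 2) (hδ : δ ≤ 1)
    (hx0 : 0 ≤ x T) (hx : ∀ s ∈ Icc 0 T, x s ≤ 1) (hr : r T ≤ 1)
    (hrT : r T ^ (m + 1) ≤ δ ^ m / 4) : δ ^ m / 4 * (log (r T) - log δ) ≤ x T := by
  have hδ0 := h.δ_pos
  -- With `X = 1` in `neg_le_cos`, the initial value contributes at least `δ ^ m / 2` and the
  -- correction costs at most `δ ^ m / 4`.
  have hc : ∀ s ∈ Icc 0 T, δ ^ m / 4 ≤ r s ^ m * cos (θ s) := by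
    intro s hs'
    have h1 := h.neg_le_cos le_rfl hx0 (X := 1) hx hs'
    have hr := h.r_pos s hs'
    have hrs : r s ≤ r T := h.r_strictMono.monotoneOn hs' h.end_mem hs'.2
    have h2 : r s ^ (m + 1) / ((m : ℝ) + 1) ≤ δ ^ m / 4 := by
      have a1 : r s ^ (m + 1) ≤ r T ^ (m + 1) := by gcongr
      refine (div_le_self (by positivity) (by linarith [m.cast_nonneg (α := ℝ)])).trans ?_
      linarith
    have h3 : 1 / 2 ≤ exp (-δ ^ 2 / 2) := by
      have := add_one_le_exp (-δ ^ 2 / 2)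
      nlinarith
    have h4 : δ ^ m * (1 / 2) ≤ δ ^ m * exp (-δ ^ 2 / 2) := by gcongr
    have h5 : 0 ≤ 1 * (δ ^ (m + 1) / ((m : ℝ) + 1)) := by positivity
    have h6 : 0 ≤ cos (θ s) := h.cos_nonneg h.end_mem hθ hs'
    have h7 : exp (-(r s) ^ 2 / 2) ≤ 1 := exp_le_one_iff.2 (by nlinarith [sq_nonneg (r s)])
    have h8 : r s ^ m * exp (-(r s) ^ 2 / 2) * cos (θ s) ≤ r s ^ m * cos (θ s) := by
      gcongr
      exact mul_le_of_le_one_right (by positivity) h7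
    linarith
  have hmono := monotoneOn_of_deriv_nonneg (f := fun s => x s - δ ^ m / 4 * log (r s)) le_rfl
    (fun s hs => (h.dx s hs).sub
      (((h.dr s hs).log (h.r_pos s hs).ne').const_mul (δ ^ m / 4)))
    (fun s hs => by
      have hs' := Ioo_subset_Icc_self hs
      have h1 := hc s hs'
      have hr := h.r_pos s hs'
      have hr1 : r s ≤ 1 := (h.r_strictMono.monotoneOn hs' h.end_mem hs.2.le).trans ‹_›
      have h2 : r s ^ m ≤ r s := by
        simpa using pow_le_pow_of_le_one hr.le hr1 hm
      have h6 : 0 ≤ cos (θ s) := h.cos_nonneg h.end_mem hθ hs'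
      have h3 : δ ^ m / 4 / r s ≤ cos (θ s) := by
        rw [div_le_iff₀ hr]
        have := mul_le_mul_of_nonneg_right h2 h6
        linarith
      have h4 : δ ^ m / 4 * (sin (θ s) / r s) ≤ δ ^ m / 4 / r s := by
        rw [mul_div_assoc', div_le_div_iff_of_pos_right hr]
        exact mul_le_of_le_one_right (by positivity) (sin_le_one _)
      linarith) h.zero_mem h.end_mem h.T_pos.le
  simp only [h.x_zero, h.r_zero] at hmono
  linarith

theorem pow_mul_exp_le_factorial (m : ℕ) {b : ℝ} (hb : 2 ≤ b) :
    b ^ m * exp (-b ^ 2 / 2) ≤ m.factorial := by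
  have hfac : (0 : ℝ) < m.factorial := by exact_mod_cast m.factorial_pos
  have h2 := pow_div_factorial_le_exp (b ^ 2 / 2) (by positivity) m
  have h3 : exp (b ^ 2 / 2) * exp (-b ^ 2 / 2) = 1 := by
    rw [← exp_add, neg_div, add_neg_cancel, exp_zero]
  have h4 : b ^ m ≤ (b ^ 2 / 2) ^ m := by
    gcongr; nlinarith
  have h5 : (b ^ 2 / 2) ^ m ≤ m.factorial * exp (b ^ 2 / 2) := by
    rw [div_le_iff₀ hfac] at h2; linarith
  calc b ^ m * exp (-b ^ 2 / 2)
      ≤ (m.factorial * exp (b ^ 2 / 2)) * exp (-b ^ 2 / 2) := by gcongr; linarith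
    _ = m.factorial := by rw [mul_assoc, h3, mul_one]

set_option maxHeartbeats 1000000 in
/-- For `λ = 0` and small `δ`, the curve crosses the axis `x = 0` before it turns horizontal. -/
theorem Arc.returning (m : ℕ) (hm : 1 ≤ m) :
    ∃ δ₀ > 0, ∀ (δ L : ℝ) (x r θ : ℝ → ℝ), Arc m 0 δ L x r θ → δ ≤ δ₀ → θ L = π → 0 ≤ x L →
      False := by
  have hpi := pi_pos
  -- Lower slope per unit of `x a`: the weighted cosine at `r = 2` is at most `-exp (-2) * x a / 4`,
  -- and for `r ≥ 2` the weight is at most `m!`.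
  set κ := exp (-2) / (4 * m.factorial) with hκ
  have hfac : (0 : ℝ) < m.factorial := by exact_mod_cast m.factorial_pos
  have hfac1 : (1 : ℝ) ≤ m.factorial := by exact_mod_cast m.factorial_pos
  have hκ0 : 0 < κ := by positivity
  have hκ1 : κ ≤ 1 := by
    rw [hκ, div_le_one (by positivity)]
    have : exp (-2) ≤ 1 := exp_le_one_iff.2 (by norm_num)
    linarith
  -- Between `r = 2` and `r = M` a slope `κ * x a` removes `2 * x a` from `x`, more than the curve
  -- has.
  set M := 2 + 2 / κ with hM
  have hM4 : 4 ≤ M := by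
    have : 2 ≤ 2 / κ := by rw [le_div_iff₀ hκ0]; linarith
    linarith
  obtain ⟨δ₁, hδ₁, c₁, hc₁, hδ48, -, Hs⟩ := Arc.small m hm (by linarith : 1 ≤ M) one_pos
  obtain ⟨δ₂, hδ₂, c₂, hc₂, Hf⟩ := Arc.far m hm M
  -- With `log Λ = 2 ^ (m + 6)`, the neck up to `r = Λ δ` produces enough `x` to make the drop
  -- between `r = 1 / 2` and `r = 1` equal to at least `2 * δ ^ m`. The weighted cosine is at most
  -- `δ ^ m`.
  set Λ := exp (2 ^ (m + 6)) with hΛ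
  have hΛ1 : 1 < Λ := one_lt_exp_iff.2 (by positivity)
  have hΛ0 : 0 < Λ := exp_pos _
  have hΛm : Λ ≤ Λ ^ (m + 1) := le_self_pow₀ hΛ1.le (by omega)
  refine ⟨min (min δ₁ δ₂) (1 / (4 * Λ ^ (m + 1))), lt_min (lt_min hδ₁ hδ₂) (by positivity), ?_⟩
  intro δ L x r θ h hδ hθL hxL
  have hδ0 := h.δ_pos
  have hδa : δ ≤ δ₁ := hδ.trans ((min_le_left _ _).trans (min_le_left _ _))
  have hδb : δ ≤ δ₂ := hδ.trans ((min_le_left _ _).trans (min_le_right _ _))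
  have hδc : Λ ^ (m + 1) * δ ≤ 1 / 4 := by
    have := hδ.trans (min_le_right _ _)
    rw [le_div_iff₀ (by positivity)] at this
    linarith
  have hδd : δ ≤ 1 / 48 := hδa.trans hδ48
  have hΛδ : Λ * δ ≤ 1 / 4 := (mul_le_mul_of_nonneg_right hΛm hδ0.le).trans hδc
  have hδΛ : δ < Λ * δ := by nlinarith
  have hrL : M < r L := Hf 0 δ L x r θ h le_rfl (by linarith) hδb hxL hθL
  obtain ⟨tM, htM, hrM⟩ := h.exists_r_eq (b := M) (by linarith) hrL.le
  have htM0 : 0 < tM := by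
    rcases htM.1.eq_or_lt with he | hlt
    · rw [← he, h.r_zero] at hrM; linarith
    · exact hlt
  have hxM : 0 ≤ x tM := h.x_nonneg hxL htM
  have hA := h.restrict htM0 htM.2
  have hsm := Hs 0 δ tM x r θ hA le_rfl (by linarith) hδa hxM hrM.le
  -- times at which `r = Λ δ, 1 / 2, 1, 2`
  obtain ⟨t₀, ht₀, hr₀⟩ := hA.exists_r_eq (b := Λ * δ) hδΛ.le (by linarith)
  obtain ⟨t₁, ht₁, hr₁⟩ := hA.exists_r_eq (b := 1 / 2) (by linarith) (by linarith)
  obtain ⟨t₂, ht₂, hr₂⟩ := hA.exists_r_eq (b := 1) (by linarith) (by linarith)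
  obtain ⟨t₃, ht₃, hr₃⟩ := hA.exists_r_eq (b := 2) (by linarith) (by linarith)
  have hlt : ∀ {s t : ℝ}, s ∈ Icc 0 tM → t ∈ Icc 0 tM → r s < r t → s < t := fun hs ht hst =>
    (hA.r_strictMono.lt_iff_lt hs ht).1 hst
  have h01 : t₀ < t₁ := hlt ht₀ ht₁ (by linarith)
  have h12 : t₁ < t₂ := hlt ht₁ ht₂ (by linarith)
  have h23 : t₂ < t₃ := hlt ht₂ ht₃ (by linarith)
  have h3M : t₃ < tM := hlt ht₃ hA.end_mem (by linarith)
  have h00 : 0 < t₀ := hlt hA.zero_mem ht₀ (by rw [h.r_zero]; linarith)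
  have hxnn : ∀ s ∈ Icc 0 tM, 0 ≤ x s := fun s hs => hA.x_nonneg hxM hs
  -- on `1 / 2 ≤ r ≤ 2` the curve is steep
  have hsin : ∀ s ∈ Icc t₁ t₃, 1 / 2 ≤ sin (θ s) := by
    intro s hs
    have hs' : s ∈ Icc 0 tM := ⟨ht₁.1.trans hs.1, hs.2.trans ht₃.2⟩
    have hrs : 1 / 2 ≤ r s := by rw [← hr₁]; exact hA.r_strictMono.monotoneOn ht₁ hs' hs.1
    have hrs2 : r s ≤ 2 := by rw [← hr₃]; exact hA.r_strictMono.monotoneOn hs' ht₃ hs.2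
    have h1 := hA.cos_le hm le_rfl hxM hs'
    have h2 := (hsm s hs').2
    have h3 : exp (r s ^ 2 / 2) ≤ 8 := by
      have : exp (r s ^ 2 / 2) ≤ exp 2 := exp_le_exp.2 (by nlinarith)
      have e2 : exp 2 = exp 1 * exp 1 := by rw [← exp_add]; norm_num
      have e1 := exp_one_lt_d9
      nlinarith [exp_pos 1]
    have h4 : δ / r s ≤ 1 / 24 := by
      rw [div_le_iff₀ (by linarith)]; nlinarith
    have h5 : cos (θ s) ≤ 1 / 2 := by
      refine h1.trans ?_
      have : exp (r s ^ 2 / 2) * (δ / r s - 0 * (r s / (m + 1))) ≤ 8 * (1 / 24) := by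
        rw [zero_mul, sub_zero]
        exact mul_le_mul h3 h4 (div_nonneg hδ0.le (by linarith)) (by norm_num)
      linarith
    have h6 := hA.sin_nonneg hs'
    nlinarith [sin_sq_add_cos_sq (θ s)]
  let P : ℝ → ℝ := fun s => r s ^ m * exp (-(r s) ^ 2 / 2) * cos (θ s)
  -- the curve is vertical before `r = 1`
  have hθ₂ : π / 2 < θ t₂ := by
    by_contra hle
    rw [not_lt] at hle
    have hX : δ ^ m / 4 * 2 ^ (m + 6) ≤ x t₀ := by
      have := (hA.restrict h00 ht₀.2).mul_log_le_x hm
        ((hA.θ_strictMono.monotoneOn ht₀ ht₂ (h01.trans h12).le).trans hle) (by linarith)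
        (hxnn t₀ ht₀) (fun u hu => (hsm u ⟨hu.1, hu.2.trans ht₀.2⟩).1) (by linarith) (by
          rw [hr₀]
          have a2 : (Λ * δ) ^ (m + 1) = (Λ ^ (m + 1) * δ) * δ ^ m := by ring
          have a3 := mul_le_mul_of_nonneg_right hδc (pow_nonneg hδ0.le m)
          linarith)
      rwa [hr₀, log_mul hΛ0.ne' hδ0.ne', hΛ, log_exp, add_sub_cancel_right] at this
    have hxm := hA.x_strictMono ht₂ hle
    have hdrop := hA.pow_mul_exp_mul_cos_drop (κ := (1 / 2) ^ m * (1 / 2)) (X := x t₀) ht₁.1 h12.le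
      ht₂.2 (by positivity) (hxnn t₀ ht₀) (fun s hs => by
        have hs' : s ∈ Icc 0 tM := ⟨ht₁.1.trans hs.1.le, hs.2.le.trans ht₂.2⟩
        have hrs : 1 / 2 ≤ r s := by rw [← hr₁]; exact hA.r_strictMono.monotoneOn ht₁ hs' hs.1.le
        have hrs2 : r s ≤ 1 := by rw [← hr₂]; exact hA.r_strictMono.monotoneOn hs' ht₂ hs.2.le
        have h4 : 1 / 2 ≤ exp (-(r s) ^ 2 / 2) := by
          have := add_one_le_exp (-(r s) ^ 2 / 2)
          nlinarith
        exact mul_le_mul (pow_le_pow_left₀ (by norm_num) hrs m) h4 (by norm_num)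
          (pow_nonneg (by linarith) m))
      (fun s hs => hxm.monotoneOn ⟨h00.le, by linarith⟩ ⟨ht₁.1.trans hs.1.le, hs.2.le⟩
          (by linarith [hs.1]))
      (fun s hs => hsin s ⟨hs.1.le, by linarith [hs.2]⟩)
    have h1 : 0 ≤ r t₂ ^ m * exp (-(r t₂) ^ 2 / 2) * cos (θ t₂) := by
      have : 0 ≤ cos (θ t₂) := hA.cos_nonneg ht₂ hle ⟨ht₂.1, le_rfl⟩
      have h0 := hA.r_pos t₂ ht₂
      exact mul_nonneg (by positivity) this
    have h2 := hA.pow_mul_exp_mul_cos_le le_rfl hxM ht₁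
    rw [zero_mul, sub_zero] at h2
    have h3 : (1 / 2 : ℝ) ^ (m + 2) * x t₀ * (1 / 2) ≤ δ ^ m := by
      rw [hr₂] at h1 hdrop
      have e : (1 / 2 : ℝ) ^ (m + 2) * x t₀ * (1 / 2)
          = (1 / 2) ^ m * (1 / 2) * (x t₀ / 2) * (1 - r t₁) := by rw [hr₁]; ring
      rw [e]
      linarith
    have h4 : (1 / 2 : ℝ) ^ (m + 2) * (δ ^ m / 4 * 2 ^ (m + 6)) * (1 / 2) ≤ δ ^ m := by
      refine le_trans ?_ h3
      exact mul_le_mul_of_nonneg_right (mul_le_mul_of_nonneg_left hX (by positivity)) (by norm_num)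
    have h5 : (1 / 2 : ℝ) ^ (m + 2) * (δ ^ m / 4 * 2 ^ (m + 6)) * (1 / 2) = 2 * δ ^ m := by
      rw [one_div, inv_pow, pow_add, pow_add]; field_simp; norm_num
    have h6 : 0 < δ ^ m := by positivity
    linarith
  obtain ⟨a, ha, hθa⟩ := hA.exists_θ_eq (b := π / 2) (by linarith)
    (hθ₂.le.trans (hA.θ_strictMono.monotoneOn ht₂ hA.end_mem ht₂.2))
  have ha2 : a < t₂ := (hA.θ_strictMono.lt_iff_lt ha ht₂).1 (by rw [hθa]; exact hθ₂)
  have ha0 : 0 < a := by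
    refine lt_of_le_of_ne ha.1 fun he => ?_
    rw [← he, h.θ_zero] at hθa
    linarith
  have hA0 : 0 < x a := by
    have := hA.x_strictMono ha hθa.le ⟨le_rfl, ha.1⟩ ⟨ha.1, le_rfl⟩ ha0
    rwa [h.x_zero] at this
  have hra : 0 < r a := hA.r_pos a ha
  have hanti := hA.x_strictAnti ha hθa.ge
  -- by concavity, `x` is at least half of its maximum up to `r = 2`
  have hx₃ : x a ≤ 2 * x t₃ :=
    hA.le_two_mul_x ha (by linarith) ht₃.2 hθa (by linarith [hsin t₃ ⟨by linarith, le_rfl⟩]) hxM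
      (by linarith)
  -- so the curve has a definite slope at `r = 2`
  have hP₃ : P t₃ ≤ -(exp (-2) * (x a / 4)) := by
    have h1 := hA.pow_mul_exp_mul_cos_drop (κ := exp (-2)) (X := x a / 2) ht₂.1 h23.le
      ht₃.2 (exp_pos _).le (by positivity) (fun s hs => by
        have hs' : s ∈ Icc 0 tM := ⟨ht₂.1.trans hs.1.le, hs.2.le.trans ht₃.2⟩
        have hrs : 1 ≤ r s := by rw [← hr₂]; exact hA.r_strictMono.monotoneOn ht₂ hs' hs.1.le
        have hrs2 : r s ≤ 2 := by rw [← hr₃]; exact hA.r_strictMono.monotoneOn hs' ht₃ hs.2.le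
        have h3 : 1 ≤ r s ^ m := one_le_pow₀ hrs
        have h4 : exp (-2) ≤ exp (-(r s) ^ 2 / 2) := exp_le_exp.2 (by nlinarith)
        exact h4.trans (le_mul_of_one_le_left (exp_pos _).le h3))
      (fun s hs => by
        have := hanti.antitoneOn ⟨by linarith [hs.1], hs.2.le.trans ht₃.2⟩
          ⟨by linarith, ht₃.2⟩ hs.2.le
        linarith)
      (fun s hs => hsin s ⟨by linarith [hs.1], hs.2.le⟩)
    have h2 : r t₂ ^ m * exp (-(r t₂) ^ 2 / 2) * cos (θ t₂) ≤ 0 := by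
      have h0 := hA.r_pos t₂ ht₂
      exact mul_nonpos_of_nonneg_of_nonpos (by positivity)
        (hA.cos_nonpos ha hθa.ge ⟨ha2.le, ht₂.2⟩)
    have e : exp (-2) * (x a / 2 / 2) * (r t₃ - r t₂) = exp (-2) * (x a / 4) := by
      rw [hr₂, hr₃]; ring
    rw [e] at h1
    change r t₃ ^ m * exp (-(r t₃) ^ 2 / 2) * cos (θ t₃) ≤ _
    linarith
  -- Beyond `r = 2` the weighted cosine keeps decreasing, so `cos θ ≤ -(κ * x a)`. At `r = M` this
  -- gives `x < 0`, contrary to `x ≥ 0` on the arc.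
  have hfin := antitoneOn_of_deriv_nonpos (f := fun s => x s + κ * x a * r s) ht₃.1
    (fun s hs => (hA.dx s ⟨ht₃.1.trans hs.1, hs.2⟩).add
      ((hA.dr s ⟨ht₃.1.trans hs.1, hs.2⟩).const_mul _))
    (fun s hs => by
      have hs' : s ∈ Icc 0 tM := ⟨ht₃.1.trans hs.1.le, hs.2.le⟩
      have hPs : P s ≤ -(exp (-2) * (x a / 4)) := by
        refine le_trans ?_ hP₃
        have := antitoneOn_of_deriv_nonpos (f := P) ht₃.1
          (fun u hu => hA.pow_mul_exp_hasDeriv ⟨ht₃.1.trans hu.1, hu.2⟩)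
          (fun u hu => by
            have hu' : u ∈ Icc 0 tM := ⟨ht₃.1.trans hu.1.le, hu.2.le⟩
            have b1 := hA.sin_nonneg hu'
            have b2 := hxnn u hu'
            have b3 := hA.r_pos u hu'
            rw [add_zero, neg_nonpos]
            positivity)
        exact this ⟨le_rfl, h3M.le⟩ ⟨hs.1.le, hs.2.le⟩ hs.1.le
      have hrs : 2 ≤ r s := by rw [← hr₃]; exact hA.r_strictMono.monotoneOn ht₃ hs' hs.1.le
      have hr0 : 0 < r s := by linarith
      have h1 := pow_mul_exp_le_factorial m hrs
      have hc : cos (θ s) ≤ 0 := hA.cos_nonpos ha hθa.ge ⟨by linarith [hs.1], hs'.2⟩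
      have h2 : (m.factorial : ℝ) * cos (θ s) ≤ P s := by
        exact mul_le_mul_of_nonpos_right h1 hc
      have h3 : cos (θ s) ≤ -(κ * x a) := by
        have e : κ * x a = exp (-2) * (x a / 4) / m.factorial := by rw [hκ]; field_simp
        rw [e, ← neg_div, le_div_iff₀ hfac]
        linarith
      have h4 := mul_le_of_le_one_right (mul_pos hκ0 hA0).le (sin_le_one (θ s))
      linarith) ⟨le_rfl, h3M.le⟩ ⟨h3M.le, le_rfl⟩ h3M.le
  simp only [hr₃, hrM] at hfin
  have h1 : x t₃ ≤ x a := hanti.antitoneOn ⟨le_rfl, ha.2⟩ ⟨by linarith, ht₃.2⟩ (by linarith)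
  have e : κ * x a * M = κ * x a * 2 + 2 * x a := by rw [hM]; field_simp
  linarith

end LambdaHypersurface
end

/-! ### `λ = 0`: curves below the cylinder become vertical. -/

noncomputable section

namespace LambdaHypersurface

open Set Filter Real

namespace Traj

variable {m : ℕ} {δ T : ℝ} {x r θ : ℝ → ℝ}

/-- The function `u = x sin θ - r cos θ` is the part of the curvature coming from the position
vector: for `λ = 0` one has `turn = m cos θ / r + u`. It increases while the curve is convex and `x
cos θ + r sin θ ≥ 0`. -/
lemma dsupport (h : Traj m 0 δ T x r θ) {s : ℝ} (hs : s ∈ Icc 0 T) :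
    HasDerivWithinAt (fun s => x s * sin (θ s) - r s * cos (θ s))
      ((x s * cos (θ s) + r s * sin (θ s)) * turn m 0 (x s) (r s) (θ s)) (Ici 0) s := by
  refine (((h.dx s hs).mul (h.dsin hs)).sub ((h.dr s hs).mul (h.dcos hs))).congr_deriv ?_
  ring

lemma dcos_div (h : Traj m 0 δ T x r θ) {s : ℝ} (hs : s ∈ Icc 0 T) :
    HasDerivWithinAt (fun s => cos (θ s) / r s)
      (-(sin (θ s) / r s) * (turn m 0 (x s) (r s) (θ s) + cos (θ s) / r s)) (Ici 0) s := by
  have hr := (h.r_pos s hs).ne'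
  refine ((h.dcos hs).div (h.dr s hs) hr).congr_deriv ?_
  field_simp
  ring

/-- The Wronskian of the two principal curvature type quantities `⟨X, ν⟩` and `cos θ / r`. -/
lemma dwronskian (h : Traj m 0 δ T x r θ) {s : ℝ} (hs : s ∈ Icc 0 T) :
    HasDerivWithinAt (fun s => weight m (x s) (r s) *
        (sin (θ s) / r s * (turn m 0 (x s) (r s) (θ s) + cos (θ s) / r s) *
            (x s * sin (θ s) - r s * cos (θ s)) +
          cos (θ s) / r s * ((x s * cos (θ s) + r s * sin (θ s)) * turn m 0 (x s) (r s) (θ s))))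
      (2 * weight m (x s) (r s) * (r s * cos (θ s) - x s * sin (θ s)) * (sin (θ s) / r s) ^ 2 *
        (turn m 0 (x s) (r s) (θ s) + cos (θ s) / r s)) (Ici 0) s := by
  have hr := (h.r_pos s hs).ne'
  have hρ := ((h.dx s hs).mul (h.dcos hs)).add ((h.dr s hs).mul (h.dsin hs))
  have hσ := (h.dsin hs).div (h.dr s hs) hr
  refine ((h.dweight hs).mul (((hσ.mul ((h.dturn hs).add (h.dcos_div hs))).mul
    (h.dsupport hs)).add ((h.dcos_div hs).mul (hρ.mul (h.dturn hs))))).congr_deriv ?_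
  simp only [Pi.mul_apply, Pi.add_apply, Pi.div_apply]
  have e1 : turn m 0 (x s) (r s) (θ s) =
    (m / r s - r s) * cos (θ s) + x s * sin (θ s) + 0 := rfl
  generalize turn m 0 (x s) (r s) (θ s) = K at *
  generalize weight m (x s) (r s) = w
  generalize sin (θ s) = S at *
  generalize cos (θ s) = C at *
  generalize x s = X at *
  generalize r s = R at *
  rw [← sub_eq_zero]
  trans w * (C / R) * (X * C + R * S) * (S / R) * (K - ((m / R - R) * C + X * S + 0))
  · field_simp
    ring
  · rw [← e1]; ring

/-- As long as the curve is convex and graphical, its curvature is controlled from below. -/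
lemma le_turn_of_nonneg (h : Traj m 0 δ T x r θ) (hT : 0 ≤ T)
    (hk : ∀ s ∈ Ioo 0 T, 0 ≤ turn m 0 (x s) (r s) (θ s)) (hθ : ∀ s ∈ Icc 0 T, θ s < π / 2) :
    (m - δ ^ 2) * (cos (θ T) / r T) ≤ turn m 0 (x T) (r T) (θ T) := by
  have hpi := pi_pos
  have h0T : (0 : ℝ) ∈ Icc 0 T := ⟨le_rfl, hT⟩
  have hTT : T ∈ Icc 0 T := ⟨hT, le_rfl⟩
  have hδ : 0 < δ := by rw [← h.r_zero]; exact h.r_pos 0 h0T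
  have hθ0 : ∀ s ∈ Icc 0 T, 0 ≤ θ s := fun s hs => by
    have := monotoneOn_of_deriv_nonneg le_rfl h.dθ hk h0T hs hs.1
    rwa [h.θ_zero] at this
  have hc : ∀ s ∈ Icc 0 T, 0 < cos (θ s) := fun s hs =>
    cos_pos_of_mem_Ioo ⟨by linarith [hθ0 s hs], hθ s hs⟩
  have hsn : ∀ s ∈ Icc 0 T, 0 ≤ sin (θ s) := fun s hs =>
    sin_nonneg_of_nonneg_of_le_pi (hθ0 s hs) (by linarith [hθ s hs])
  have hx : ∀ s ∈ Icc 0 T, 0 ≤ x s := fun s hs => by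
    have := monotoneOn_of_deriv_nonneg le_rfl h.dx
      (fun t ht => (hc t (Ioo_subset_Icc_self ht)).le) h0T hs hs.1
    rwa [h.x_zero] at this
  have hρ : ∀ s ∈ Icc 0 T, 0 ≤ x s * cos (θ s) + r s * sin (θ s) := fun s hs =>
    add_nonneg (mul_nonneg (hx s hs) (hc s hs).le) (mul_nonneg (h.r_pos s hs).le (hsn s hs))
  have hu := monotoneOn_of_deriv_nonneg le_rfl (fun s hs => h.dsupport hs)
    (fun s hs => mul_nonneg (hρ s (Ioo_subset_Icc_self hs)) (hk s hs))
  have hrT := h.r_pos T hTT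
  have eT : turn m 0 (x T) (r T) (θ T) =
      m * (cos (θ T) / r T) + (x T * sin (θ T) - r T * cos (θ T)) := by
    unfold turn; ring
  have hκT : 0 < cos (θ T) / r T := div_pos (hc T hTT) hrT
  -- If `u ≥ 0` at the end, the claim is immediate. Otherwise `u < 0` on the whole interval by
  -- monotonicity, and division by `u` is allowed.
  rcases le_or_gt 0 (x T * sin (θ T) - r T * cos (θ T)) with hge | hlt
  · rw [eT]
    have := mul_nonneg (sq_nonneg δ) hκT.le
    linarith
  have hneg : ∀ s ∈ Icc 0 T, 0 < r s * cos (θ s) - x s * sin (θ s) := fun s hs => by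
    have := hu hs hTT hs.2
    simp only at this
    linarith
  have hkκ : ∀ s ∈ Ioo 0 T, 0 ≤ turn m 0 (x s) (r s) (θ s) + cos (θ s) / r s := fun s hs =>
    add_nonneg (hk s hs) (div_pos (hc s (Ioo_subset_Icc_self hs))
      (h.r_pos s (Ioo_subset_Icc_self hs))).le
  have hW := monotoneOn_of_deriv_nonneg le_rfl (fun s hs => h.dwronskian hs)
    (fun s hs => by
      have hs' := Ioo_subset_Icc_self hs
      have := weight_pos (m := m) (a := x s) (h.r_pos s hs')
      exact mul_nonneg (mul_nonneg (mul_nonneg (by positivity) (hneg s hs').le) (sq_nonneg _))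
        (hkκ s hs))
  -- The derivative of `(cos θ / r) / (-u)` is the Wronskian divided by `weight * u ^ 2`. The
  -- Wronskian vanishes at time `0` and increases, so this quotient stays above its initial value `1
  -- / δ ^ 2`; hence `-u ≤ δ ^ 2 * cos θ / r`.
  have hq := monotoneOn_of_deriv_nonneg (f := fun s => (cos (θ s) / r s) /
      (x s * sin (θ s) - r s * cos (θ s)) * -1) le_rfl
    (fun s hs => (((h.dcos_div hs).div (h.dsupport hs) (by linarith [hneg s hs])).mul_const (-1)))
    (fun s hs => by
      have hs' := Ioo_subset_Icc_self hs
      have h1 := hW h0T hs' hs.1.le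
      simp only [h.x_zero, h.r_zero, h.θ_zero, sin_zero, zero_div, zero_mul, mul_zero,
        add_zero] at h1
      have h2 := nonneg_of_mul_nonneg_right h1 (weight_pos (m := m) (a := x s) (h.r_pos s hs'))
      rw [div_mul_eq_mul_div]
      refine div_nonneg ?_ (sq_nonneg _)
      linarith) h0T hTT hT
  simp only [h.x_zero, h.r_zero, h.θ_zero, sin_zero, cos_zero, mul_zero, mul_one, zero_sub] at hq
  have e3 : 1 / δ / -δ * -1 = 1 / δ ^ 2 := by field_simp
  have e4 : (cos (θ T) / r T) / (x T * sin (θ T) - r T * cos (θ T)) * -1 =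
      (cos (θ T) / r T) / (r T * cos (θ T) - x T * sin (θ T)) := by
    rw [← neg_sub (r T * cos (θ T)), div_neg]; ring
  rw [e3, e4, div_le_div_iff₀ (by positivity) (hneg T hTT)] at hq
  rw [eT]
  linarith

/-- Convexity need not be assumed: at a first time where the curvature is nonpositive, the preceding
estimate applies and gives a positive value because `δ ^ 2 < m`. -/
lemma le_turn (h : Traj m 0 δ T x r θ) (hδ : δ ^ 2 < m)
    (hθ : ∀ s ∈ Icc 0 T, θ s < π / 2) : ∀ s ∈ Icc 0 T, 0 < cos (θ s) ∧ 0 ≤ θ s ∧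
      (m - δ ^ 2) * (cos (θ s) / r s) ≤ turn m 0 (x s) (r s) (θ s) := by
  have key : ∀ s ∈ Icc 0 T, (∀ t ∈ Ioo 0 s, 0 ≤ turn m 0 (x t) (r t) (θ t)) →
      0 < cos (θ s) ∧ 0 ≤ θ s ∧
      (m - δ ^ 2) * (cos (θ s) / r s) ≤ turn m 0 (x s) (r s) (θ s) := by
    intro s hs hks
    have hs' := h.mono hs.2
    have h0 : 0 ≤ θ s := by
      have := monotoneOn_of_deriv_nonneg le_rfl hs'.dθ hks ⟨le_rfl, hs.1⟩ ⟨hs.1, le_rfl⟩ hs.1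
      rwa [h.θ_zero] at this
    exact ⟨cos_pos_of_mem_Ioo ⟨by linarith [pi_pos], hθ s hs⟩, h0,
      hs'.le_turn_of_nonneg hs.1 hks fun t ht => hθ t ⟨ht.1, ht.2.trans hs.2⟩⟩
  have hpos : ∀ s ∈ Icc 0 T, 0 < turn m 0 (x s) (r s) (θ s) := by
    by_contra hne
    push Not at hne
    obtain ⟨t, ⟨htT, ht⟩, hleast⟩ : ∃ t, IsLeast (Icc 0 T ∩
        (fun s => turn m 0 (x s) (r s) (θ s)) ⁻¹' Iic 0) t := by
      refine IsCompact.exists_isLeast ?_ (by obtain ⟨s, hs, h'⟩ := hne; exact ⟨s, hs, h'⟩)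
      exact isCompact_Icc.of_isClosed_subset
        (h.continuousOn_turn.preimage_isClosed_of_isClosed isClosed_Icc isClosed_Iic)
        inter_subset_left
    obtain ⟨hc, -, hle⟩ := key t htT fun s hs => by
      by_contra hlt
      exact absurd (hleast ⟨⟨hs.1.le, hs.2.le.trans htT.2⟩, (not_le.1 hlt).le⟩) (not_le.2 hs.2)
    have : 0 < (m - δ ^ 2) * (cos (θ t) / r t) :=
      mul_pos (by linarith) (div_pos hc (h.r_pos t htT))
    exact absurd ht (not_le.2 (this.trans_le hle))
  exact fun s hs => key s hs fun t ht => (hpos t ⟨ht.1.le, ht.2.le.trans hs.2⟩).le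

lemma turn_pos_of_graph (h : Traj m 0 δ T x r θ) (hδ : δ ^ 2 < m)
    (hθ : ∀ s ∈ Icc 0 T, θ s < π / 2) {s : ℝ} (hs : s ∈ Icc 0 T) :
    0 < turn m 0 (x s) (r s) (θ s) := by
  obtain ⟨hc, -, hle⟩ := h.le_turn hδ hθ s hs
  exact (mul_pos (by linarith) (div_pos hc (h.r_pos s hs))).trans_le hle

end Traj

namespace PhaseCurve

variable {Γ : PhaseCurve} {m : ℕ} {δ : ℝ}

/-- For `λ = 0`, no entire graph other than the cylinder: the curve becomes vertical. -/
theorem IsMaximalSolution.exists_eq_pi_div_two (h : Γ.IsMaximalSolution (m + 1) 0 δ)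
    (hδ : δ ^ 2 < m) : ∃ s : ℝ, 0 ≤ s ∧ (s : EReal) < Γ.S ∧ π / 2 ≤ Γ.θ s := by
  have hpi := pi_pos
  by_contra hno
  push Not at hno
  have hδ0 := h.pos
  have hm : 0 < (m : ℝ) - δ ^ 2 := by linarith
  have hlow : ∀ s : ℝ, 0 ≤ s → (s : EReal) < Γ.S → 0 < cos (Γ.θ s) ∧ 0 ≤ Γ.θ s ∧
      0 < turn m 0 (Γ.x s) (Γ.r s) (Γ.θ s) ∧
      (m - δ ^ 2) * (cos (Γ.θ s) / Γ.r s) ≤ turn m 0 (Γ.x s) (Γ.r s) (Γ.θ s) := by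
    intro s hs0 hs
    have hθ : ∀ t ∈ Icc 0 s, Γ.θ t < π / 2 := fun t ht =>
      hno t ht.1 ((EReal.coe_le_coe_iff.2 ht.2).trans_lt hs)
    obtain ⟨a, b, c⟩ := (h.traj hs).le_turn hδ hθ s ⟨hs0, le_rfl⟩
    exact ⟨a, b, (h.traj hs).turn_pos_of_graph hδ hθ ⟨hs0, le_rfl⟩, c⟩
  have hsn : ∀ s : ℝ, 0 ≤ s → (s : EReal) < Γ.S → 0 ≤ sin (Γ.θ s) := fun s hs0 hs =>
    sin_nonneg_of_nonneg_of_le_pi (hlow s hs0 hs).2.1 (by linarith [hno s hs0 hs])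
  have htop : Γ.S = ⊤ := by
    refine h.S_eq_top hδ0 fun s hs0 hs => ?_
    have := monotoneOn_of_deriv_nonneg le_rfl (h.traj hs).dr (fun t ht => hsn t ht.1.le
      ((EReal.coe_le_coe_iff.2 ht.2.le).trans_lt hs)) ⟨le_rfl, hs0⟩ ⟨hs0, le_rfl⟩ hs0
    rwa [(h.traj hs).r_zero] at this
  have hS : ∀ s : ℝ, (s : EReal) < Γ.S := fun s => htop ▸ EReal.coe_lt_top s
  have hmem : ∀ {s : ℝ}, 0 ≤ s → s ∈ Icc 0 s := fun hs => ⟨hs, le_rfl⟩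
  have hθpos : ∀ s : ℝ, 0 < s → 0 < Γ.θ s := fun s hs => by
    have := strictMonoOn_of_deriv_pos' le_rfl (h.traj (hS s)).dθ
      (fun t ht => (hlow t ht.1.le (hS t)).2.2.1) ⟨le_rfl, hs.le⟩ (hmem hs.le) hs
    rwa [(h.traj (hS s)).θ_zero] at this
  have hsnpos : ∀ s : ℝ, 0 < s → 0 < sin (Γ.θ s) := fun s hs =>
    sin_pos_of_pos_of_lt_pi (hθpos s hs) (by linarith [hno s hs.le (hS s)])
  have hrpos : ∀ s : ℝ, 0 ≤ s → 0 < Γ.r s := fun s hs => (h.traj (hS s)).r_pos s (hmem hs)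
  have hxpos : ∀ s : ℝ, 0 < s → 0 < Γ.x s := fun s hs => by
    have := strictMonoOn_of_deriv_pos' le_rfl (h.traj (hS s)).dx
      (fun t ht => (hlow t ht.1.le (hS t)).1) ⟨le_rfl, hs.le⟩ (hmem hs.le) hs
    rwa [(h.traj (hS s)).x_zero] at this
  -- a positive lower bound `k ≥ A / (δ + s)` for large `s` is impossible
  have habsurd : ∀ A > 0, ∀ t ≥ 0,
      (∀ s > t, A / (δ + s) ≤ turn m 0 (Γ.x s) (Γ.r s) (Γ.θ s)) → False := by
    intro A hA t ht hle
    -- At this time `A * log (δ + s)` has grown by exactly `π / 2` since time `t`.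
    set s := (δ + t) * exp (π / 2 / A) - δ with hs
    have h1 : 1 ≤ exp (π / 2 / A) := one_le_exp (by positivity)
    have hts : t ≤ s := by nlinarith
    have hs0 : 0 ≤ s := ht.trans hts
    have hmono := monotoneOn_of_deriv_nonneg (f := fun s => Γ.θ s - A * log (δ + s)) ht
      (fun u hu => ((h.traj (hS s)).dθ u ⟨ht.trans hu.1, hu.2⟩).sub
        ((((hasDerivWithinAt_id u _).const_add δ).log
          (by simp only [id]; linarith [hu.1])).const_mul A))
      (fun u hu => by
        have := hle u hu.1
        rw [div_eq_mul_one_div] at this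
        simp only [id]
        linarith) ⟨le_rfl, hts⟩ ⟨hts, le_rfl⟩ hts
    simp only at hmono
    have e : log (δ + s) = log (δ + t) + π / 2 / A := by
      rw [hs, add_sub_cancel, log_mul (by linarith) (exp_pos _).ne', log_exp]
    have e2 : A * (π / 2 / A) = π / 2 := by field_simp
    rw [e, mul_add, e2] at hmono
    linarith [hno s hs0 (hS s), (hlow t ht (hS t)).2.1]
  have hr_le : ∀ s : ℝ, 0 ≤ s → Γ.r s ≤ δ + s := fun s hs => (h.traj (hS s)).r_le (hmem hs)
  -- If `u` ever becomes nonnegative, it is afterwards bounded below by a positive constant, and so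
  -- is the curvature.
  by_cases hu : ∃ t : ℝ, 0 ≤ t ∧ 0 ≤ Γ.x t * sin (Γ.θ t) - Γ.r t * cos (Γ.θ t)
  · obtain ⟨t, ht0, ht⟩ := hu
    have hd : ∀ s : ℝ, 0 ≤ s → HasDerivWithinAt
        (fun s => Γ.x s * sin (Γ.θ s) - Γ.r s * cos (Γ.θ s)) _ (Ici 0) s :=
      fun s hs => (h.traj (hS s)).dsupport (hmem hs)
    have hmono : ∀ a b, 0 ≤ a → a < b → Γ.x a * sin (Γ.θ a) - Γ.r a * cos (Γ.θ a) <
        Γ.x b * sin (Γ.θ b) - Γ.r b * cos (Γ.θ b) := fun a b ha hab =>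
      strictMonoOn_of_deriv_pos' ha (b := b) (fun s hs => hd s (ha.trans hs.1))
        (fun s hs => by
          have hs0 := ha.trans_lt hs.1
          exact mul_pos (add_pos (mul_pos (hxpos s hs0) (hlow s hs0.le (hS s)).1)
            (mul_pos (hrpos s hs0.le) (hsnpos s hs0))) (hlow s hs0.le (hS s)).2.2.1)
        ⟨le_rfl, hab.le⟩ ⟨hab.le, le_rfl⟩ hab
    set u₁ := Γ.x (t + 1) * sin (Γ.θ (t + 1)) - Γ.r (t + 1) * cos (Γ.θ (t + 1)) with hu₁
    have hu₁0 : 0 < u₁ := ht.trans_lt (hmono t (t + 1) ht0 (by linarith))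
    refine habsurd u₁ hu₁0 (t + 1) (by linarith) fun s hs => ?_
    have h1 := hmono (t + 1) s (by linarith) hs
    have hs0 : 0 ≤ s := by linarith
    have h2 : u₁ / (δ + s) ≤ u₁ := div_le_self hu₁0.le (by linarith)
    have h3 : 0 ≤ (m : ℝ) / Γ.r s * cos (Γ.θ s) :=
      mul_nonneg (div_nonneg (by positivity) (hrpos s hs0).le) (hlow s hs0 (hS s)).1.le
    unfold turn
    linarith
  -- If `u < 0` throughout, then `x / r` is nondecreasing. With `r cos θ > x sin θ` this bounds `cos
  -- θ` from below, and the curvature is at least a constant over `δ + s`.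
  · push Not at hu
    set ε := Γ.x 1 / Γ.r 1 with hε
    have hε0 : 0 < ε := div_pos (hxpos 1 one_pos) (hrpos 1 zero_le_one)
    have hratio : ∀ s : ℝ, 1 ≤ s → ε * Γ.r s ≤ Γ.x s := fun s hs => by
      have hs0 : 0 ≤ s := zero_le_one.trans hs
      have := monotoneOn_of_deriv_nonneg (f := fun s => Γ.x s / Γ.r s) zero_le_one
        (fun u hu => ((h.traj (hS s)).dx u ⟨zero_le_one.trans hu.1, hu.2⟩).div
          ((h.traj (hS s)).dr u ⟨zero_le_one.trans hu.1, hu.2⟩)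
          (hrpos u (zero_le_one.trans hu.1)).ne')
        (fun u hu' => by
          have := hu u (zero_le_one.trans hu'.1.le)
          refine div_nonneg ?_ (sq_nonneg _)
          linarith) ⟨le_rfl, hs⟩ ⟨hs, le_rfl⟩ hs
      simp only at this
      rwa [le_div_iff₀ (hrpos s hs0)] at this
    have hcos : ∀ s : ℝ, 1 ≤ s → min (ε / 2) (1 / 2) ≤ cos (Γ.θ s) := fun s hs => by
      have hs0 : 0 ≤ s := zero_le_one.trans hs
      have hc := (hlow s hs0 (hS s)).1
      have h1 : ε * sin (Γ.θ s) ≤ cos (Γ.θ s) := by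
        refine le_of_mul_le_mul_left ?_ (hrpos s hs0)
        have h2 := mul_le_mul_of_nonneg_right (hratio s hs) (hsn s hs0 (hS s))
        linarith [hu s hs0]
      rcases le_or_gt (1 / 2) (sin (Γ.θ s)) with h2 | h2
      · exact (min_le_left _ _).trans (by nlinarith)
      · refine (min_le_right _ _).trans ?_
        nlinarith [sin_sq_add_cos_sq (Γ.θ s), hsn s hs0 (hS s)]
    have hμ : 0 < min (ε / 2) (1 / 2) := lt_min (by linarith) (by norm_num)
    refine habsurd ((m - δ ^ 2) * min (ε / 2) (1 / 2)) (by positivity) 1 zero_le_one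
      fun s hs => ?_
    have hs0 : 0 ≤ s := by linarith
    refine le_trans ?_ (hlow s hs0 (hS s)).2.2.2
    rw [mul_div_assoc]
    exact mul_le_mul_of_nonneg_left
      (div_le_div₀ (hlow s hs0 (hS s)).1.le (hcos s hs.le) (hrpos s hs0) (hr_le s hs0)) hm.le

theorem IsMaximalSolution.crosses_or_turnsAt_of_lam_eq_zero (h : Γ.IsMaximalSolution (m + 1) 0 δ)
    (hδ : δ ^ 2 < m) : Γ.Crosses ∨ ∃ L, Γ.TurnsAt L := by
  have hm : 1 ≤ m := by
    rcases Nat.eq_zero_or_pos m with rfl | hm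
    · rw [Nat.cast_zero] at hδ
      exact absurd hδ (not_lt.2 (sq_nonneg _))
    · exact hm
  obtain ⟨T, hT0, hT, hθT⟩ := h.exists_eq_pi_div_two hδ
  have ht := h.traj hT
  obtain ⟨t, ⟨htT, hθt⟩, hleast⟩ : ∃ t, IsLeast (Icc 0 T ∩ Γ.θ ⁻¹' Ici (π / 2)) t := by
    refine IsCompact.exists_isLeast ?_ ⟨T, ⟨hT0, le_rfl⟩, hθT⟩
    exact isCompact_Icc.of_isClosed_subset
      (ht.continuousOn_θ.preimage_isClosed_of_isClosed isClosed_Icc isClosed_Ici)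
      inter_subset_left
  have hlt : ∀ s ∈ Icc 0 T, s < t → Γ.θ s < π / 2 := fun s hs hst => by
    by_contra hge
    exact absurd (hleast ⟨hs, not_lt.1 hge⟩) (not_le.2 hst)
  have ht0 : 0 < t := by
    refine lt_of_le_of_ne htT.1 fun he => ?_
    have : π / 2 ≤ Γ.θ t := hθt
    rw [← he, ht.θ_zero] at this
    linarith [pi_pos]
  have hθ : Γ.θ t = π / 2 := by
    obtain ⟨u, hu, hu'⟩ := intermediate_value_Icc htT.1
      (ht.continuousOn_θ.mono (Icc_subset_Icc_right htT.2))
      (show π / 2 ∈ Icc (Γ.θ 0) (Γ.θ t) from ⟨by rw [ht.θ_zero]; linarith [pi_pos], hθt⟩)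
    rcases hu.2.eq_or_lt with he | hlt'
    · rwa [← he]
    · exact absurd hu' (hlt u ⟨hu.1, hu.2.trans htT.2⟩ hlt').ne
  have hmem : ∀ s ∈ Ioo 0 t, Γ.θ s ∈ Ioo 0 π := by
    intro s hs
    have hsT : s ≤ T := hs.2.le.trans htT.2
    have hpos : ∀ u ∈ Icc 0 s, 0 < turn m 0 (Γ.x u) (Γ.r u) (Γ.θ u) := fun u hu =>
      (ht.mono hsT).turn_pos_of_graph hδ (fun v hv =>
        hlt v ⟨hv.1, hv.2.trans hsT⟩ (hv.2.trans_lt hs.2)) hu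
    have := strictMonoOn_of_deriv_pos' le_rfl (ht.mono hsT).dθ
      (fun u hu => hpos u (Ioo_subset_Icc_self hu)) ⟨le_rfl, hs.1.le⟩ ⟨hs.1.le, le_rfl⟩ hs.1
    rw [ht.θ_zero] at this
    exact ⟨this, by linarith [hlt s ⟨hs.1.le, hsT⟩ hs.2, pi_pos]⟩
  rcases h.crosses_or_turnsAt hm ht0 ((EReal.coe_le_coe_iff.2 htT.2).trans_lt hT) hmem hθ with
    hc | ⟨L, -, hL⟩
  exacts [Or.inl hc, Or.inr ⟨L, hL⟩]

end PhaseCurve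

end LambdaHypersurface
end

/-! ### `λ = 0`: curves close to the cylinder turn at `x > 0`. -/

noncomputable section

namespace LambdaHypersurface

open Set Filter Real

namespace PhaseCurve

/-- The cylinder of radius `√m`. -/
def cylinder (m : ℕ) : PhaseCurve := ⟨⊤, id, fun _ => √m, fun _ => 0⟩

lemma cylinder_isMaximalSolution {m : ℕ} (hm : 1 ≤ m) :
    (cylinder m).IsMaximalSolution (m + 1) 0 (√m) := by
  have hm0 : (0 : ℝ) < m := by exact_mod_cast hm
  refine ⟨EReal.zero_lt_top, ⟨rfl, rfl, rfl, fun s _ _ => sqrt_pos.2 hm0, fun s _ _ => ?_,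
    fun s _ _ => ?_, fun s _ _ => ?_⟩, fun _ _ => le_top⟩
  · simpa [cylinder] using hasDerivWithinAt_id s (Ici 0)
  · simpa [cylinder] using hasDerivWithinAt_const s (Ici 0) (√m)
  · have : (m : ℝ) / √m = √m := div_sqrt
    simpa [cylinder, this] using hasDerivWithinAt_const s (Ici 0) (0 : ℝ)

end PhaseCurve

variable {m : ℕ} {δ T : ℝ} {x r θ : ℝ → ℝ}

/-- If `r` stayed below `√m`, then with `y = √m - r 1` the angle would reach `y / 2` by time `1`.
Afterwards `sin θ ≥ y / 4`, and `r` would gain `5 y / 4 > y` by time `6`. -/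
lemma Arc.sqrt_le_r_of_graph (h : Arc m 0 δ T x r θ) (hT : 6 ≤ T)
    (hθ : ∀ s ∈ Icc (0 : ℝ) 6, θ s < π / 6) : √m ≤ r 6 := by
  have hpi := pi_pos
  by_contra hlt
  rw [not_le] at hlt
  have h6 : (6 : ℝ) ∈ Icc 0 T := ⟨by norm_num, hT⟩
  have hmem : ∀ s ∈ Icc (0 : ℝ) 6, s ∈ Icc 0 T := fun s hs => ⟨hs.1, hs.2.trans hT⟩
  have h1 : (1 : ℝ) ∈ Icc (0 : ℝ) 6 := by norm_num
  have hr : ∀ s ∈ Icc (0 : ℝ) 6, r s < √m := fun s hs =>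
    (h.r_strictMono.monotoneOn (hmem s hs) h6 hs.2).trans_lt hlt
  have hc : ∀ s ∈ Icc (0 : ℝ) 6, 1 / 2 ≤ cos (θ s) := fun s hs => by
    rw [← cos_pi_div_three]
    have := (h.θ_mem_Icc (hmem s hs)).1
    exact cos_le_cos_of_nonneg_of_le_pi this (by linarith) (by linarith [hθ s hs])
  have hx : ∀ s ∈ Icc (0 : ℝ) 6, 0 ≤ x s := fun s hs => by
    have := monotoneOn_of_deriv_nonneg le_rfl (fun s hs => h.dx s (hmem s hs))
      (fun t ht => by linarith [hc t (Ioo_subset_Icc_self ht)]) ⟨le_rfl, by norm_num⟩ hs hs.1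
    rwa [h.x_zero] at this
  have hy : 0 < √m - r 1 := by linarith [hr 1 h1]
  have hθ1 : (√m - r 1) / 2 ≤ θ 1 := by
    have := monotoneOn_of_deriv_nonneg (f := fun s => θ s - (√m - r 1) / 2 * s) le_rfl (b := 1)
      (fun s hs => (h.dθ s ⟨hs.1, by linarith [hs.2]⟩).sub
        ((hasDerivWithinAt_id s (Ici 0)).const_mul ((√m - r 1) / 2)))
      (fun s hs => by
        have hs' : s ∈ Icc (0 : ℝ) 6 := ⟨hs.1.le, by linarith [hs.2]⟩
        have hr0 := h.r_pos s (hmem s hs')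
        have b1 : √m ≤ m / r s := by
          rw [le_div_iff₀ hr0]
          nlinarith [sq_sqrt (Nat.cast_nonneg (α := ℝ) m), hr s hs', sqrt_nonneg (m : ℝ)]
        have b2 : r s ≤ r 1 := h.r_strictMono.monotoneOn (hmem s hs') (hmem 1 h1) hs.2.le
        have b3 : (√m - r 1) * (1 / 2) ≤ (m / r s - r s) * cos (θ s) :=
          mul_le_mul (by linarith) (hc s hs') (by norm_num) (by linarith)
        have b4 := mul_nonneg (hx s hs') (h.sin_nonneg (hmem s hs'))
        unfold turn
        linarith) ⟨le_rfl, zero_le_one⟩ ⟨zero_le_one, le_rfl⟩ zero_le_one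
    simp only [h.θ_zero, mul_zero, sub_zero, mul_one] at this
    linarith
  have hsin : ∀ s ∈ Icc (1 : ℝ) 6, (√m - r 1) / 4 ≤ sin (θ s) := fun s hs => by
    have hs' : s ∈ Icc (0 : ℝ) 6 := ⟨by linarith [hs.1], hs.2⟩
    have b1 := h.θ_strictMono.monotoneOn (hmem 1 h1) (hmem s hs') hs.1
    have b2 := mul_le_sin (h.θ_mem_Icc (hmem s hs')).1 (by linarith [hθ s hs'])
    have b3 : 1 / 2 ≤ 2 / π := by
      rw [div_le_div_iff₀ two_pos hpi]
      linarith [pi_le_four]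
    have b4 := mul_le_mul b3 (hθ1.trans b1) (by linarith) (by positivity)
    linarith
  have := monotoneOn_of_deriv_nonneg (f := fun s => r s - (√m - r 1) / 4 * s) zero_le_one (b := 6)
    (fun s hs => (h.dr s ⟨by linarith [hs.1], hs.2.trans hT⟩).sub
      ((hasDerivWithinAt_id s (Ici 0)).const_mul ((√m - r 1) / 4)))
    (fun s hs => by linarith [hsin s (Ioo_subset_Icc_self hs)])
    ⟨le_rfl, by norm_num⟩ ⟨by norm_num, le_rfl⟩ (by norm_num)
  simp only at this
  linarith

/-- A curve that stays close to the cylinder for a while turns horizontal at a point with `x > 0`. -/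
lemma Arc.x_pos_of_graph (h : Arc m 0 δ T x r θ) (hm : 1 ≤ m) (hθT : π / 2 ≤ θ T)
    (hθ : ∀ s ∈ Icc (0 : ℝ) 6, θ s < π / 6) : 0 < x T := by
  have hpi := pi_pos
  obtain ⟨a, ha, hθa⟩ := h.exists_θ_eq (b := π / 2) (by linarith) hθT
  have ha6 : 6 < a := by
    by_contra hle
    linarith [hθ a ⟨ha.1, not_lt.1 hle⟩]
  have h6 : (6 : ℝ) ∈ Icc 0 T := ⟨by norm_num, ha6.le.trans ha.2⟩
  have hr6 := h.sqrt_le_r_of_graph h6.2 hθ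
  have hx6 : 3 ≤ x 6 := by
    have := monotoneOn_of_deriv_nonneg (f := fun s => x s - 1 / 2 * s) le_rfl (b := 6)
      (fun s hs => (h.dx s ⟨hs.1, hs.2.trans h6.2⟩).sub
        ((hasDerivWithinAt_id s (Ici 0)).const_mul (1 / 2)))
      (fun s hs => by
        have : 1 / 2 ≤ cos (θ s) := by
          rw [← cos_pi_div_three]
          exact cos_le_cos_of_nonneg_of_le_pi (h.θ_mem_Icc ⟨hs.1.le, hs.2.le.trans h6.2⟩).1
            (by linarith) (by linarith [hθ s (Ioo_subset_Icc_self hs)])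
        linarith) ⟨le_rfl, by norm_num⟩ ⟨by norm_num, le_rfl⟩ (by norm_num)
    simp only [h.x_zero] at this
    linarith
  have hxm := h.x_strictMono ha hθa.le
  have hxa : 3 ≤ x a := hx6.trans (hxm.monotoneOn ⟨h6.1, ha6.le⟩ ⟨ha.1, le_rfl⟩ ha6.le)
  have hra := h.r_pos a ha
  have hsq := sq_sqrt (Nat.cast_nonneg (α := ℝ) m)
  have hm1 : 1 ≤ √(m : ℝ) := one_le_sqrt.2 (by exact_mod_cast hm)
  -- Once `r ≥ √m` the first term of the curvature is nonpositive, so `θ' ≤ x a * r'`. The angle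
  -- still has to grow by more than `π / 3` to become vertical.
  have hdiff : π / 3 < x a * (r a - √m) := by
    have := antitoneOn_of_deriv_nonpos (f := fun s => θ s - x a * r s) h6.1
      (fun s hs => (h.dθ s ⟨h6.1.trans hs.1, hs.2.trans ha.2⟩).sub
        ((h.dr s ⟨h6.1.trans hs.1, hs.2.trans ha.2⟩).const_mul (x a)))
      (fun s hs => by
        have hs' : s ∈ Icc 0 T := ⟨h6.1.trans hs.1.le, hs.2.le.trans ha.2⟩
        have b1 := h.r_strictMono.monotoneOn h6 hs' hs.1.le
        have b2 : m / r s ≤ r s := by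
          rw [div_le_iff₀ (h.r_pos s hs')]
          nlinarith
        have b3 := h.cos_nonneg ha hθa.le ⟨hs'.1, hs.2.le⟩
        have b4 : x s ≤ x a := hxm.monotoneOn ⟨hs'.1, hs.2.le⟩ ⟨ha.1, le_rfl⟩ hs.2.le
        have b5 := mul_le_mul_of_nonneg_right b4 (h.sin_nonneg hs')
        have b6 := mul_nonneg (sub_nonneg.2 b2) b3
        unfold turn
        linarith) ⟨le_rfl, ha6.le⟩ ⟨ha6.le, le_rfl⟩ ha6.le
    simp only [hθa] at this
    have h5 := hθ 6 ⟨by norm_num, le_rfl⟩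
    have h7 := mul_le_mul_of_nonneg_left hr6 (by linarith : 0 ≤ x a)
    linarith
  have hgap : 0 < r a - √m := pos_of_mul_pos_right (by linarith : 0 < x a * (r a - √m)) (by linarith)
  -- This is exactly what makes the loss `π / 2 / K` smaller than `x a`. For `r a ≤ 2 √m` one has `K
  -- ≥ 3 / 2 * (r a - √m)`, which turns `π / 3` into `π / 2`; farther out `x a ≥ 3` and `K ≥ 3 / 2`
  -- suffice.
  have hAK : π / 2 < x a * (r a - m / r a + 0) := by
    rw [add_zero]
    rcases le_or_gt (r a) (2 * √m) with hle | hgt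
    · have hK : 3 / 2 * (r a - √m) ≤ r a - m / r a := by
        have e : r a - m / r a - 3 / 2 * (r a - √m) =
            (r a - √m) * (2 * √m - r a) / (2 * r a) := by
          clear hr6 hm1 hdiff hgap hle
          generalize √(m : ℝ) = q at hsq ⊢
          rw [← hsq]; field_simp; ring
        have := div_nonneg (mul_nonneg hgap.le (sub_nonneg.2 hle)) (by linarith : 0 ≤ 2 * r a)
        linarith
      have := mul_le_mul_of_nonneg_left hK (by linarith : 0 ≤ x a)
      linarith
    · have hK : 3 / 2 ≤ r a - m / r a := by
        have : m / r a ≤ √m / 2 := by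
          rw [div_le_div_iff₀ hra two_pos]
          nlinarith
        linarith
      have := mul_le_mul hxa hK (by norm_num) (by linarith)
      linarith [pi_lt_four]
  have hK0 : 0 < r a - m / r a + 0 :=
    pos_of_mul_pos_right (by linarith : 0 < x a * (r a - m / r a + 0)) (by linarith)
  have := h.le_x_of_turning le_rfl ha hθa.ge (by linarith) hK0 (t := T) ⟨ha.2, le_rfl⟩
  have h2 : π / 2 / (r a - m / r a + 0) < x a := by rwa [div_lt_iff₀ hK0]
  linarith

theorem exists_turnsAt_near_cylinder (hm : 1 ≤ m) : ∃ δ : ℝ, 0 < δ ∧ δ < √m ∧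
    ∀ Γ : PhaseCurve, Γ.IsMaximalSolution (m + 1) 0 δ → ∃ L, Γ.TurnsAt L ∧ 0 < Γ.x L := by
  have hpi := pi_pos
  have hm1 : 1 ≤ √(m : ℝ) := one_le_sqrt.2 (by exact_mod_cast hm)
  obtain ⟨ν, hν, H⟩ := (PhaseCurve.cylinder_isMaximalSolution hm).continuous_dependence (T := 6)
    (EReal.coe_lt_top _) (by norm_num) (show 0 < π / 6 by linarith)
  have hμ : 0 < min (ν / 2) (1 / 2) := lt_min (by linarith) (by norm_num)
  have hμ1 := min_le_left (ν / 2) (1 / 2)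
  have hμ2 := min_le_right (ν / 2) (1 / 2)
  refine ⟨√m - min (ν / 2) (1 / 2), by linarith, by linarith, fun Γ hΓ => ?_⟩
  have hsq : (√m - min (ν / 2) (1 / 2)) ^ 2 < m := by
    have := sq_sqrt (Nat.cast_nonneg (α := ℝ) m)
    nlinarith
  obtain ⟨-, hclose⟩ := H 0 _ Γ (by simpa using hν)
    (by rw [sub_sub_cancel_left, abs_neg, abs_of_pos hμ]; linarith) hΓ
  have hθ : ∀ s ∈ Icc (0 : ℝ) 6, Γ.θ s < π / 6 := fun s hs => by
    have := (abs_lt.1 (hclose s hs).2.2).2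
    simpa [PhaseCurve.cylinder] using this
  rcases hΓ.crosses_or_turnsAt_of_lam_eq_zero hsq with hc | ⟨L, hL⟩
  · obtain ⟨T, -, ha, hθT, -, hx⟩ := PhaseCurve.IsMaximalSolution.Crosses.exists_arc hΓ hm hc
    exact absurd hx (ha.x_pos_of_graph hm hθT.le hθ).ne'
  · refine ⟨L, hL, (hL.arc hΓ hm).x_pos_of_graph hm ?_ hθ⟩
    rw [hL.2.2.2.1]
    linarith

end LambdaHypersurface
end

/-! ### Types, choice of constants, and the two closed profiles. -/

noncomputable section

namespace LambdaHypersurface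

open Set Filter Real

namespace PhaseCurve

variable {Γ : PhaseCurve} {m : ℕ} {lam δ L : ℝ}

lemma TurnsAt.s₁_eq (hL : Γ.TurnsAt L) : Γ.s₁ = (L : EReal) := by
  refine le_antisymm (firstTime_le hL.1 hL.2.1 (Or.inr hL.2.2.2.1))
    (le_firstTime hL.2.1.le fun s hs => ?_)
  have := hL.2.2.1 s hs
  exact not_or.2 ⟨this.1.ne', this.2.ne⟩

lemma TurnsAt.s₃_lt (hL : Γ.TurnsAt L) (h : Γ.IsMaximalSolution (m + 1) lam δ) : Γ.s₃ < Γ.s₁ := by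
  have hpi := pi_pos
  have ht := h.traj hL.2.1
  obtain ⟨t, ht', hθt⟩ := intermediate_value_Icc hL.1.le ht.continuousOn_θ
    (show π / 2 ∈ Icc (Γ.θ 0) (Γ.θ L) by rw [ht.θ_zero, hL.2.2.2.1]; constructor <;> linarith)
  have ht0 : 0 < t := lt_of_le_of_ne ht'.1 fun he => by
    rw [← he, ht.θ_zero] at hθt
    linarith
  have htL : t < L := lt_of_le_of_ne ht'.2 fun he => by
    rw [he, hL.2.2.2.1] at hθt
    linarith
  rw [hL.s₁_eq]
  exact (firstTime_le ht0 ((EReal.coe_lt_coe_iff.2 htL).trans hL.2.1) (Or.inr hθt)).trans_lt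
    (EReal.coe_lt_coe_iff.2 htL)

lemma TurnsAt.s₄_eq (hL : Γ.TurnsAt L) (h : Γ.IsMaximalSolution (m + 1) lam δ) (hm : 1 ≤ m)
    (hx : Γ.x L = 0) : Γ.s₄ = Γ.s₁ := by
  rw [hL.s₁_eq]
  exact le_antisymm (firstTime_le hL.1 hL.2.1 hx) (le_firstTime hL.2.1.le fun s hs =>
    ((hL.arc h hm).x_pos hL.2.2.2.2 hs).ne')

lemma TurnsAt.s₁_lt_s₄ (hL : Γ.TurnsAt L) (h : Γ.IsMaximalSolution (m + 1) lam δ) (hm : 1 ≤ m)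
    (hx : 0 < Γ.x L) : Γ.s₁ < Γ.s₄ := by
  obtain ⟨T, hT, hTS⟩ := exists_gt_lt_S hL.2.1
  have hev : ∀ᶠ s in 𝓝[Icc 0 T] L, 0 < Γ.x s :=
    ((h.traj hTS).continuousOn_x L ⟨hL.1.le, hT.le⟩).eventually (lt_mem_nhds hx)
  obtain ⟨μ, hμ, hball⟩ := Metric.mem_nhdsWithin_iff.1 hev
  have hmin : 0 < min (μ / 2) (T - L) := lt_min (by linarith) (by linarith)
  have h1 := min_le_left (μ / 2) (T - L)
  have h2 := min_le_right (μ / 2) (T - L)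
  have h3 : ((L + min (μ / 2) (T - L) : ℝ) : EReal) ≤ Γ.s₄ := by
    refine le_firstTime ((EReal.coe_le_coe_iff.2 (by linarith)).trans hTS.le) fun s hs => ?_
    rcases lt_or_ge s L with hlt | hge
    · exact ((hL.arc h hm).x_pos hL.2.2.2.2 ⟨hs.1, hlt⟩).ne'
    · refine ne_of_gt (hball ⟨?_, hs.1.le, by linarith [hs.2]⟩)
      rw [Metric.mem_ball, Real.dist_eq, abs_of_nonneg (by linarith)]
      linarith [hs.2]
  rw [hL.s₁_eq]
  exact (EReal.coe_lt_coe_iff.2 (by linarith)).trans_le h3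

lemma IsMaximalSolution.isType11_iff (h : Γ.IsMaximalSolution (m + 1) lam δ) (hm : 1 ≤ m) :
    IsType11 (m + 1) lam δ ↔ 0 < turn m lam 0 δ 0 ∧ Γ.Crosses := by
  rw [IsType11, lt_cylinderRadius_iff m h.pos]
  constructor
  · rintro ⟨-, hk, Γ', h', hs⟩
    -- Persistence with zero perturbation transfers crossing between two maximal solutions with the
    -- same data.
    obtain ⟨ν, hν, H⟩ := ((h'.crosses_iff hk).1 hs).persists h' hm
    exact ⟨hk, H lam δ Γ (by simpa) (by simpa) h⟩
  · rintro ⟨hk, hc⟩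
    exact ⟨h.pos, hk, Γ, h, (h.crosses_iff hk).2 hc⟩

lemma TurnsAt.isType12 (hL : Γ.TurnsAt L) (h : Γ.IsMaximalSolution (m + 1) lam δ) (hm : 1 ≤ m)
    (hx : Γ.x L = 0) : IsType12 (m + 1) lam δ := by
  have ha := hL.arc h hm
  refine ⟨h.pos, (lt_cylinderRadius_iff m h.pos).2 ?_, Γ, h, hL.s₃_lt h, hL.s₄_eq h hm hx⟩
  simpa [ha.x_zero, ha.r_zero, ha.θ_zero] using ha.turn_pos 0 ha.zero_mem

lemma TurnsAt.isType13 (hL : Γ.TurnsAt L) (h : Γ.IsMaximalSolution (m + 1) lam δ) (hm : 1 ≤ m)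
    (hx : 0 < Γ.x L) : IsType13 (m + 1) lam δ := by
  have ha := hL.arc h hm
  refine ⟨h.pos, (lt_cylinderRadius_iff m h.pos).2 ?_, Γ, h, hL.s₃_lt h, hL.s₁_lt_s₄ h hm hx⟩
  simpa [ha.x_zero, ha.r_zero, ha.θ_zero] using ha.turn_pos 0 ha.zero_mem

/-- Near `λ = 0`, the curves with `δ` in a compact range that turn horizontal do so in a uniformly
bounded time. -/
theorem exists_turnsAt_le (hm : 1 ≤ m) {a b : ℝ} (ha : 0 < a) (hb : b < √m) :
    ∃ c > 0, ∃ M : ℝ, ∀ lam δ : ℝ, |lam| < c → δ ∈ Icc a b → ∀ (Γ : PhaseCurve) (L : ℝ),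
      Γ.IsMaximalSolution (m + 1) lam δ → Γ.TurnsAt L → L ≤ M := by
  -- Near each `δ` and `λ = 0` there are two cases: either all neighbouring curves cross, and then
  -- none of them turns, or they turn at most one unit of time after the curve for `λ = 0`.
  -- Compactness makes the bound uniform.
  refine isCompact_Icc.induction_on (p := fun s => ∃ c > 0, ∃ M : ℝ, ∀ lam δ : ℝ, |lam| < c →
    δ ∈ s → ∀ (Γ : PhaseCurve) (L : ℝ), Γ.IsMaximalSolution (m + 1) lam δ → Γ.TurnsAt L → L ≤ M)
    ?_ ?_ ?_ ?_
  · exact ⟨1, one_pos, 0, fun _ _ _ h => h.elim⟩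
  · rintro s t hst ⟨c, hc, M, H⟩
    exact ⟨c, hc, M, fun lam δ hl hδ => H lam δ hl (hst hδ)⟩
  · rintro s t ⟨c, hc, M, H⟩ ⟨c', hc', M', H'⟩
    refine ⟨min c c', lt_min hc hc', max M M', fun lam δ hl hδ Γ L hΓ hL => ?_⟩
    rcases hδ with hδ | hδ
    · exact (H lam δ (hl.trans_le (min_le_left _ _)) hδ Γ L hΓ hL).trans (le_max_left _ _)
    · exact (H' lam δ (hl.trans_le (min_le_right _ _)) hδ Γ L hΓ hL).trans (le_max_right _ _)
  · intro δ hδ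
    have hδ0 : 0 < δ := ha.trans_le hδ.1
    obtain ⟨Γ, hΓ⟩ := exists_isMaximalSolution m 0 hδ0
    have hsq : δ ^ 2 < m := (lt_sqrt hδ0.le).1 (hδ.2.trans_lt hb)
    have hball : ∀ ν > 0, Metric.ball δ ν ∈ 𝓝[Icc a b] δ := fun ν hν =>
      mem_nhdsWithin_of_mem_nhds (Metric.ball_mem_nhds δ hν)
    rcases hΓ.crosses_or_turnsAt_of_lam_eq_zero hsq with hc | ⟨L, hL⟩
    · obtain ⟨ν, hν, H⟩ := hc.persists hΓ hm
      refine ⟨_, hball ν hν, ν, hν, 0, fun lam δ' hl hδ' Γ' L' hΓ' hL' => ?_⟩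
      exact absurd (H lam δ' Γ' (by rwa [sub_zero]) (by rwa [Metric.mem_ball, Real.dist_eq] at hδ')
        hΓ') (hL'.not_crosses hΓ' hm)
    · obtain ⟨ν, hν, H⟩ := hL.persists hΓ hm one_pos
      refine ⟨_, hball ν hν, ν, hν, L + 1, fun lam δ' hl hδ' Γ' L' hΓ' hL' => ?_⟩
      obtain ⟨L'', h1, -, h0, -, -, hπ⟩ := H lam δ' Γ' (by rwa [sub_zero])
        (by rwa [Metric.mem_ball, Real.dist_eq] at hδ') hΓ'
      by_contra hlt
      exact (hL'.2.2.1 L'' ⟨h0, by linarith⟩).2.ne hπ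

end PhaseCurve

open PhaseCurve

/-- An endpoint of the set of crossing curves is of type 1.2. -/
lemma exists_turnsAt_of_mem_closure {m : ℕ} {lam δ δs : ℝ} (hm : 1 ≤ m) (hlam : lam < 0)
    (hδ : 0 < δ) (hk : 0 < turn m lam 0 δ 0)
    (hmem : δ ∈ closure {δ' | 0 < δ' ∧ δ' < δs ∧ IsType11 (m + 1) lam δ'})
    (hnot : ¬ IsType11 (m + 1) lam δ) :
    ∃ (Γ : PhaseCurve) (L : ℝ), Γ.IsMaximalSolution (m + 1) lam δ ∧ Γ.TurnsAt L ∧ Γ.x L = 0 := by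
  obtain ⟨Γ, hΓ⟩ := exists_isMaximalSolution m lam hδ
  rw [hΓ.isType11_iff hm, not_and] at hnot
  obtain ⟨L, hL, hx⟩ := hΓ.turnsAt_of_limit hm hlam hk (fun ν hν => by
    obtain ⟨δ', ⟨h0, -, h11⟩, hd⟩ := Metric.mem_closure_iff.1 hmem ν hν
    obtain ⟨Γ', hΓ'⟩ := exists_isMaximalSolution m lam h0
    rw [dist_comm, Real.dist_eq] at hd
    exact ⟨δ', Γ', hd, hΓ', ((hΓ'.isType11_iff hm).1 h11).2⟩) (hnot hk)
  exact ⟨Γ, L, hΓ, hL, hx⟩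

lemma exists_isType11_nhds {m : ℕ} {lam δ : ℝ} (hm : 1 ≤ m) (h : IsType11 (m + 1) lam δ) :
    ∃ ν > 0, ∀ δ', |δ' - δ| < ν → 0 < δ' → 0 < turn m lam 0 δ' 0 → IsType11 (m + 1) lam δ' := by
  obtain ⟨Γ, hΓ⟩ := exists_isMaximalSolution m lam h.1
  obtain ⟨ν, hν, H⟩ := ((hΓ.isType11_iff hm).1 h).2.persists hΓ hm
  refine ⟨ν, hν, fun δ' hd h0 hk => ?_⟩
  obtain ⟨Γ', hΓ'⟩ := exists_isMaximalSolution m lam h0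
  exact (hΓ'.isType11_iff hm).2 ⟨hk, H lam δ' Γ' (by simpa) hd hΓ'⟩

lemma exists_crosses_of_lam_eq_zero {m : ℕ} (hm : 1 ≤ m) :
    ∃ δ₀ > 0, ∀ (δ : ℝ) (Γ : PhaseCurve), δ ≤ δ₀ → Γ.IsMaximalSolution (m + 1) 0 δ →
      Γ.Crosses := by
  have hm1 : (1 : ℝ) ≤ m := by exact_mod_cast hm
  obtain ⟨δ₀, hδ₀, H⟩ := Arc.returning m hm
  refine ⟨min δ₀ (1 / 2), lt_min hδ₀ (by norm_num), fun δ Γ hδ hΓ => ?_⟩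
  have h2 := hδ.trans (min_le_right _ _)
  have h0 := hΓ.pos
  rcases hΓ.crosses_or_turnsAt_of_lam_eq_zero (by nlinarith) with hc | ⟨L, hL⟩
  · exact hc
  · exact (H δ L Γ.x Γ.r Γ.θ (hL.arc hΓ hm) (hδ.trans (min_le_left _ _)) hL.2.2.2.1
      hL.2.2.2.2).elim

/-- Two closed profile curves, at the endpoints of the set of parameters of type 1.1; the first one
is much longer than the second one. -/
theorem exists_closed_profiles {m : ℕ} (hm : 1 ≤ m) :
    ∃ c : ℝ, 0 < c ∧ ∃ δs : ℝ, 0 < δs ∧ δs < √m ∧ ∀ lam : ℝ, -c < lam → lam < 0 →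
      IsType13 (m + 1) lam δs ∧ ∃ δ₁ δ₂ : ℝ,
        IsGLB {δ : ℝ | 0 < δ ∧ δ < δs ∧ IsType11 (m + 1) lam δ} δ₁ ∧
        IsLUB {δ : ℝ | 0 < δ ∧ δ < δs ∧ IsType11 (m + 1) lam δ} δ₂ ∧ δ₁ < δ₂ ∧
        ∃ (Γ₁ Γ₂ : PhaseCurve) (L₁ L₂ : ℝ),
          (Γ₁.IsMaximalSolution (m + 1) lam δ₁ ∧ Γ₁.TurnsAt L₁ ∧ Γ₁.x L₁ = 0) ∧
          (Γ₂.IsMaximalSolution (m + 1) lam δ₂ ∧ Γ₂.TurnsAt L₂ ∧ Γ₂.x L₂ = 0) ∧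
          2 * L₂ + π * (δ₂ + L₂) < Γ₁.r L₁ - δ₁ := by
  have hpi := pi_pos
  have hm0 : (0 : ℝ) < m := by exact_mod_cast hm
  obtain ⟨δs, hδs0, hδs, Hs⟩ := exists_turnsAt_near_cylinder hm
  have hsq : δs ^ 2 < m := (lt_sqrt hδs0.le).1 hδs
  obtain ⟨Γs, hΓs⟩ := exists_isMaximalSolution m 0 hδs0
  obtain ⟨Ls, hLs, hxs⟩ := Hs Γs hΓs
  obtain ⟨νs, hνs, Ps⟩ := hLs.persists hΓs hm hxs
  obtain ⟨δ₀, hδ₀, Hc⟩ := exists_crosses_of_lam_eq_zero hm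
  have hpers : ∀ δ > 0, δ ≤ δ₀ → ∃ ν > 0, ∀ lam, |lam| < ν → 0 < turn m lam 0 δ 0 →
      IsType11 (m + 1) lam δ := by
    intro δ hδ hle
    obtain ⟨Γ, hΓ⟩ := exists_isMaximalSolution m 0 hδ
    obtain ⟨ν, hν, H⟩ := (Hc δ Γ hle hΓ).persists hΓ hm
    refine ⟨ν, hν, fun lam hl hk => ?_⟩
    obtain ⟨Γ', hΓ'⟩ := exists_isMaximalSolution m lam hδ
    exact (hΓ'.isType11_iff hm).2 ⟨hk, H lam δ Γ' (by rwa [sub_zero]) (by simpa) hΓ'⟩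
  set δb := min δ₀ (δs / 2) with hδb
  have hδb0 : 0 < δb := lt_min hδ₀ (by linarith)
  have hδbs : δb ≤ δs / 2 := min_le_right _ _
  obtain ⟨νb, hνb, Pb⟩ := hpers δb hδb0 (min_le_left _ _)
  obtain ⟨c₁, hc₁, M, HM⟩ := exists_turnsAt_le hm hδb0 hδs
  -- An upper bound for the intrinsic diameter of a torus whose parameter lies in `[δb, δs]`: a
  -- meridian of length `2 L` and a half circle of radius at most `δ + L`.
  set M' := 2 * M + π * (δs + M) with hM'
  obtain ⟨δM, hδM, c₂, hc₂, Hf⟩ := Arc.far m hm (M' + 1)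
  -- A crossing parameter so small that every closed profile with `δ ≤ δa` reaches beyond `M' + 1`
  -- from the axis. The infimum is at most `δa` and the supremum at least `δb`, which separates
  -- them.
  set δa := min (min δM 1) (δb / 2) with hδa
  have hδa0 : 0 < δa := lt_min (lt_min hδM one_pos) (by linarith)
  have hδab : δa ≤ δb / 2 := min_le_right _ _
  have hδaM : δa ≤ δM := (min_le_left _ _).trans (min_le_left _ _)
  have hδa1 : δa ≤ 1 := (min_le_left _ _).trans (min_le_right _ _)
  obtain ⟨νa, hνa, Pa⟩ := hpers δa hδa0 (by linarith [min_le_left δ₀ (δs / 2)])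
  -- For `|λ| < d` the initial curvature is positive for all `δ ≤ δs`; equivalently these `δ` lie
  -- below `R_λ`.
  set d := m / δs - δs with hd
  have hd0 : 0 < d := by
    rw [hd, sub_pos, lt_div_iff₀ hδs0]
    linarith [sq δs]
  have hcpos : 0 < min (min (min νs νb) (min νa c₁)) (min (min c₂ d) 1) :=
    lt_min (lt_min (lt_min hνs hνb) (lt_min hνa hc₁)) (lt_min (lt_min hc₂ hd0) one_pos)
  refine ⟨_, hcpos, δs, hδs0, hδs, fun lam hlam hlam0 => ?_⟩
  have habs : |lam| < min (min (min νs νb) (min νa c₁)) (min (min c₂ d) 1) := by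
    rw [abs_of_neg hlam0]; linarith
  simp only [lt_min_iff] at habs
  obtain ⟨⟨⟨hls, hlb⟩, hla, hl1⟩, ⟨hl2, hld⟩, hl3⟩ := habs
  have hk : ∀ δ, 0 < δ → δ ≤ δs → 0 < turn m lam 0 δ 0 := fun δ h0 hle => by
    rw [turn_initial]
    have : (m : ℝ) / δs ≤ m / δ := div_le_div_of_nonneg_left hm0.le h0 hle
    linarith [neg_abs_le lam]
  -- the parameter `δs` is of type 1.3
  obtain ⟨Γ, hΓ⟩ := exists_isMaximalSolution m lam hδs0
  obtain ⟨L, -, hxL, hL0, hLS, hLθ, hLπ⟩ := Ps lam δs Γ (by rwa [sub_zero]) (by simpa) hΓ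
  have hx0 : 0 < Γ.x L := by linarith [(abs_lt.1 hxL).1]
  have hL : Γ.TurnsAt L := ⟨hL0, hLS, hLθ, hLπ, hx0.le⟩
  refine ⟨hL.isType13 hΓ hm hx0, ?_⟩
  have hnots : ¬ IsType11 (m + 1) lam δs := fun h11 =>
    hL.not_crosses hΓ hm ((hΓ.isType11_iff hm).1 h11).2
  set A := {δ : ℝ | 0 < δ ∧ δ < δs ∧ IsType11 (m + 1) lam δ} with hA
  have hbA : δb ∈ A := ⟨hδb0, by linarith, Pb lam hlb (hk _ hδb0 (by linarith))⟩
  have haA : δa ∈ A := ⟨hδa0, by linarith, Pa lam hla (hk _ hδa0 (by linarith))⟩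
  -- a positive lower bound
  obtain ⟨δ₀', hδ₀', Hn⟩ := Arc.not_returning m hm hlam0 (by linarith [neg_abs_le lam])
  have hlow : ∀ δ ∈ A, δ₀' ≤ δ := by
    rintro δ ⟨h0, -, h11⟩
    by_contra hlt
    obtain ⟨Γ', hΓ'⟩ := exists_isMaximalSolution m lam h0
    obtain ⟨T, -, ha, hθ, -, hx⟩ :=
      IsMaximalSolution.Crosses.exists_arc hΓ' hm ((hΓ'.isType11_iff hm).1 h11).2
    exact Hn δ T _ _ _ ha (not_le.1 hlt).le hθ.le hx.ge (by linarith)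
  have hglb : IsGLB A (sInf A) := isGLB_csInf ⟨_, hbA⟩ ⟨δ₀', hlow⟩
  have hlub : IsLUB A (sSup A) := isLUB_csSup ⟨_, hbA⟩ ⟨δs, fun δ hδ => hδ.2.1.le⟩
  have h1pos : 0 < sInf A := hδ₀'.trans_le (hglb.2 hlow)
  have h1a : sInf A ≤ δa := hglb.1 haA
  have h2b : δb ≤ sSup A := hlub.1 hbA
  have h2s : sSup A ≤ δs := hlub.2 fun δ hδ => hδ.2.1.le
  -- Openness of crossing would produce a smaller element of `A`. The supremum is treated likewise,
  -- with `δs` itself excluded because it is of type 1.3.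
  have hnot1 : ¬ IsType11 (m + 1) lam (sInf A) := fun h11 => by
    obtain ⟨ν, hν, H⟩ := exists_isType11_nhds hm h11
    have hμ : 0 < min (ν / 2) (sInf A / 2) := lt_min (by linarith) (by linarith)
    have hμ1 := min_le_left (ν / 2) (sInf A / 2)
    have hμ2 := min_le_right (ν / 2) (sInf A / 2)
    have hmem : sInf A - min (ν / 2) (sInf A / 2) ∈ A :=
      ⟨by linarith, by linarith, H _ (by rw [sub_sub_cancel_left, abs_neg, abs_of_pos hμ]; linarith)
        (by linarith) (hk _ (by linarith) (by linarith))⟩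
    linarith [hglb.1 hmem]
  have hnot2 : ¬ IsType11 (m + 1) lam (sSup A) := fun h11 => by
    have hlt : sSup A < δs := lt_of_le_of_ne h2s fun he => hnots (he ▸ h11)
    obtain ⟨ν, hν, H⟩ := exists_isType11_nhds hm h11
    have hμ : 0 < min (ν / 2) ((δs - sSup A) / 2) := lt_min (by linarith) (by linarith)
    have hμ1 := min_le_left (ν / 2) ((δs - sSup A) / 2)
    have hμ2 := min_le_right (ν / 2) ((δs - sSup A) / 2)
    have hmem : sSup A + min (ν / 2) ((δs - sSup A) / 2) ∈ A :=
      ⟨by linarith, by linarith, H _ (by rw [add_sub_cancel_left, abs_of_pos hμ]; linarith)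
        (by linarith) (hk _ (by linarith) (by linarith))⟩
    linarith [hlub.1 hmem]
  obtain ⟨Γ₁, L₁, hΓ₁, hL₁, hx₁⟩ := exists_turnsAt_of_mem_closure hm hlam0 h1pos
    (hk _ h1pos (by linarith)) (hglb.mem_closure ⟨_, hbA⟩) hnot1
  obtain ⟨Γ₂, L₂, hΓ₂, hL₂, hx₂⟩ := exists_turnsAt_of_mem_closure hm hlam0 (by linarith)
    (hk _ (by linarith) h2s) (hlub.mem_closure ⟨_, hbA⟩) hnot2
  refine ⟨sInf A, sSup A, hglb, hlub, by linarith, Γ₁, Γ₂, L₁, L₂, ⟨hΓ₁, hL₁, hx₁⟩,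
    ⟨hΓ₂, hL₂, hx₂⟩, ?_⟩
  have hLM : L₂ ≤ M := HM lam _ hl1 ⟨h2b, h2s⟩ Γ₂ L₂ hΓ₂ hL₂
  have hr := Hf lam _ L₁ _ _ _ (hL₁.arc hΓ₁ hm) hlam0.le (by linarith [neg_abs_le lam])
    (h1a.trans hδaM) hx₁.ge hL₁.2.2.2.1
  have : π * (sSup A + L₂) ≤ π * (δs + M) := mul_le_mul_of_nonneg_left (by linarith) hpi.le
  linarith

end LambdaHypersurface
end

/-! ### Reflection and the periodic extension of a closed profile. -/

noncomputable section

namespace LambdaHypersurface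

open Set Filter Real

/-- A periodic solution of the profile curve equation, symmetric with respect to `x ↦ -x`, whose right
half is convex. -/
structure ClosedProfile (m : ℕ) (lam δ L : ℝ) (x r θ : ℝ → ℝ) : Prop where
  arc : Arc m lam δ L x r θ
  θ_end : θ L = π
  x_end : x L = 0
  dx : ∀ t, HasDerivAt x (cos (θ t)) t
  dr : ∀ t, HasDerivAt r (sin (θ t)) t
  dθ : ∀ t, HasDerivAt θ (turn m lam (x t) (r t) (θ t)) t
  r_pos : ∀ t, 0 < r t
  x_neg : ∀ t, x (-t) = -x t
  r_neg : ∀ t, r (-t) = r t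
  θ_neg : ∀ t, θ (-t) = -θ t
  x_add : ∀ t, x (t + 2 * L) = x t
  r_add : ∀ t, r (t + 2 * L) = r t
  θ_add : ∀ t, θ (t + 2 * L) = θ t + 2 * π

/-- This is the reflection symmetry in `x = 0`; reversal of time supplies the overall sign. The
integer `k` fixes the lift of the angle: `k = 0` reflects at the start, `k = 1` at the turning point
where `θ = π`. -/
lemma clampedField_reflect (m : ℕ) (lam : ℝ) {B : ℝ} (hB : 0 ≤ B) (k : ℤ) (p : ℝ × ℝ × ℝ) :
    clampedField m lam B (-p.1, p.2.1, k * (2 * π) - p.2.2) =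
      ((clampedField m lam B p).1, -(clampedField m lam B p).2.1, (clampedField m lam B p).2.2) := by
  have h1 : max (-B) (min B (-p.1)) = -max (-B) (min B p.1) := by grind
  have hs : sin (k * (2 * π) - p.2.2) = -sin p.2.2 := sin_int_mul_two_pi_sub p.2.2 k
  have hc : cos (k * (2 * π) - p.2.2) = cos p.2.2 := cos_int_mul_two_pi_sub p.2.2 k
  simp only [clampedField, field, clamp, turn, h1, hs, hc, neg_mul_neg]

/-- Solutions of the truncated equation starting on the axis of symmetry are symmetric. -/
lemma clamped_reflect {m : ℕ} {lam B : ℝ} (hB : 1 ≤ B) {Z : ℝ → ℝ × ℝ × ℝ}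
    (hZ : ∀ t, HasDerivAt Z (clampedField m lam B (Z t)) t) (k : ℤ) {T : ℝ} (hx : (Z T).1 = 0)
    (hθ : (Z T).2.2 = k * π) (t : ℝ) :
    Z (2 * T - t) = (-(Z t).1, (Z t).2.1, k * (2 * π) - (Z t).2.2) := by
  obtain ⟨K, -, hK⟩ := exists_lipschitzWith_clampedField m lam hB
  have hY : ∀ t, HasDerivAt (fun t => (-(Z (2 * T - t)).1, (Z (2 * T - t)).2.1,
      k * (2 * π) - (Z (2 * T - t)).2.2)) (clampedField m lam B (-(Z (2 * T - t)).1,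
      (Z (2 * T - t)).2.1, k * (2 * π) - (Z (2 * T - t)).2.2)) t := by
    intro t
    have h1 : HasDerivAt (fun t => Z (2 * T - t)) (-clampedField m lam B (Z (2 * T - t))) t := by
      have := (hZ (2 * T - t)).scomp t ((hasDerivAt_id t).const_sub (2 * T))
      simpa [Function.comp_def] using this
    have h2 : HasDerivAt (fun t => (Z (2 * T - t)).2) (-clampedField m lam B (Z (2 * T - t))).2 t :=
      (ContinuousLinearMap.snd ℝ ℝ (ℝ × ℝ)).hasFDerivAt.comp_hasDerivAt t h1
    have hx : HasDerivAt (fun t => (Z (2 * T - t)).1) (-clampedField m lam B (Z (2 * T - t))).1 t :=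
      (ContinuousLinearMap.fst ℝ ℝ (ℝ × ℝ)).hasFDerivAt.comp_hasDerivAt t h1
    have hr : HasDerivAt (fun t => (Z (2 * T - t)).2.1)
        (-clampedField m lam B (Z (2 * T - t))).2.1 t :=
      (ContinuousLinearMap.fst ℝ ℝ ℝ).hasFDerivAt.comp_hasDerivAt t h2
    have hθ : HasDerivAt (fun t => (Z (2 * T - t)).2.2)
        (-clampedField m lam B (Z (2 * T - t))).2.2 t :=
      (ContinuousLinearMap.snd ℝ ℝ ℝ).hasFDerivAt.comp_hasDerivAt t h2
    rw [clampedField_reflect m lam (by linarith) k]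
    refine (hx.neg.prodMk (hr.prodMk (hθ.const_sub (k * (2 * π))))).congr_deriv ?_
    simp
  have heq := ODE_solution_unique_univ (v := fun _ => clampedField m lam B) (s := fun _ => univ)
    (K := K) (t₀ := T) (f := fun t => (-(Z (2 * T - t)).1, (Z (2 * T - t)).2.1,
      k * (2 * π) - (Z (2 * T - t)).2.2)) (g := Z) (fun _ => hK.lipschitzOnWith)
    (fun t => ⟨hY t, mem_univ _⟩) (fun t => ⟨hZ t, mem_univ _⟩) (by
      have e : 2 * T - T = T := by ring
      simp only [e]
      refine Prod.ext ?_ (Prod.ext rfl ?_)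
      · simp [hx]
      · simp only [hθ]; ring)
  rw [← congrFun heq t]
  simp only [neg_neg, sub_sub_cancel, Prod.mk.eta]

lemma PhaseCurve.TurnsAt.exists_closedProfile {Γ : PhaseCurve} {m : ℕ} {lam δ L : ℝ}
    (hL : Γ.TurnsAt L) (h : Γ.IsMaximalSolution (m + 1) lam δ) (hm : 1 ≤ m) (hx : Γ.x L = 0) :
    ∃ x r θ : ℝ → ℝ, ClosedProfile m lam δ L x r θ ∧ Γ.S = ⊤ ∧
      ∀ s : ℝ, 0 ≤ s → Γ.x s = x s ∧ Γ.r s = r s ∧ Γ.θ s = θ s := by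
  have ha := hL.arc h hm
  have hL0 := hL.1
  obtain ⟨B, hB, hbox⟩ := ha.exists_box
  replace hbox := hbox B le_rfl
  obtain ⟨Z, hZ0, hZ⟩ := exists_clamped_solution m lam hB (0, δ, 0)
  have heq := ha.eqOn_clamped hB hbox hZ0 hZ
  have hZL : Z L = (0, Γ.r L, π) := by
    rw [← heq ha.end_mem]
    simp [hx, hL.2.2.2.1]
  have hneg : ∀ t, Z (-t) = (-(Z t).1, (Z t).2.1, -(Z t).2.2) := fun t => by
    have := clamped_reflect hB hZ 0 (T := 0) (by rw [hZ0]) (by simp [hZ0]) t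
    simpa using this
  have hrefl : ∀ t, Z (2 * L - t) = (-(Z t).1, (Z t).2.1, 2 * π - (Z t).2.2) := fun t => by
    have := clamped_reflect hB hZ 1 (T := L) (by rw [hZL]) (by simp [hZL]) t
    simpa using this
  -- The composition of the reflections at times `0` and `L` is the translation by `2 L`, which adds
  -- `2 π` to the angle.
  have hadd : ∀ t, Z (t + 2 * L) = ((Z t).1, (Z t).2.1, (Z t).2.2 + 2 * π) := fun t => by
    have e : t + 2 * L = 2 * L - -t := by ring
    rw [e, hrefl, hneg]
    simp [add_comm]
  have hbox₁ : ∀ t ∈ Icc (-L) L, InBox B (Z t) := by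
    intro t ht
    rcases le_total 0 t with h0 | h0
    · rw [← heq ⟨h0, ht.2⟩]; exact hbox t ⟨h0, ht.2⟩
    · have h1 : -t ∈ Icc 0 L := ⟨by linarith, by linarith [ht.1]⟩
      have h2 := hbox _ h1
      have h3 := heq h1
      simp only at h3
      rw [h3, hneg] at h2
      simpa [InBox] using h2
  -- Evenness and periodicity carry the bounds of the arc on `[0, L]` to all times, so the
  -- truncation never acts and `Z` is a global solution of the original equation.
  have hbox₂ : ∀ t, InBox B (Z t) := by
    have hper : Function.Periodic (fun t => InBox B (Z t)) (2 * L) := fun t => by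
      simp [InBox, hadd]
    intro t
    obtain ⟨s, hs, he⟩ := hper.exists_mem_Ico (by linarith) t (-L)
    rw [show InBox B (Z t) = InBox B (Z s) from he]
    exact hbox₁ s ⟨hs.1, by linarith [hs.2]⟩
  have hd : ∀ s, HasDerivAt Z (field m lam (Z s)) s := fun s => by
    have := hZ s
    rwa [clampedField, clamp_eq_of_inBox (hbox₂ s)] at this
  have h2 : ∀ s, HasDerivAt (fun s => (Z s).2) (field m lam (Z s)).2 s :=
    fun s => (ContinuousLinearMap.snd ℝ ℝ (ℝ × ℝ)).hasFDerivAt.comp_hasDerivAt s (hd s)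
  have hdx : ∀ s, HasDerivAt (fun s => (Z s).1) (cos (Z s).2.2) s :=
    fun s => (ContinuousLinearMap.fst ℝ ℝ (ℝ × ℝ)).hasFDerivAt.comp_hasDerivAt s (hd s)
  have hdr : ∀ s, HasDerivAt (fun s => (Z s).2.1) (sin (Z s).2.2) s :=
    fun s => (ContinuousLinearMap.fst ℝ ℝ ℝ).hasFDerivAt.comp_hasDerivAt s (h2 s)
  have hdθ : ∀ s, HasDerivAt (fun s => (Z s).2.2) (turn m lam (Z s).1 (Z s).2.1 (Z s).2.2) s :=
    fun s => (ContinuousLinearMap.snd ℝ ℝ ℝ).hasFDerivAt.comp_hasDerivAt s (h2 s)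
  have hrpos : ∀ t, 0 < (Z t).2.1 := fun t =>
    (inv_pos.2 (by linarith : 0 < B)).trans (hbox₂ t).2.1
  have htraj : ∀ T : ℝ, Traj m lam δ T (fun t => (Z t).1) (fun t => (Z t).2.1)
      (fun t => (Z t).2.2) := fun T => Traj.of_clamped hB hZ0 hZ fun s _ => hbox₂ s
  have hS : ∀ s : ℝ, 0 ≤ s → (s : EReal) < Γ.S := fun s hs => h.lt_S (htraj s) hs
  have heqs : ∀ s : ℝ, 0 ≤ s → Γ.x s = (Z s).1 ∧ Γ.r s = (Z s).2.1 ∧ Γ.θ s = (Z s).2.2 :=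
    fun s hs => h.eq_of_traj (htraj s) ⟨hs, le_rfl⟩
  refine ⟨fun t => (Z t).1, fun t => (Z t).2.1, fun t => (Z t).2.2, ?_, ?_, heqs⟩
  · exact
    { arc :=
      { toTraj := htraj L
        T_pos := hL0
        turn_pos := fun s hs => by
          have := ha.turn_pos s hs
          rwa [(heqs s hs.1).1, (heqs s hs.1).2.1, (heqs s hs.1).2.2] at this
        θ_le := by simp [hZL] }
      θ_end := by simp [hZL]
      x_end := by simp [hZL]
      dx := hdx
      dr := hdr
      dθ := hdθ
      r_pos := hrpos
      x_neg := fun t => by rw [hneg]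
      r_neg := fun t => by rw [hneg]
      θ_neg := fun t => by rw [hneg]
      x_add := fun t => by rw [hadd]
      r_add := fun t => by rw [hadd]
      θ_add := fun t => by rw [hadd] }
  · by_contra hne
    have hbot : Γ.S ≠ ⊥ := (bot_lt_iff_ne_bot.1 (bot_le.trans_lt h.1))
    have h1 := hS (max 0 Γ.S.toReal) (le_max_left _ _)
    have h3 : Γ.S ≤ ((max 0 Γ.S.toReal : ℝ) : EReal) := by
      rw [← EReal.coe_toReal hne hbot]
      exact EReal.coe_le_coe_iff.2 (by simp)
    exact absurd h1 (not_lt.2 h3)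

namespace ClosedProfile

variable {m : ℕ} {lam δ L : ℝ} {x r θ : ℝ → ℝ}

lemma L_pos (h : ClosedProfile m lam δ L x r θ) : 0 < L := h.arc.T_pos

lemma contDiff (h : ClosedProfile m lam δ L x r θ) :
    ContDiff ℝ ∞ x ∧ ContDiff ℝ ∞ r ∧ ContDiff ℝ ∞ θ := by
  have key : ∀ k : ℕ, ContDiff ℝ k x ∧ ContDiff ℝ k r ∧ ContDiff ℝ k θ := by
    intro k
    induction k with
    | zero =>
      exact ⟨contDiff_zero.2 (continuous_iff_continuousAt.2 fun t => (h.dx t).continuousAt),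
        contDiff_zero.2 (continuous_iff_continuousAt.2 fun t => (h.dr t).continuousAt),
        contDiff_zero.2 (continuous_iff_continuousAt.2 fun t => (h.dθ t).continuousAt)⟩
    | succ k ih =>
      obtain ⟨hx, hr, hθ⟩ := ih
      have step : ∀ f f' : ℝ → ℝ, (∀ t, HasDerivAt f (f' t) t) → ContDiff ℝ k f' →
          ContDiff ℝ ((k + 1 : ℕ) : ℕ∞ω) f := by
        intro f f' hf hf'
        rw [show (((k + 1 : ℕ) : ℕ∞ω)) = (k : ℕ∞ω) + 1 by norm_cast, contDiff_succ_iff_deriv]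
        refine ⟨fun t => (hf t).differentiableAt, by simp, ?_⟩
        rwa [show deriv f = f' from funext fun t => (hf t).deriv]
      refine ⟨step _ _ h.dx (contDiff_cos.comp hθ), step _ _ h.dr (contDiff_sin.comp hθ),
        step _ _ h.dθ ?_⟩
      unfold turn
      exact ((((contDiff_const.div hr fun t => (h.r_pos t).ne').sub hr).mul
        (contDiff_cos.comp hθ)).add (hx.mul (contDiff_sin.comp hθ))).add contDiff_const
  exact ⟨contDiff_infty.2 fun k => (key k).1, contDiff_infty.2 fun k => (key k).2.1,
    contDiff_infty.2 fun k => (key k).2.2⟩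

lemma x_pos (h : ClosedProfile m lam δ L x r θ) {t : ℝ} (ht : t ∈ Ioo 0 L) : 0 < x t :=
  h.arc.x_pos h.x_end.ge ht

lemma r_abs (h : ClosedProfile m lam δ L x r θ) (t : ℝ) : r |t| = r t := by
  rcases abs_choice t with h1 | h1 <;> rw [h1]
  exact h.r_neg t

lemma abs_x (h : ClosedProfile m lam δ L x r θ) {t : ℝ} (ht : |t| ≤ L) : |x t| = x |t| := by
  have h0 := h.arc.x_nonneg h.x_end.ge ⟨abs_nonneg t, ht⟩
  rcases abs_choice t with h1 | h1
  · rw [h1] at h0 ⊢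
    exact abs_of_nonneg h0
  · rw [h1] at h0 ⊢
    rw [← abs_of_nonneg h0, h.x_neg, abs_neg]

/-- The profile curve is simple. -/
lemma injOn (h : ClosedProfile m lam δ L x r θ) {s t : ℝ} (hs : s ∈ Ioc (-L) L)
    (ht : t ∈ Ioc (-L) L) (hx : x s = x t) (hr : r s = r t) : s = t := by
  have hL := h.L_pos
  have has : |s| ∈ Icc 0 L := ⟨abs_nonneg s, abs_le.2 ⟨hs.1.le, hs.2⟩⟩
  have hat : |t| ∈ Icc 0 L := ⟨abs_nonneg t, abs_le.2 ⟨ht.1.le, ht.2⟩⟩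
  -- The function `r` is even and strictly increasing on `[0, L]`, so equal radii leave only the
  -- ambiguity of sign. It is resolved by `x`, which is odd and positive on `(0, L)`.
  have habs : |s| = |t| := by
    refine h.arc.r_strictMono.injOn has hat ?_
    rw [h.r_abs, h.r_abs, hr]
  rcases abs_eq_abs.1 habs with he | he
  · exact he
  have hxt : x t = 0 := by
    have : x s = -x t := by rw [he, h.x_neg]
    linarith
  have hxat : x |t| = 0 := by rw [← h.abs_x hat.2, hxt, abs_zero]
  rcases hat.1.eq_or_lt with h0 | h0
  · rw [abs_eq_zero.1 h0.symm, neg_zero] at he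
    rw [he, abs_eq_zero.1 h0.symm]
  rcases hat.2.eq_or_lt with h1 | h1
  · rw [h1] at habs
    rcases abs_eq hL.le |>.1 h1 with h2 | h2
    · rw [h2] at he; exact absurd hs.1 (by rw [he]; exact lt_irrefl _)
    · exact absurd ht.1 (by rw [h2]; exact lt_irrefl _)
  · exact absurd hxat (h.x_pos ⟨h0, h1⟩).ne'

end ClosedProfile

end LambdaHypersurface
end

/-! ### Parametrization of tori of revolution. -/

noncomputable section

namespace LambdaHypersurface

open Set Filter Real

/-! ### The ambient space as `ℝ × ℝⁿ` -/

/-- The identification `ℝ × ℝⁿ = ℝⁿ⁺¹`. -/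
def join (n : ℕ) : (ℝ × EuclideanSpace ℝ (Fin n)) →L[ℝ] Ambient n :=
  LinearMap.toContinuousLinearMap
    { toFun := fun p => WithLp.toLp 2 (Fin.cons p.1 p.2.ofLp : Fin (n + 1) → ℝ)
      map_add' := fun p q => by
        ext i
        refine Fin.cases ?_ (fun j => ?_) i <;> simp
      map_smul' := fun c p => by
        ext i
        refine Fin.cases ?_ (fun j => ?_) i <;> simp }

variable {n : ℕ}

lemma join_apply_zero (p : ℝ × EuclideanSpace ℝ (Fin n)) : join n p 0 = p.1 := rfl

lemma join_apply_succ (p : ℝ × EuclideanSpace ℝ (Fin n)) (i : Fin n) : join n p i.succ = p.2 i := rfl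

lemma inner_join (p q : ℝ × EuclideanSpace ℝ (Fin n)) :
    inner ℝ (join n p) (join n q) = p.1 * q.1 + inner ℝ p.2 q.2 := by
  rw [PiLp.inner_apply, PiLp.inner_apply, Fin.sum_univ_succ]
  simp only [join_apply_zero, join_apply_succ]
  congr 1
  simp [mul_comm]

lemma norm_join_sq (p : ℝ × EuclideanSpace ℝ (Fin n)) :
    ‖join n p‖ ^ 2 = p.1 ^ 2 + ‖p.2‖ ^ 2 := by
  rw [← real_inner_self_eq_norm_sq, inner_join, real_inner_self_eq_norm_sq]
  ring

lemma axisDist_join (p : ℝ × EuclideanSpace ℝ (Fin n)) : axisDist (join n p) = ‖p.2‖ := rfl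

lemma join_surj (q : Ambient n) : ∃ v : EuclideanSpace ℝ (Fin n), q = join n (q 0, v) ∧
    axisDist q = ‖v‖ := by
  refine ⟨WithLp.toLp 2 fun i : Fin n => q i.succ, ?_, rfl⟩
  ext i
  refine Fin.cases ?_ (fun j => ?_) i
  · rw [join_apply_zero]
  · rw [join_apply_succ]

lemma join_injective : Function.Injective (join n) := by
  intro p q h
  refine Prod.ext ?_ ?_
  · rw [← join_apply_zero p, h, join_apply_zero]
  · ext i
    rw [← join_apply_succ p, h, join_apply_succ]

lemma continuous_axisDist : Continuous (axisDist (n := n)) := by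
  unfold axisDist
  fun_prop

lemma norm_le_axisDist (q : Ambient n) : ‖q‖ ≤ |q 0| + axisDist q := by
  obtain ⟨v, hq, hd⟩ := join_surj q
  have h1 := norm_join_sq (q 0, v)
  rw [← hq, ← hd] at h1
  simp only at h1
  have h2 : 0 ≤ axisDist q := by rw [hd]; exact norm_nonneg v
  rw [← sq_abs (q 0)] at h1
  refine le_of_sq_le_sq ?_ (add_nonneg (abs_nonneg _) h2)
  nlinarith [mul_nonneg (abs_nonneg (q 0)) h2]

/-! ### Swept out maps -/

/-- `(t, v) ↦ (f t, g t v)`. -/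
def sweep (n : ℕ) (f g : ℝ → ℝ) (p : ℝ × EuclideanSpace ℝ (Fin n)) : Ambient n :=
  join n (f p.1, g p.1 • p.2)

lemma contDiff_sweep {f g : ℝ → ℝ} (hf : ContDiff ℝ ∞ f) (hg : ContDiff ℝ ∞ g) :
    ContDiff ℝ ∞ (sweep n f g) := by
  unfold sweep
  exact (join n).contDiff.comp ((hf.comp contDiff_fst).prodMk
    ((hg.comp contDiff_fst).smul contDiff_snd))

lemma exists_hasFDerivAt_sweep {f g : ℝ → ℝ} {f' g' t : ℝ} (hf : HasDerivAt f f' t)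
    (hg : HasDerivAt g g' t) (v : EuclideanSpace ℝ (Fin n)) :
    ∃ D : ℝ × EuclideanSpace ℝ (Fin n) →L[ℝ] Ambient n, HasFDerivAt (sweep n f g) D (t, v) ∧
      ∀ a w, D (a, w) = join n (f' * a, g t • w + (g' * a) • v) := by
  have h1 : HasFDerivAt (fun p : ℝ × EuclideanSpace ℝ (Fin n) => f p.1) _ (t, v) :=
    hf.hasFDerivAt.comp (t, v) hasFDerivAt_fst
  have h2 : HasFDerivAt (fun p : ℝ × EuclideanSpace ℝ (Fin n) => g p.1) _ (t, v) :=
    hg.hasFDerivAt.comp (t, v) hasFDerivAt_fst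
  refine ⟨_, (join n).hasFDerivAt.comp (t, v) (h1.prodMk (h2.smul hasFDerivAt_snd)), ?_⟩
  intro a w
  simp [mul_comm]

section Derivative

variable {E F H M : Type*} [NormedAddCommGroup E] [NormedSpace ℝ E] [NormedAddCommGroup F]
  [NormedSpace ℝ F] [TopologicalSpace H] {E₀ : Type*} [NormedAddCommGroup E₀] [NormedSpace ℝ E₀]
  {I : ModelWithCorners ℝ E₀ H} [TopologicalSpace M] [ChartedSpace H M]

lemma mvfderiv_comp_hasFDerivAt {f : M → E} {g : E → F} {D : E →L[ℝ] F} {p : M}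
    (hg : HasFDerivAt g D (f p)) (hf : MDifferentiableAt I 𝓘(ℝ, E) f p) (v : TangentSpace I p) :
    mvfderiv I (g ∘ f) p v = D (mvfderiv I f p v) := by
  have h := (hg.hasMFDerivAt.comp p hf.hasMFDerivAt).mfderiv
  have h2 : mfderiv I 𝓘(ℝ, F) (g ∘ f) p v = D (mfderiv I 𝓘(ℝ, E) f p v) := by
    rw [h]; rfl
  exact h2

lemma mvfderiv_prodMk_space {f : M → E} {g : M → F} {p : M} (hf : MDifferentiableAt I 𝓘(ℝ, E) f p)
    (hg : MDifferentiableAt I 𝓘(ℝ, F) g p) (v : TangentSpace I p) :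
    mvfderiv I (fun q => (f q, g q)) p v = (mvfderiv I f p v, mvfderiv I g p v) := by
  have h1 := hf.hasMFDerivAt
  have h2 := hg.hasMFDerivAt
  have h : HasMFDerivAt I 𝓘(ℝ, E × F) (fun q => (f q, g q)) p
      ((mfderiv I 𝓘(ℝ, E) f p).prod (mfderiv I 𝓘(ℝ, F) g p)) :=
    ⟨h1.1.prodMk h2.1, h1.2.prodMk h2.2⟩
  have h3 : mfderiv I 𝓘(ℝ, E × F) (fun q => (f q, g q)) p v =
      (mfderiv I 𝓘(ℝ, E) f p v, mfderiv I 𝓘(ℝ, F) g p v) := by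
    rw [h.mfderiv]; rfl
  exact h3

end Derivative

/-! ### Local angle functions on the circle -/

/-- The multiple of the angle of `z` which is smooth near `z₀`. -/
def localAngle (L : ℝ) (z₀ z : Circle) : ℝ :=
  L / π * (Complex.arg z₀ + Complex.arg ((z : ℂ) / z₀))

def angle (L : ℝ) (z : Circle) : ℝ := L / π * Complex.arg z

lemma localAngle_self (L : ℝ) (z : Circle) : localAngle L z z = angle L z := by
  simp [localAngle, angle]

/-- The argument jumps at `-1`; the jump is a period `2 L`, invisible to `2 L`-periodic functions,
so near each point `angle` may be replaced by the smooth `localAngle`. -/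
lemma exists_angle_eq (L : ℝ) (z₀ z : Circle) :
    ∃ k : ℤ, angle L z = localAngle L z₀ z + k * (2 * L) := by
  have h : ((Complex.arg z : ℝ) : Real.Angle) =
      ((Complex.arg z₀ + Complex.arg ((z : ℂ) / z₀) : ℝ) : Real.Angle) := by
    rw [Real.Angle.coe_add, ← Complex.arg_mul_coe_angle z₀.coe_ne_zero
      (div_ne_zero z.coe_ne_zero z₀.coe_ne_zero), mul_div_cancel₀ _ z₀.coe_ne_zero]
  obtain ⟨k, hk⟩ := Real.Angle.angle_eq_iff_two_pi_dvd_sub.1 h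
  refine ⟨k, ?_⟩
  rw [angle, localAngle, sub_eq_iff_eq_add.1 hk]
  field_simp
  ring

attribute [local instance] finrank_real_complex_fact'

lemma contMDiff_circle_coe : ContMDiff (𝓡 1) 𝓘(ℝ, ℂ) ∞ (fun z : Circle => (z : ℂ)) :=
  contMDiff_coe_sphere

lemma contMDiffAt_localAngle (L : ℝ) (z₀ : Circle) :
    ContMDiffAt (𝓡 1) 𝓘(ℝ, ℝ) ∞ (localAngle L z₀) z₀ := by
  have h1 : ContDiffAt ℝ ∞ (fun w : ℂ => L / π * (Complex.arg z₀ + (Complex.log (w / z₀)).im))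
      (z₀ : ℂ) := by
    have h2 : ContDiffAt ℝ ∞ (fun w : ℂ => Complex.log (w / z₀)) (z₀ : ℂ) := by
      have h3 : ContDiffAt ℂ ∞ (fun w : ℂ => Complex.log (w / z₀)) (z₀ : ℂ) := by
        refine ContDiffAt.comp _ (Complex.contDiffAt_log ?_) (contDiffAt_id.div_const _)
        simp [z₀.coe_ne_zero]
      exact h3.restrict_scalars ℝ
    exact contDiffAt_const.mul (contDiffAt_const.add (Complex.imCLM.contDiff.contDiffAt.comp _ h2))
  have h2 := h1.contMDiffAt.comp z₀ contMDiff_circle_coe.contMDiffAt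
  refine h2.congr_of_eventuallyEq (Eventually.of_forall fun z => ?_)
  simp only [localAngle, Complex.log_im]
  rfl

lemma coe_eq_exp_localAngle {L : ℝ} (hL : 0 < L) (z₀ z : Circle) :
    (z : ℂ) = Complex.exp ((π / L * localAngle L z₀ z : ℝ) * Complex.I) := by
  have e : π / L * localAngle L z₀ z = Complex.arg z₀ + Complex.arg ((z : ℂ) / z₀) := by
    rw [localAngle]
    have := pi_pos
    field_simp
  rw [e, Complex.ofReal_add, add_mul, Complex.exp_add]
  have h1 : ∀ w : ℂ, ‖w‖ = 1 → Complex.exp (Complex.arg w * Complex.I) = w := fun w hw => by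
    have := Complex.norm_mul_exp_arg_mul_I w
    rwa [hw, Complex.ofReal_one, one_mul] at this
  rw [h1 _ z₀.norm_coe, h1 _ (by rw [norm_div, z.norm_coe, z₀.norm_coe, div_one]),
    mul_div_cancel₀ _ z₀.coe_ne_zero]

/-- The inclusion of the circle in the plane factors through `localAngle`, so the kernel of its
derivative is contained in that of the immersion. -/
lemma mvfderiv_localAngle_injective {L : ℝ} (hL : 0 < L) (z₀ : Circle) :
    Function.Injective (mvfderiv (𝓡 1) (localAngle L z₀) z₀) := by
  rw [injective_iff_map_eq_zero]
  intro v hv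
  have hd := (contMDiffAt_localAngle L z₀).mdifferentiableAt (by simp)
  have hE : DifferentiableAt ℝ (fun t : ℝ => Complex.exp ((π / L * t : ℝ) * Complex.I))
      (localAngle L z₀ z₀) := by
    fun_prop
  have h1 : (fun z : Circle => (z : ℂ)) =
      (fun t : ℝ => Complex.exp ((π / L * t : ℝ) * Complex.I)) ∘ localAngle L z₀ :=
    funext fun z => coe_eq_exp_localAngle hL z₀ z
  have h2 : mvfderiv (𝓡 1) (fun z : Circle => (z : ℂ)) z₀ v = 0 := by
    rw [h1, mvfderiv_comp_hasFDerivAt hE.hasFDerivAt hd, hv, map_zero]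
  have h3 := injective_mvfderiv_subtypeVal_sphere (E := ℂ) (n := 1)
    (⟨(z₀ : ℂ), by rw [mem_sphere_zero_iff_norm]; exact z₀.norm_coe⟩ : Metric.sphere (0 : ℂ) 1)
  exact (injective_iff_map_eq_zero _).1 h3 v h2

/-! ### The parametrized tori -/

/-- The map `(z, α) ↦ (f t, g t α)`, where `t` is the rescaled angle of `z`. -/
def torusMap (n : ℕ) (L : ℝ) (f g : ℝ → ℝ) (p : Torus n) : Ambient n :=
  sweep n f g (angle L p.1, p.2)

/-- Around each point the map is a smooth function of two smooth coordinates; smoothness and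
derivatives are read off from this factorization. -/
lemma torusMap_eq {L : ℝ} {f g : ℝ → ℝ} (hf : Function.Periodic f (2 * L))
    (hg : Function.Periodic g (2 * L)) (z₀ : Circle) :
    torusMap n L f g = sweep n f g ∘ fun p => (localAngle L z₀ p.1, (p.2 : EuclideanSpace ℝ (Fin n))) := by
  funext p
  obtain ⟨k, hk⟩ := exists_angle_eq L z₀ p.1
  simp only [torusMap, sweep, Function.comp_apply, hk]
  rw [hf.int_mul k, hg.int_mul k]

variable [NeZero n]

lemma contMDiffAt_localAngle_fst (L : ℝ) (p : Torus n) :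
    ContMDiffAt (torusModel n) 𝓘(ℝ, ℝ) ∞ (fun q : Torus n => localAngle L p.1 q.1) p :=
  ContMDiffAt.comp (g := localAngle L p.1) (f := Prod.fst) p (contMDiffAt_localAngle L p.1)
    contMDiffAt_fst

lemma contMDiffAt_coe (w : Metric.sphere (0 : EuclideanSpace ℝ (Fin n)) 1) :
    ContMDiffAt (𝓡 (n - 1)) 𝓘(ℝ, EuclideanSpace ℝ (Fin n)) ∞
      (Subtype.val : Metric.sphere (0 : EuclideanSpace ℝ (Fin n)) 1 → EuclideanSpace ℝ (Fin n)) w :=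
  contMDiff_coe_sphere w

lemma contMDiffAt_coe_snd (p : Torus n) : ContMDiffAt (torusModel n) 𝓘(ℝ, EuclideanSpace ℝ (Fin n))
    ∞ (fun q : Torus n => (q.2 : EuclideanSpace ℝ (Fin n))) p :=
  ContMDiffAt.comp p (contMDiffAt_coe p.2) contMDiffAt_snd

lemma contMDiff_torusMap {L : ℝ} {f g : ℝ → ℝ} (hf : Function.Periodic f (2 * L))
    (hg : Function.Periodic g (2 * L)) (hf' : ContDiff ℝ ∞ f) (hg' : ContDiff ℝ ∞ g) :
    ContMDiff (torusModel n) 𝓘(ℝ, Ambient n) ∞ (torusMap n L f g) := by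
  intro p
  rw [torusMap_eq hf hg p.1]
  exact (contDiff_sweep hf' hg').contMDiff.contMDiffAt.comp p
    ((contMDiffAt_localAngle_fst L p).prodMk_space (contMDiffAt_coe_snd p))

/-- The derivative of the rescaled angle. -/
def angleDeriv (L : ℝ) (p : Torus n) (v : TangentSpace (torusModel n) p) : ℝ :=
  mvfderiv (𝓡 1) (localAngle L p.1) p.1 v.1

/-- The component of a tangent vector along the sphere. -/
def sphereDeriv (p : Torus n) (v : TangentSpace (torusModel n) p) : EuclideanSpace ℝ (Fin n) :=
  mvfderiv (𝓡 (n - 1)) (Subtype.val : Metric.sphere (0 : EuclideanSpace ℝ (Fin n)) 1 → EuclideanSpace ℝ (Fin n)) p.2 v.2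

lemma mvfderiv_torusMap {L : ℝ} {f g : ℝ → ℝ} (hf : Function.Periodic f (2 * L))
    (hg : Function.Periodic g (2 * L)) (p : Torus n) {f' g' : ℝ}
    (hf' : HasDerivAt f f' (angle L p.1)) (hg' : HasDerivAt g g' (angle L p.1))
    (v : TangentSpace (torusModel n) p) :
    mvfderiv (torusModel n) (torusMap n L f g) p v =
      join n (f' * angleDeriv L p v,
        g (angle L p.1) • sphereDeriv p v + (g' * angleDeriv L p v) • (p.2 : EuclideanSpace ℝ (Fin n))) := by
  rw [torusMap_eq hf hg p.1]
  rw [← localAngle_self] at hf' hg' ⊢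
  obtain ⟨D, hD, hDv⟩ := exists_hasFDerivAt_sweep (n := n) hf' hg' p.2
  have h1 := (contMDiffAt_localAngle_fst L p).mdifferentiableAt (by simp)
  have h2 := (contMDiffAt_coe_snd p).mdifferentiableAt (by simp)
  rw [mvfderiv_comp_hasFDerivAt (f := fun q : Torus n => (localAngle L p.1 q.1,
    (q.2 : EuclideanSpace ℝ (Fin n)))) hD (((contMDiffAt_localAngle_fst L p).prodMk_space
    (contMDiffAt_coe_snd p)).mdifferentiableAt (by simp)), mvfderiv_prodMk_space h1 h2, hDv]
  have e1 : mvfderiv (torusModel n) (fun q : Torus n => localAngle L p.1 q.1) p v =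
      angleDeriv L p v := by
    have h := (((contMDiffAt_localAngle L p.1).mdifferentiableAt (by simp)).hasMFDerivAt.comp p
      (hasMFDerivAt_fst (I := 𝓡 1) (I' := 𝓡 (n - 1)) p)).mfderiv
    have h' : mfderiv (torusModel n) 𝓘(ℝ, ℝ) (fun q : Torus n => localAngle L p.1 q.1) p v =
      mfderiv (𝓡 1) 𝓘(ℝ, ℝ) (localAngle L p.1) p.1 v.1 := by
      rw [show (fun q : Torus n => localAngle L p.1 q.1) = localAngle L p.1 ∘ Prod.fst from rfl, h]
      rfl
    exact h'
  have e2 : mvfderiv (torusModel n) (fun q : Torus n => (q.2 : EuclideanSpace ℝ (Fin n))) p v =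
      sphereDeriv p v := by
    have hs : MDifferentiableAt (𝓡 (n - 1)) 𝓘(ℝ, EuclideanSpace ℝ (Fin n))
        (Subtype.val : Metric.sphere (0 : EuclideanSpace ℝ (Fin n)) 1 → EuclideanSpace ℝ (Fin n)) p.2 :=
      (contMDiffAt_coe p.2).mdifferentiableAt (by simp)
    have h := (hs.hasMFDerivAt.comp p (hasMFDerivAt_snd (I := 𝓡 1) (I' := 𝓡 (n - 1)) p)).mfderiv
    have h' : mfderiv (torusModel n) 𝓘(ℝ, EuclideanSpace ℝ (Fin n))
        (fun q : Torus n => (q.2 : EuclideanSpace ℝ (Fin n))) p v =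
      mfderiv (𝓡 (n - 1)) 𝓘(ℝ, EuclideanSpace ℝ (Fin n))
        (Subtype.val : Metric.sphere (0 : EuclideanSpace ℝ (Fin n)) 1 → EuclideanSpace ℝ (Fin n)) p.2 v.2 := by
      rw [show (fun q : Torus n => (q.2 : EuclideanSpace ℝ (Fin n))) = Subtype.val ∘ Prod.snd from rfl, h]
      rfl
    exact h'
  rw [e1, e2]

lemma inner_coe_sphereDeriv (p : Torus n) (v : TangentSpace (torusModel n) p) :
    inner ℝ (p.2 : EuclideanSpace ℝ (Fin n)) (sphereDeriv p v) = 0 := by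
  have h := range_mvfderiv_subtypeVal (n := n - 1) p.2
  have h2 : sphereDeriv p v ∈ (Submodule.span ℝ {(p.2 : EuclideanSpace ℝ (Fin n))})ᗮ := by
    rw [← h]
    exact ⟨v.2, rfl⟩
  exact (Submodule.mem_orthogonal_singleton_iff_inner_right).1 h2

lemma eq_zero_of_angleDeriv_sphereDeriv {L : ℝ} (hL : 0 < L) (p : Torus n)
    (v : TangentSpace (torusModel n) p) (h1 : angleDeriv L p v = 0) (h2 : sphereDeriv p v = 0) :
    v = 0 :=
  Prod.ext ((injective_iff_map_eq_zero _).1 (mvfderiv_localAngle_injective hL p.1) v.1 h1)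
    ((injective_iff_map_eq_zero _).1 (injective_mvfderiv_subtypeVal_sphere (n := n - 1) p.2) v.2 h2)

end LambdaHypersurface
end

/-! ### Embeddedness, symmetry and mean curvature. -/

noncomputable section

namespace LambdaHypersurface

open Set Filter Real

/-! ### Rotations -/

section Rotation

variable {n : ℕ}

lemma rotate_apply_zero (A : Matrix.specialOrthogonalGroup (Fin n) ℝ) (q : Ambient n) :
    rotate A q 0 = q 0 := rfl

lemma axisDist_sq (q : Ambient n) :
    axisDist q ^ 2 = (fun i : Fin n => q i.succ) ⬝ᵥ (fun i : Fin n => q i.succ) := by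
  rw [axisDist, EuclideanSpace.real_norm_sq_eq]
  simp [dotProduct, sq]

lemma axisDist_rotate (A : Matrix.specialOrthogonalGroup (Fin n) ℝ) (q : Ambient n) :
    axisDist (rotate A q) = axisDist q := by
  have h0 : ∀ q : Ambient n, 0 ≤ axisDist q := fun q => norm_nonneg _
  rw [← sq_eq_sq₀ (h0 _) (h0 _), axisDist_sq, axisDist_sq]
  have hA : (A : Matrix (Fin n) (Fin n) ℝ).transpose * (A : Matrix (Fin n) (Fin n) ℝ) = 1 :=
    (Matrix.mem_orthogonalGroup_iff' (Fin n) ℝ).1 (Matrix.mem_specialOrthogonalGroup_iff.1 A.2).1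
  have e : (fun i : Fin n => rotate A q i.succ) =
      (A : Matrix (Fin n) (Fin n) ℝ).mulVec (fun i : Fin n => q i.succ) := rfl
  rw [e, Matrix.dotProduct_mulVec, Matrix.vecMul_mulVec, hA, Matrix.vecMul_one]

lemma rotate_rotate_inv (A : Matrix.specialOrthogonalGroup (Fin n) ℝ) (q : Ambient n) :
    rotate A (rotate A⁻¹ q) = q := by
  have hA : (A : Matrix (Fin n) (Fin n) ℝ) * ((A⁻¹ : Matrix.specialOrthogonalGroup (Fin n) ℝ) :
      Matrix (Fin n) (Fin n) ℝ) = 1 := by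
    rw [← Submonoid.coe_mul, mul_inv_cancel, Submonoid.coe_one]
  ext i
  refine Fin.cases rfl (fun j => ?_) i
  change ((A : Matrix (Fin n) (Fin n) ℝ).mulVec
    (((A⁻¹ : Matrix.specialOrthogonalGroup (Fin n) ℝ) : Matrix (Fin n) (Fin n) ℝ).mulVec
      fun i => q i.succ)) j = q j.succ
  rw [Matrix.mulVec_mulVec, hA, Matrix.one_mulVec]

lemma isRotationallyInvariant_of_axisDist {P : ℝ → ℝ → Prop} :
    IsRotationallyInvariant {q : Ambient n | P (q 0) (axisDist q)} := by
  intro A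
  ext q
  constructor
  · rintro ⟨p, hp, rfl⟩
    rwa [mem_ofPred_eq, rotate_apply_zero, axisDist_rotate]
  · intro hq
    refine ⟨rotate A⁻¹ q, ?_, rotate_rotate_inv A q⟩
    rwa [mem_ofPred_eq, rotate_apply_zero, axisDist_rotate]

end Rotation

/-! ### The angle -/

section Angle

variable {L : ℝ}

lemma angle_mem_Ioc (hL : 0 < L) (z : Circle) : angle L z ∈ Ioc (-L) L := by
  have hpi := pi_pos
  have h1 := Complex.neg_pi_lt_arg z
  have h2 := Complex.arg_le_pi z
  rw [angle, div_mul_eq_mul_div, mem_Ioc, lt_div_iff₀ hpi, div_le_iff₀ hpi]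
  constructor <;> nlinarith

lemma exists_angle (hL : 0 < L) {t : ℝ} (ht : t ∈ Ioc (-L) L) : ∃ z : Circle, angle L z = t := by
  have hpi := pi_pos
  refine ⟨Circle.exp (π / L * t), ?_⟩
  rw [angle, Circle.arg_exp]
  · field_simp
  · rw [div_mul_eq_mul_div, lt_div_iff₀ hL]; nlinarith [ht.1]
  · rw [div_mul_eq_mul_div, div_le_iff₀ hL]; nlinarith [ht.2]

lemma angle_injective (hL : 0 < L) : Function.Injective (angle L) := by
  intro z w h
  have : 0 < L / π := div_pos hL pi_pos
  exact Circle.injective_arg (mul_left_cancel₀ this.ne' h)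

end Angle

/-- A tangential endomorphism acting by scalars on the two factors. -/
lemma exists_diagonal {n : ℕ} [NeZero n] {L : ℝ} (p : Torus n) (a b : ℝ) :
    ∃ A : TangentSpace (torusModel n) p →ₗ[ℝ] TangentSpace (torusModel n) p,
      (∀ v, angleDeriv L p (A v) = a * angleDeriv L p v) ∧
      (∀ v, sphereDeriv p (A v) = b • sphereDeriv p v) ∧
      LinearMap.trace ℝ (TangentSpace (torusModel n) p) A = a + (n - 1 : ℕ) * b := by
  -- The tangent space of the product is by definition this product of model spaces, on which the
  -- trace of a block scalar map is computed.
  let A : (EuclideanSpace ℝ (Fin 1) × EuclideanSpace ℝ (Fin (n - 1))) →ₗ[ℝ]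
      (EuclideanSpace ℝ (Fin 1) × EuclideanSpace ℝ (Fin (n - 1))) :=
    LinearMap.prodMap (a • LinearMap.id) (b • LinearMap.id)
  have hA : LinearMap.trace ℝ _ A = a + (n - 1 : ℕ) * b := by
    rw [LinearMap.trace_prodMap', map_smul, map_smul, LinearMap.trace_id, LinearMap.trace_id,
      finrank_euclideanSpace_fin, finrank_euclideanSpace_fin]
    simp only [Nat.cast_one, smul_eq_mul]
    ring
  refine ⟨A, fun v => ?_, fun v => ?_, hA⟩
  · exact (mvfderiv (𝓡 1) (localAngle L p.1) p.1).map_smul a v.1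
  · exact (mvfderiv (𝓡 (n - 1)) (Subtype.val : Metric.sphere (0 : EuclideanSpace ℝ (Fin n)) 1 →
      EuclideanSpace ℝ (Fin n)) p.2).map_smul b v.2

namespace ClosedProfile

variable {n : ℕ} {m : ℕ} {lam δ L : ℝ} {x r θ : ℝ → ℝ}

lemma range_torusMap (h : ClosedProfile m lam δ L x r θ) :
    range (torusMap n L x r) =
      {q : Ambient n | ∃ t ∈ Ioc (-L) L, q 0 = x t ∧ axisDist q = r t} := by
  ext q
  constructor
  · rintro ⟨p, rfl⟩
    refine ⟨angle L p.1, angle_mem_Ioc h.L_pos _, rfl, ?_⟩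
    rw [torusMap, sweep, axisDist_join, norm_smul, norm_eq_of_mem_sphere, mul_one, Real.norm_eq_abs,
      abs_of_pos (h.r_pos _)]
  · rintro ⟨t, ht, h0, hd⟩
    obtain ⟨z, hz⟩ := exists_angle h.L_pos ht
    obtain ⟨v, hq, hv⟩ := join_surj q
    have hr := h.r_pos t
    have hv' : ‖(r t)⁻¹ • v‖ = 1 := by
      rw [norm_smul, ← hv, hd, norm_inv, Real.norm_eq_abs, abs_of_pos hr, inv_mul_cancel₀ hr.ne']
    refine ⟨(z, ⟨(r t)⁻¹ • v, mem_sphere_zero_iff_norm.2 hv'⟩), ?_⟩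
    rw [hq, torusMap, sweep]
    simp only [hz, smul_inv_smul₀ hr.ne', h0]

lemma periodic_x (h : ClosedProfile m lam δ L x r θ) : Function.Periodic x (2 * L) := h.x_add
lemma periodic_r (h : ClosedProfile m lam δ L x r θ) : Function.Periodic r (2 * L) := h.r_add
lemma periodic_cos (h : ClosedProfile m lam δ L x r θ) :
    Function.Periodic (fun t => cos (θ t)) (2 * L) := fun t => by simp [h.θ_add]
lemma periodic_neg_sin (h : ClosedProfile m lam δ L x r θ) :
    Function.Periodic (fun t => -sin (θ t)) (2 * L) := fun t => by simp [h.θ_add]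

lemma torusMap_injective (h : ClosedProfile m lam δ L x r θ) :
    Function.Injective (torusMap n L x r) := by
  intro p q hpq
  have hr : ∀ p : Torus n, axisDist (torusMap n L x r p) = r (angle L p.1) := fun p => by
    rw [torusMap, sweep, axisDist_join, norm_smul, norm_eq_of_mem_sphere, mul_one, Real.norm_eq_abs,
      abs_of_pos (h.r_pos _)]
  have h1 := join_injective hpq
  have h2 : r (angle L p.1) = r (angle L q.1) := by rw [← hr, hpq, hr]
  have h3 := h.injOn (angle_mem_Ioc h.L_pos _) (angle_mem_Ioc h.L_pos _) (congrArg Prod.fst h1) h2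
  have h4 : r (angle L p.1) • (p.2 : EuclideanSpace ℝ (Fin n)) = r (angle L q.1) • (q.2 : _) :=
    congrArg Prod.snd h1
  rw [← h2] at h4
  exact Prod.ext (angle_injective h.L_pos h3)
    (Subtype.ext (smul_right_injective _ (h.r_pos _).ne' h4))

variable [NeZero n]

lemma isTorusEmbedding (h : ClosedProfile m lam δ L x r θ) :
    IsTorusEmbedding (torusMap n L x r) where
  contMDiff := contMDiff_torusMap h.periodic_x h.periodic_r h.contDiff.1 h.contDiff.2.1
  immersion p := by
    rw [injective_iff_map_eq_zero]
    intro v hv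
    rw [mvfderiv_torusMap h.periodic_x h.periodic_r p (h.dx _) (h.dr _)] at hv
    have h0 := join_injective (hv.trans (map_zero (join n)).symm)
    have h1 : cos (θ (angle L p.1)) * angleDeriv L p v = 0 := congrArg Prod.fst h0
    have h2 : r (angle L p.1) • sphereDeriv p v +
        (sin (θ (angle L p.1)) * angleDeriv L p v) • (p.2 : EuclideanSpace ℝ (Fin n)) = 0 :=
      congrArg Prod.snd h0
    have h3 : sin (θ (angle L p.1)) * angleDeriv L p v = 0 := by
      have := congrArg (fun w => inner ℝ (p.2 : EuclideanSpace ℝ (Fin n)) w) h2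
      simpa [inner_add_right, real_inner_smul_right, inner_coe_sphereDeriv] using this
    have ha : angleDeriv L p v = 0 := by
      have := sin_sq_add_cos_sq (θ (angle L p.1))
      generalize sin (θ (angle L p.1)) = s at *
      generalize cos (θ (angle L p.1)) = c at *
      linear_combination (-angleDeriv L p v) * this + s * h3 + c * h1
    rw [ha, mul_zero, zero_smul, add_zero] at h2
    exact eq_zero_of_angleDeriv_sphereDeriv h.L_pos p v ha
      ((smul_eq_zero.1 h2).resolve_left (h.r_pos _).ne')
  embedding :=
    ((contMDiff_torusMap h.periodic_x h.periodic_r h.contDiff.1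
      h.contDiff.2.1).continuous.isClosedEmbedding h.torusMap_injective).isEmbedding

/-- The normal is `(-sin θ, cos θ α)`. The principal curvatures are the curvature of the profile,
once, and `-cos θ / r` on the sphere directions, `m` times. -/
lemma hasMeanCurvatureAt (h : ClosedProfile m lam δ L x r θ) (hn : n = m + 1) (p : Torus n) :
    HasMeanCurvatureAt (torusMap n L x r) (torusMap n L (fun t => -sin (θ t)) fun t => cos (θ t)) p
      (turn m lam (x (angle L p.1)) (r (angle L p.1)) (θ (angle L p.1)) -
        m * (cos (θ (angle L p.1)) / r (angle L p.1))) := by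
  set t := angle L p.1 with ht
  set κ := turn m lam (x t) (r t) (θ t) with hκ
  have hr := (h.r_pos t).ne'
  obtain ⟨A, h1, h2, h3⟩ := exists_diagonal (L := L) p κ (-(cos (θ t) / r t))
  refine ⟨A, fun v => ?_, ?_⟩
  · rw [mvfderiv_torusMap h.periodic_x h.periodic_r p (h.dx _) (h.dr _),
      mvfderiv_torusMap h.periodic_neg_sin h.periodic_cos p (h.dθ _).sin.neg (h.dθ _).cos, h1 v, h2 v,
      ← map_neg]
    congr 1
    refine Prod.ext ?_ ?_
    · simp only [← ht, ← hκ, Prod.fst_neg]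
      ring
    · simp only [← ht, ← hκ, Prod.snd_neg]
      rw [smul_smul, mul_neg, mul_div_cancel₀ _ hr]
      module
  · rw [h3, hn, Nat.add_sub_cancel]
    ring

end ClosedProfile

end LambdaHypersurface
end

/-! ### The region bounded by the torus and the inward normal. -/

noncomputable section

namespace LambdaHypersurface

open Set Filter Real

namespace ClosedProfile

variable {n : ℕ} {m : ℕ} {lam δ L : ℝ} {x r θ : ℝ → ℝ}

/-- The open region bounded by the torus. -/
def region (n : ℕ) (L : ℝ) (x r : ℝ → ℝ) : Set (Ambient n) :=
  {q | ∃ s ∈ Ioo 0 L, axisDist q = r s ∧ |q 0| < x s}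

def closedRegion (n : ℕ) (L : ℝ) (x r : ℝ → ℝ) : Set (Ambient n) :=
  {q | ∃ s ∈ Icc 0 L, axisDist q = r s ∧ |q 0| ≤ x s}

lemma isOpen_region (h : ClosedProfile m lam δ L x r θ) : IsOpen (region n L x r) := by
  rw [isOpen_iff_mem_nhds]
  rintro q ⟨s, hs, hd, hx⟩
  obtain ⟨c, hc1, hc2⟩ := exists_between hx
  have hev : ∀ᶠ t in 𝓝 s, c < x t ∧ t ∈ Ioo 0 L :=
    ((h.dx s).continuousAt.eventually (lt_mem_nhds hc2)).and (isOpen_Ioo.mem_nhds hs)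
  obtain ⟨ε, hε, hball⟩ := Metric.eventually_nhds_iff.1 hev
  have hmem : ∀ t ∈ Icc (s - ε / 2) (s + ε / 2), c < x t ∧ t ∈ Ioo 0 L := fun t ht =>
    hball (by rw [Real.dist_eq, abs_lt]; constructor <;> linarith [ht.1, ht.2])
  have ha := (hmem (s - ε / 2) ⟨le_rfl, by linarith⟩).2
  have hb := (hmem (s + ε / 2) ⟨by linarith, le_rfl⟩).2
  have hra : r (s - ε / 2) < axisDist q := hd ▸ h.arc.r_strictMono (Ioo_subset_Icc_self ha)
    (Ioo_subset_Icc_self hs) (by linarith)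
  have hrb : axisDist q < r (s + ε / 2) := hd ▸ h.arc.r_strictMono (Ioo_subset_Icc_self hs)
    (Ioo_subset_Icc_self hb) (by linarith)
  have h0 : Continuous fun q : Ambient n => |q 0| := by fun_prop
  filter_upwards [continuous_axisDist.continuousAt.eventually (lt_mem_nhds hra),
    continuous_axisDist.continuousAt.eventually (gt_mem_nhds hrb),
    h0.continuousAt.eventually (gt_mem_nhds hc1)] with p h1 h2 h3
  obtain ⟨t, ht, hrt⟩ := intermediate_value_Icc (by linarith : s - ε / 2 ≤ s + ε / 2)
    (fun t _ => (h.dr t).continuousAt.continuousWithinAt) ⟨h1.le, h2.le⟩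
  exact ⟨t, (hmem t ht).2, hrt.symm, h3.trans (hmem t ht).1⟩

/-- The set is the projection of a closed set along the compact factor `[0, L]`. -/
lemma isClosed_closedRegion (h : ClosedProfile m lam δ L x r θ) :
    IsClosed (closedRegion n L x r) := by
  have hx : Continuous x := h.contDiff.1.continuous
  have hr : Continuous r := h.contDiff.2.1.continuous
  have hc : IsClosed {p : Icc (0 : ℝ) L × Ambient n | axisDist p.2 = r p.1 ∧ |p.2 0| ≤ x p.1} := by
    refine IsClosed.inter (isClosed_eq (continuous_axisDist.comp continuous_snd)
      (hr.comp (continuous_subtype_val.comp continuous_fst))) (isClosed_le ?_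
      (hx.comp (continuous_subtype_val.comp continuous_fst)))
    fun_prop
  have := isClosedMap_snd_of_compactSpace _ hc
  convert this using 1
  ext q
  constructor
  · rintro ⟨s, hs, h'⟩
    exact ⟨(⟨s, hs⟩, q), h', rfl⟩
  · rintro ⟨⟨s, q'⟩, h', rfl⟩
    exact ⟨s, s.2, h'⟩

lemma isBounded_region (h : ClosedProfile m lam δ L x r θ) :
    Bornology.IsBounded (region n L x r) := by
  refine isBounded_iff_forall_norm_le.2 ⟨L + (δ + L), ?_⟩
  rintro q ⟨s, hs, hd, hx⟩
  have hs' := Ioo_subset_Icc_self hs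
  have h1 := norm_le_axisDist q
  have h2 := h.arc.toTraj.x_le hs'
  have h3 := h.arc.toTraj.r_le hs'
  linarith [hs.2]

lemma closedRegion_eq (h : ClosedProfile m lam δ L x r θ) :
    closedRegion n L x r = region n L x r ∪ range (torusMap n L x r) := by
  have hL := h.L_pos
  rw [h.range_torusMap]
  ext q
  constructor
  · rintro ⟨s, hs, hd, hx⟩
    have hxs := h.arc.x_nonneg h.x_end.ge hs
    rcases hx.lt_or_eq with hlt | he
    · refine Or.inl ⟨s, ⟨lt_of_le_of_ne hs.1 fun h0 => ?_, lt_of_le_of_ne hs.2 fun h0 => ?_⟩, hd, hlt⟩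
      · rw [← h0, h.arc.x_zero] at hlt
        exact absurd hlt (not_lt.2 (abs_nonneg _))
      · rw [h0, h.x_end] at hlt
        exact absurd hlt (not_lt.2 (abs_nonneg _))
    · right
      rcases abs_eq hxs |>.1 he with h1 | h1
      · exact ⟨s, ⟨by linarith [hs.1], hs.2⟩, h1, hd⟩
      rcases hs.2.lt_or_eq with h2 | h2
      · exact ⟨-s, ⟨by linarith, by linarith [hs.1]⟩, by rw [h.x_neg, h1], by rw [h.r_neg, hd]⟩
      · refine ⟨s, ⟨by linarith [hs.1], hs.2⟩, ?_, hd⟩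
        rw [h1, h2, h.x_end, neg_zero]
  · rintro (⟨s, hs, hd, hx⟩ | ⟨t, ht, h0, hd⟩)
    · exact ⟨s, Ioo_subset_Icc_self hs, hd, hx.le⟩
    · have habs : |t| ≤ L := abs_le.2 ⟨ht.1.le, ht.2⟩
      exact ⟨|t|, ⟨abs_nonneg t, habs⟩, by rw [hd, h.r_abs], by rw [h0, h.abs_x habs]⟩

lemma region_disjoint (h : ClosedProfile m lam δ L x r θ) :
    Disjoint (region n L x r) (range (torusMap n L x r)) := by
  rw [disjoint_left]
  rintro q ⟨s, hs, hd, hx⟩ hq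
  rw [h.range_torusMap] at hq
  obtain ⟨t, ht, h0, hd'⟩ := hq
  have habs : |t| ≤ L := abs_le.2 ⟨ht.1.le, ht.2⟩
  have he : s = |t| := h.arc.r_strictMono.injOn (Ioo_subset_Icc_self hs) ⟨abs_nonneg t, habs⟩
    (by rw [h.r_abs, ← hd, hd'])
  rw [h0, h.abs_x habs, he] at hx
  exact lt_irrefl _ hx

/-- The region is open and its union with the torus is closed. A connected subset of the complement
of the torus that meets the region therefore stays in it, and the region is bounded. -/
lemma region_subset_inside (h : ClosedProfile m lam δ L x r θ) :
    region n L x r ⊆ inside (range (torusMap n L x r)) := by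
  intro q hq
  have hnot : q ∉ range (torusMap n L x r) := disjoint_left.1 h.region_disjoint hq
  refine ⟨hnot, h.isBounded_region.subset ?_⟩
  refine IsPreconnected.subset_left_of_subset_union h.isOpen_region
    h.isClosed_closedRegion.isOpen_compl (v := (closedRegion n L x r)ᶜ) ?_ ?_ ?_
    isPreconnected_connectedComponentIn
  · rw [h.closedRegion_eq]
    exact disjoint_compl_right.mono_left subset_union_left
  · intro p hp
    have hp' := connectedComponentIn_subset _ _ hp
    rw [h.closedRegion_eq]
    by_cases hpr : p ∈ region n L x r
    · exact Or.inl hpr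
    · exact Or.inr fun hmem => hmem.elim hpr hp'
  · exact ⟨q, mem_connectedComponentIn hnot, hq⟩

/-- The normal `(-sin θ, cos θ)` points into the region bounded by the profile curve. -/
lemma eventually_normal (h : ClosedProfile m lam δ L x r θ) {t : ℝ} (ht : t ∈ Icc 0 L) :
    ∀ᶠ τ : ℝ in 𝓝[>] 0, ∃ s ∈ Ioo 0 L, r t + τ * cos (θ t) = r s ∧
      |x t + τ * -sin (θ t)| < x s := by
  have hL := h.L_pos
  have hθ := h.arc.θ_mem_Icc ht
  have hend : ∀ b ∈ Ioo (r 0) (r L), ∃ s ∈ Ioo 0 L, b = r s := fun b hb => by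
    obtain ⟨s, hs, hrs⟩ := intermediate_value_Ioo hL.le h.arc.continuousOn_r hb
    exact ⟨s, hs, hrs.symm⟩
  have hr0L : r 0 < r L := h.arc.r_strictMono h.arc.zero_mem h.arc.end_mem hL
  -- At the two ends the normal is parallel to the `r`-axis and points to radii strictly between `r
  -- 0` and `r L`, where the profile has `x > 0`.
  rcases ht.1.eq_or_lt with h0 | h0
  · subst h0
    filter_upwards [Ioo_mem_nhdsGT (sub_pos.2 hr0L)] with τ hτ
    obtain ⟨s, hs, hrs⟩ := hend (r 0 + τ) ⟨by linarith [hτ.1], by linarith [hτ.2]⟩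
    refine ⟨s, hs, by rw [h.arc.θ_zero, cos_zero, mul_one, hrs], ?_⟩
    simpa [h.arc.θ_zero, h.arc.x_zero] using h.x_pos hs
  rcases ht.2.eq_or_lt with h1 | h1
  · subst h1
    filter_upwards [Ioo_mem_nhdsGT (sub_pos.2 hr0L)] with τ hτ
    obtain ⟨s, hs, hrs⟩ := hend (r t - τ) ⟨by linarith [hτ.2], by linarith [hτ.1]⟩
    refine ⟨s, hs, by rw [h.θ_end, cos_pi, mul_neg_one, ← sub_eq_add_neg, hrs], ?_⟩
    simpa [h.θ_end, h.x_end] using h.x_pos hs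
  set S := sin (θ t) with hS
  set c := cos (θ t) with hc
  have hS0 : 0 < S := h.arc.sin_pos ⟨h0, h1⟩
  have hev : ∀ᶠ s in 𝓝 t, s ∈ Ioo 0 L ∧ S / 2 < sin (θ s) ∧ |sin (θ t - θ s)| < S / 4 := by
    have hcont := (h.dθ t).continuousAt
    have c1 : ContinuousAt (fun s => sin (θ s)) t := continuous_sin.continuousAt.comp hcont
    have c2 : ContinuousAt (fun s => |sin (θ t - θ s)|) t :=
      (continuous_sin.continuousAt.comp (continuousAt_const.sub hcont)).abs
    have c0 : ∀ᶠ s in 𝓝 t, s ∈ Ioo 0 L := isOpen_Ioo.mem_nhds ⟨h0, h1⟩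
    refine c0.and ((c1.eventually (lt_mem_nhds ?_)).and (c2.eventually (gt_mem_nhds ?_)))
    · linarith
    · simp only [sub_self, sin_zero, abs_zero]
      linarith
  obtain ⟨ε, hε, hball⟩ := Metric.eventually_nhds_iff.1 hev
  have hmem : ∀ s ∈ Icc (t - ε / 2) (t + ε / 2), s ∈ Ioo 0 L ∧ S / 2 < sin (θ s) ∧
      |sin (θ t - θ s)| < S / 4 := fun s hs =>
    hball (by rw [Real.dist_eq, abs_lt]; constructor <;> linarith [hs.1, hs.2])
  have htm : t ∈ Icc (t - ε / 2) (t + ε / 2) := ⟨by linarith, by linarith⟩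
  have ha := (hmem (t - ε / 2) ⟨le_rfl, by linarith⟩).1
  have hb := (hmem (t + ε / 2) ⟨by linarith, le_rfl⟩).1
  have hra : r (t - ε / 2) < r t := h.arc.r_strictMono (Ioo_subset_Icc_self ha) ht (by linarith)
  have hrb : r t < r (t + ε / 2) := h.arc.r_strictMono ht (Ioo_subset_Icc_self hb) (by linarith)
  have hxt : 0 < x t := h.x_pos ⟨h0, h1⟩
  have hmin : 0 < min (x t) (min (r t - r (t - ε / 2)) (r (t + ε / 2) - r t)) :=
    lt_min hxt (lt_min (by linarith) (by linarith))
  filter_upwards [Ioo_mem_nhdsGT hmin] with τ hτ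
  have hτ0 : 0 < τ := hτ.1
  obtain ⟨hτ1, hτ2, hτ3⟩ : τ < x t ∧ τ < r t - r (t - ε / 2) ∧ τ < r (t + ε / 2) - r t := by
    simpa using hτ.2
  have hc1 := cos_le_one (θ t)
  have hc2 := neg_one_le_cos (θ t)
  have hS1 : S ≤ 1 := sin_le_one (θ t)
  rw [← hc] at hc1 hc2
  obtain ⟨s, hs, hrs⟩ := intermediate_value_Icc (by linarith : t - ε / 2 ≤ t + ε / 2)
    (fun t _ => (h.dr t).continuousAt.continuousWithinAt)
    (show r t + τ * c ∈ Icc (r (t - ε / 2)) (r (t + ε / 2)) by constructor <;> nlinarith)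
  refine ⟨s, (hmem s hs).1, hrs.symm, ?_⟩
  -- the profile rises, and `S x - c r` is almost constant, between `s` and `t`
  have hconv := convex_Icc (𝕜 := ℝ) (t - ε / 2) (t + ε / 2)
  have hlen : |s - t| * (S / 2) ≤ τ := by
    have h2 : S / 2 * |s - t| ≤ |r s - r t| := by
      have hmono : MonotoneOn (fun u => r u - S / 2 * u) (Icc (t - ε / 2) (t + ε / 2)) := by
        refine monotoneOn_of_hasDerivWithinAt_nonneg hconv
          (fun u _ => ((h.dr u).sub ((hasDerivAt_id u).const_mul (S / 2))).continuousAt.continuousWithinAt)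
          (fun u _ => ((h.dr u).sub ((hasDerivAt_id u).const_mul (S / 2))).hasDerivWithinAt)
          fun u hu => ?_
        linarith [(hmem u (interior_subset hu)).2.1]
      rcases le_total s t with hst | hst
      · have := hmono hs htm hst
        simp only at this
        rw [abs_of_nonpos (by linarith), abs_of_nonpos] <;> nlinarith
      · have := hmono htm hs hst
        simp only at this
        rw [abs_of_nonneg (by linarith), abs_of_nonneg] <;> nlinarith
    have h3 : |r s - r t| ≤ τ := by
      rw [hrs, add_sub_cancel_left, abs_mul, abs_of_pos hτ0]
      exact mul_le_of_le_one_right hτ0.le (abs_le.2 ⟨hc2, hc1⟩)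
    linarith
  have herr : |(S * x s - c * r s) - (S * x t - c * r t)| ≤ S / 4 * |s - t| := by
    have hd : ∀ u ∈ Icc (t - ε / 2) (t + ε / 2), HasDerivWithinAt (fun u => S * x u - c * r u)
        (sin (θ t - θ u)) (Icc (t - ε / 2) (t + ε / 2)) u := fun u _ => by
      refine (((h.dx u).const_mul S).sub ((h.dr u).const_mul c)).hasDerivWithinAt.congr_deriv ?_
      rw [sin_sub]
    have := hconv.norm_image_sub_le_of_norm_hasDerivWithin_le hd
      (fun u hu => (hmem u hu).2.2.le) htm hs
    simpa [Real.norm_eq_abs] using this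
  have hsq : S ^ 2 + c ^ 2 = 1 := sin_sq_add_cos_sq (θ t)
  have h4 := (abs_le.1 herr).1
  -- Moving by `τ` along the normal lowers `S x - c r` by `τ`, whereas along the profile it changes
  -- by at most `τ / 2`. Both points have the same radius, so the profile point lies farther out in
  -- `x`.
  have h5 : S * (x t - τ * S) < S * x s := by
    have e1 : S * x s - c * r s - (S * x t - c * r t) =
        S * x s - S * (x t - τ * S) - τ * (S ^ 2 + c ^ 2) := by rw [hrs]; ring
    rw [e1, hsq] at h4
    linarith
  have h6 := lt_of_mul_lt_mul_left h5 hS0.le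
  have h7 : τ * S ≤ τ := mul_le_of_le_one_right hτ0.le hS1
  rw [abs_of_nonneg (by linarith)]
  linarith

variable [NeZero n]

lemma isInwardUnitNormal (h : ClosedProfile m lam δ L x r θ) :
    IsInwardUnitNormal (torusMap n L x r)
      (torusMap n L (fun t => -sin (θ t)) fun t => cos (θ t)) where
  contMDiff := contMDiff_torusMap h.periodic_neg_sin h.periodic_cos
    (contDiff_sin.comp h.contDiff.2.2).neg (contDiff_cos.comp h.contDiff.2.2)
  unit p := by
    have h1 : ‖torusMap n L (fun t => -sin (θ t)) (fun t => cos (θ t)) p‖ ^ 2 = 1 := by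
      rw [torusMap, sweep, norm_join_sq, norm_smul, norm_eq_of_mem_sphere, mul_one,
        Real.norm_eq_abs, sq_abs, neg_sq, sin_sq_add_cos_sq]
    exact (pow_eq_one_iff_of_nonneg (norm_nonneg _) two_ne_zero).1 h1
  normal p v := by
    rw [mvfderiv_torusMap h.periodic_x h.periodic_r p (h.dx _) (h.dr _), torusMap, sweep, inner_join]
    simp only [inner_add_right, real_inner_smul_left, real_inner_smul_right, inner_coe_sphereDeriv,
      real_inner_self_eq_norm_sq, norm_eq_of_mem_sphere]
    ring
  inward p := by
    have hang := angle_mem_Ioc h.L_pos p.1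
    set t := angle L p.1 with ht
    have habs : |t| ∈ Icc 0 L := ⟨abs_nonneg t, abs_le.2 ⟨hang.1.le, hang.2⟩⟩
    filter_upwards [h.eventually_normal habs] with τ hτ
    obtain ⟨s, hs, hrs, hxs⟩ := hτ
    -- The left half is reduced to the right half by reflection, which preserves radii and `|x|`.
    have hcos : cos (θ |t|) = cos (θ t) := by
      rcases abs_choice t with h1 | h1 <;> rw [h1]
      rw [h.θ_neg, cos_neg]
    have hsin : |x |t| + τ * -sin (θ |t|)| = |x t + τ * -sin (θ t)| := by
      rcases abs_choice t with h1 | h1 <;> rw [h1]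
      rw [h.θ_neg, h.x_neg, sin_neg, ← abs_neg]
      congr 1
      ring
    rw [h.r_abs, hcos] at hrs
    rw [hsin] at hxs
    refine h.region_subset_inside ⟨s, hs, ?_⟩
    have e : torusMap n L x r p + τ • torusMap n L (fun t => -sin (θ t)) (fun t => cos (θ t)) p =
        join n (x t + τ * -sin (θ t), r s • (p.2 : EuclideanSpace ℝ (Fin n))) := by
      rw [torusMap, torusMap, sweep, sweep, ← map_smul, ← map_add, ← hrs]
      congr 1
      refine Prod.ext rfl ?_
      simp only [Prod.smul_mk, Prod.mk_add_mk, ← ht]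
      module
    rw [e, axisDist_join, norm_smul, norm_eq_of_mem_sphere, mul_one, Real.norm_eq_abs,
      abs_of_pos (h.r_pos s), join_apply_zero]
    exact ⟨rfl, hxs⟩

lemma isLambdaHypersurface (h : ClosedProfile m lam δ L x r θ) (hn : n = m + 1) :
    IsLambdaHypersurface lam (torusMap n L x r) := by
  refine ⟨_, h.isInwardUnitNormal, fun p => ⟨_, h.hasMeanCurvatureAt hn p, ?_⟩⟩
  have hr := (h.r_pos (angle L p.1)).ne'
  rw [torusMap, torusMap, sweep, sweep, inner_join]
  simp only [real_inner_smul_left, real_inner_smul_right, real_inner_self_eq_norm_sq,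
    norm_eq_of_mem_sphere, turn]
  ring

lemma exists_mem_Ioc (h : ClosedProfile m lam δ L x r θ) {s : ℝ} (hs : s ∈ Ico 0 (2 * L)) :
    ∃ t ∈ Ioc (-L) L, x t = x s ∧ r t = r s ∧ (t = s ∨ t = s - 2 * L) := by
  have hL := h.L_pos
  rcases le_or_gt s L with hle | hlt
  · exact ⟨s, ⟨by linarith [hs.1], hle⟩, rfl, rfl, Or.inl rfl⟩
  · exact ⟨s - 2 * L, ⟨by linarith, by linarith [hs.2]⟩, by rw [← h.x_add (s - 2 * L), sub_add_cancel],
      by rw [← h.r_add (s - 2 * L), sub_add_cancel], Or.inr rfl⟩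

/-- The closed profile curve generates an embedded torus. -/
theorem isTorusWithProfile (h : ClosedProfile m lam δ L x r θ) (hn : n = m + 1) {Γ : PhaseCurve}
    (hΓ : Γ.IsMaximalSolution n lam δ) (hS : Γ.S = ⊤) (hs₁ : Γ.s₁ = (L : EReal))
    (heq : ∀ s : ℝ, 0 ≤ s → Γ.x s = x s ∧ Γ.r s = r s ∧ Γ.θ s = θ s) :
    IsTorusWithProfile lam δ (torusMap n L x r) := by
  have hL := h.L_pos
  have h2L : 0 ≤ 2 * L := by linarith
  refine ⟨h.isTorusEmbedding, h.isLambdaHypersurface hn, ?_, Γ, L, hΓ, hs₁, ?_, ?_⟩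
  · rw [h.range_torusMap]
    exact isRotationallyInvariant_of_axisDist (P := fun a b => ∃ t ∈ Ioc (-L) L, a = x t ∧ b = r t)
  · refine ⟨by linarith, hS ▸ EReal.coe_lt_top _, ?_, ?_, ?_, ?_⟩
    · rw [(heq _ h2L).1, (heq 0 le_rfl).1, ← h.x_add 0, zero_add]
    · rw [(heq _ h2L).2.1, (heq 0 le_rfl).2.1, ← h.r_add 0, zero_add]
    · rw [(heq _ h2L).2.2, (heq 0 le_rfl).2.2, ← h.θ_add 0, zero_add]
    · intro s hs t ht hst
      simp only [Prod.mk.injEq, (heq s hs.1).1, (heq s hs.1).2.1, (heq t ht.1).1,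
        (heq t ht.1).2.1] at hst
      obtain ⟨s', hs', hxs, hrs, hs''⟩ := h.exists_mem_Ioc hs
      obtain ⟨t', ht', hxt, hrt, ht''⟩ := h.exists_mem_Ioc ht
      have := h.injOn hs' ht' (by rw [hxs, hxt, hst.1]) (by rw [hrs, hrt, hst.2])
      rcases hs'' with rfl | rfl <;> rcases ht'' with rfl | rfl <;>
        linarith [hs.1, hs.2, ht.1, ht.2]
  · rw [h.range_torusMap]
    ext q
    constructor
    · rintro ⟨t, ht, h0, hd⟩
      rcases le_or_gt 0 t with hpos | hneg
      · exact ⟨t, ⟨hpos, by linarith [ht.2]⟩, by rw [h0, (heq t hpos).1], by rw [hd, (heq t hpos).2.1]⟩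
      · have hp : 0 ≤ t + 2 * L := by linarith [ht.1]
        exact ⟨t + 2 * L, ⟨hp, by linarith⟩, by rw [h0, (heq _ hp).1, h.x_add],
          by rw [hd, (heq _ hp).2.1, h.r_add]⟩
    · rintro ⟨s, hs, h0, hd⟩
      rw [(heq s hs.1).1] at h0
      rw [(heq s hs.1).2.1] at hd
      rcases le_or_gt s L with hle | hlt
      · exact ⟨s, ⟨by linarith [hs.1], hle⟩, h0, hd⟩
      · rcases hs.2.eq_or_lt with h2 | h2
        · refine ⟨0, ⟨by linarith, hL.le⟩, ?_, ?_⟩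
          · rw [h0, h2, ← h.x_add 0, zero_add]
          · rw [hd, h2, ← h.r_add 0, zero_add]
        · refine ⟨s - 2 * L, ⟨by linarith, by linarith⟩, ?_, ?_⟩
          · rw [h0, ← h.x_add (s - 2 * L), sub_add_cancel]
          · rw [hd, ← h.r_add (s - 2 * L), sub_add_cancel]

end ClosedProfile

end LambdaHypersurface
end

/-! ### Distances and non-isometry. -/

noncomputable section

namespace LambdaHypersurface

open Set Filter Real

section Curve

variable {E M : Type*} [NormedAddCommGroup E] [NormedSpace ℝ E] {H F : Type*} [TopologicalSpace H]
  [NormedAddCommGroup F] [NormedSpace ℝ F] {I : ModelWithCorners ℝ F H} [TopologicalSpace M]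
  [ChartedSpace H M]

lemma hasDerivAt_comp_curve {f : M → E} {g : ℝ → M} {τ : ℝ}
    (hf : MDifferentiableAt I 𝓘(ℝ, E) f (g τ)) (hg : MDifferentiableAt 𝓘(ℝ, ℝ) I g τ) :
    HasDerivAt (f ∘ g) (mvfderiv I f (g τ) (mfderiv 𝓘(ℝ, ℝ) I g τ (1 : ℝ))) τ := by
  have h : HasFDerivAt (f ∘ g) (show ℝ →L[ℝ] E from
      (mfderiv I 𝓘(ℝ, E) f (g τ)).comp (mfderiv 𝓘(ℝ, ℝ) I g τ)) τ :=
    (hf.hasMFDerivAt.comp τ hg.hasMFDerivAt).hasFDerivAt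
  exact h.hasDerivAt

end Curve

variable {n : ℕ}

lemma hasDerivAt_greatCircle (a w : EuclideanSpace ℝ (Fin n)) (τ : ℝ) :
    HasDerivAt (fun τ : ℝ => cos τ • a + sin τ • w) (-sin τ • a + cos τ • w) τ :=
  ((hasDerivAt_cos τ).smul_const a).add ((hasDerivAt_sin τ).smul_const w)

lemma norm_greatCircle {a w : EuclideanSpace ℝ (Fin n)} (ha : ‖a‖ = 1) (hw : ‖w‖ = 1)
    (haw : inner ℝ a w = (0 : ℝ)) {p q : ℝ} (hpq : p ^ 2 + q ^ 2 = 1) : ‖p • a + q • w‖ = 1 := by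
  refine (pow_eq_one_iff_of_nonneg (norm_nonneg _) two_ne_zero).1 ?_
  rw [← real_inner_self_eq_norm_sq, inner_add_left, inner_add_right, inner_add_right]
  simp only [real_inner_smul_left, real_inner_smul_right, real_inner_comm a w, haw,
    real_inner_self_eq_norm_sq a, real_inner_self_eq_norm_sq w, ha, hw]
  linarith

/-- The vector `w` is the normalized component of `b` orthogonal to `a`. If `b = ± a` any unit
vector orthogonal to `a` serves, and it exists because `n ≥ 2`. -/
lemma exists_greatCircle (hn : 2 ≤ n) (a b : Metric.sphere (0 : EuclideanSpace ℝ (Fin n)) 1) :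
    ∃ w : EuclideanSpace ℝ (Fin n), ‖w‖ = 1 ∧ inner ℝ (a : EuclideanSpace ℝ (Fin n)) w = 0 ∧
      ∃ φ ∈ Icc 0 π, (b : EuclideanSpace ℝ (Fin n)) =
        cos φ • (a : EuclideanSpace ℝ (Fin n)) + sin φ • w := by
  obtain ⟨a, ha⟩ := a
  obtain ⟨b, hb⟩ := b
  rw [mem_sphere_zero_iff_norm] at ha hb
  simp only
  set k : ℝ := inner ℝ a b with hk
  have hk1 : |k| ≤ 1 := by
    have := abs_real_inner_le_norm a b
    rwa [ha, hb, one_mul] at this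
  have hk2 := abs_le.1 hk1
  have hφ : arccos k ∈ Icc 0 π := ⟨arccos_nonneg k, arccos_le_pi k⟩
  have haa : inner ℝ a a = (1 : ℝ) := by rw [real_inner_self_eq_norm_sq, ha, one_pow]
  set u := b - k • a with hu
  have hau : inner ℝ a u = (0 : ℝ) := by
    rw [hu, inner_sub_right, real_inner_smul_right, haa, ← hk]
    ring
  have hub : b = k • a + u := by rw [hu]; abel
  have hnorm : ‖u‖ = sin (arccos k) := by
    rw [sin_arccos, eq_comm, sqrt_eq_iff_mul_self_eq (by nlinarith) (norm_nonneg _)]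
    have h1 : ‖b‖ ^ 2 = k ^ 2 + ‖u‖ ^ 2 := by
      rw [← real_inner_self_eq_norm_sq b, hub, inner_add_left, inner_add_right, inner_add_right,
        real_inner_smul_left, real_inner_smul_left, real_inner_smul_right, real_inner_smul_right,
        real_inner_comm a u, haa, hau, real_inner_self_eq_norm_sq]
      ring
    rw [hb] at h1
    linarith
  rcases eq_or_ne u 0 with h0 | h0
  · have : Nontrivial ((Submodule.span ℝ {a})ᗮ : Submodule ℝ (EuclideanSpace ℝ (Fin n))) := by
      rw [← Module.finrank_pos_iff (R := ℝ)]
      have h1 := Submodule.finrank_add_finrank_orthogonal (Submodule.span ℝ {a})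
      have h2 := finrank_span_singleton (K := ℝ) (v := a) (by rintro rfl; simp at ha)
      rw [finrank_euclideanSpace_fin, h2] at h1
      omega
    obtain ⟨w, hw⟩ := exists_norm_eq ((Submodule.span ℝ {a})ᗮ : Submodule ℝ (EuclideanSpace ℝ (Fin n)))
      zero_le_one
    refine ⟨w, hw, Submodule.mem_orthogonal_singleton_iff_inner_right.1 w.2, arccos k, hφ, ?_⟩
    rw [← hnorm, h0, norm_zero, zero_smul, cos_arccos hk2.1 hk2.2]
    rw [h0] at hub
    exact hub
  · have h1 := norm_ne_zero_iff.2 h0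
    refine ⟨‖u‖⁻¹ • u, ?_, by rw [real_inner_smul_right, hau, mul_zero], arccos k, hφ, ?_⟩
    · rw [norm_smul, norm_inv, norm_norm, inv_mul_cancel₀ h1]
    · rw [← hnorm, smul_smul, mul_inv_cancel₀ h1, one_smul, cos_arccos hk2.1 hk2.2]
      exact hub

lemma torusMap_exp {L : ℝ} {f g : ℝ → ℝ} (hL : 0 < L) (hf : Function.Periodic f (2 * L))
    (hg : Function.Periodic g (2 * L)) (τ : ℝ) (α : Metric.sphere (0 : EuclideanSpace ℝ (Fin n)) 1) :
    torusMap n L f g (Circle.exp τ, α) = sweep n f g (L / π * τ, α) := by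
  obtain ⟨k, hk⟩ := Circle.exp_eq_exp.1 (Circle.exp_arg (Circle.exp τ))
  have e : angle L (Circle.exp τ) = L / π * τ + k * (2 * L) := by
    rw [angle, hk]
    have := pi_pos
    field_simp
  simp only [torusMap, sweep, e]
  rw [hf.int_mul k, hg.int_mul k]

lemma hasDerivAt_meridian {L : ℝ} {f g : ℝ → ℝ} (hL : 0 < L) (hf : Function.Periodic f (2 * L))
    (hg : Function.Periodic g (2 * L)) {ϑ : ℝ → ℝ} (hf' : ∀ t, HasDerivAt f (cos (ϑ t)) t)
    (hg' : ∀ t, HasDerivAt g (sin (ϑ t)) t) (α : Metric.sphere (0 : EuclideanSpace ℝ (Fin n)) 1)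
    (τ : ℝ) : ∃ e, HasDerivAt (torusMap n L f g ∘ fun τ => (Circle.exp τ, α)) e τ ∧ ‖e‖ ≤ L / π := by
  have hLπ : 0 < L / π := div_pos hL pi_pos
  have e : (torusMap n L f g ∘ fun τ => (Circle.exp τ, α)) =
      fun τ => join n (f (L / π * τ), g (L / π * τ) • (α : EuclideanSpace ℝ (Fin n))) :=
    funext fun τ => torusMap_exp hL hf hg τ α
  rw [e]
  have hl : HasDerivAt (fun τ : ℝ => L / π * τ) (L / π) τ := by
    simpa using (hasDerivAt_id τ).const_mul (L / π)
  have h1 := (hf' (L / π * τ)).comp τ hl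
  have h2 := ((hg' (L / π * τ)).comp τ hl).smul_const (α : EuclideanSpace ℝ (Fin n))
  refine ⟨_, (join n).hasFDerivAt.comp_hasDerivAt τ (h1.prodMk h2), ?_⟩
  refine abs_le_of_sq_le_sq' ?_ hLπ.le |>.2
  rw [norm_join_sq, norm_smul, norm_eq_of_mem_sphere, mul_one, Real.norm_eq_abs, sq_abs]
  have := sin_sq_add_cos_sq (ϑ (L / π * τ))
  simp only [mul_pow]
  rw [← add_mul, add_comm, this, one_mul]

variable [NeZero n]

/-- Curves of bounded speed in `X₂` bound distances of corresponding points of the isometric `X₁`. -/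
lemma norm_sub_le_of_isometry {X₁ X₂ : Torus n → Ambient n}
    (h₁ : ContMDiff (torusModel n) 𝓘(ℝ, Ambient n) ∞ X₁)
    (h₂ : ContMDiff (torusModel n) 𝓘(ℝ, Ambient n) ∞ X₂)
    {Φ : Diffeomorph (torusModel n) (torusModel n) (Torus n) (Torus n) ∞}
    (hΦ : ∀ p (v w : TangentSpace (torusModel n) p),
      inner ℝ (mvfderiv (torusModel n) (X₂ ∘ Φ) p v) (mvfderiv (torusModel n) (X₂ ∘ Φ) p w) =
        inner ℝ (mvfderiv (torusModel n) X₁ p v) (mvfderiv (torusModel n) X₁ p w))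
    {c : ℝ → Torus n} (hc : ContMDiff 𝓘(ℝ, ℝ) (torusModel n) ∞ c) {C : ℝ}
    (hC : ∀ τ, ∃ e, HasDerivAt (X₂ ∘ c) e τ ∧ ‖e‖ ≤ C) (a b : ℝ) :
    ‖X₁ (Φ.symm (c b)) - X₁ (Φ.symm (c a))‖ ≤ C * |b - a| := by
  have hg : ContMDiff 𝓘(ℝ, ℝ) (torusModel n) ∞ (Φ.symm ∘ c) := Φ.symm.contMDiff.comp hc
  have hd : ∀ τ ∈ univ, HasDerivWithinAt (X₁ ∘ Φ.symm ∘ c) (mvfderiv (torusModel n) X₁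
      ((Φ.symm ∘ c) τ) (mfderiv 𝓘(ℝ, ℝ) (torusModel n) (Φ.symm ∘ c) τ (1 : ℝ))) univ τ := fun τ _ =>
    (hasDerivAt_comp_curve (h₁.mdifferentiableAt (by simp))
      (hg.mdifferentiableAt (by simp))).hasDerivWithinAt
  refine convex_univ.norm_image_sub_le_of_norm_hasDerivWithin_le hd (fun τ _ => ?_) (mem_univ a)
    (mem_univ b)
  obtain ⟨e, he, heC⟩ := hC τ
  have h3 := hasDerivAt_comp_curve ((h₂.comp Φ.contMDiff).mdifferentiableAt (by simp))
    (hg.mdifferentiableAt (by simp) (x := τ))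
  -- The pulled back curve has in `X₁` the same speed as `c` has in `X₂`, because the induced
  -- metrics correspond under `Φ`.
  have h4 : (X₂ ∘ Φ) ∘ Φ.symm ∘ c = X₂ ∘ c := by
    funext s
    simp
  rw [h4] at h3
  have h5 := he.unique h3
  refine le_trans (le_of_eq ?_) heC
  rw [h5, @norm_eq_sqrt_real_inner (Ambient n), @norm_eq_sqrt_real_inner (Ambient n)]
  exact congrArg sqrt (hΦ _ _ _).symm

/-- A hypersurface isometric to a torus has diameter at most the intrinsic diameter of the torus. -/
lemma norm_sub_le_of_isometry_torusMap {L : ℝ} {f g : ℝ → ℝ} (hn : 2 ≤ n) (hL : 0 < L)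
    (hf : Function.Periodic f (2 * L)) (hg : Function.Periodic g (2 * L)) (hfs : ContDiff ℝ ∞ f) (hgs : ContDiff ℝ ∞ g) {ϑ : ℝ → ℝ}
    (hf' : ∀ t, HasDerivAt f (cos (ϑ t)) t) (hg' : ∀ t, HasDerivAt g (sin (ϑ t)) t) {R : ℝ}
    (hR : ∀ t, |g t| ≤ R) {X : Torus n → Ambient n}
    (hX : ContMDiff (torusModel n) 𝓘(ℝ, Ambient n) ∞ X) (hiso : AreIsometric X (torusMap n L f g))
    (p q : Torus n) : ‖X p - X q‖ ≤ 2 * L + π * R := by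
  obtain ⟨Φ, hΦ⟩ := hiso
  have hT := contMDiff_torusMap (n := n) hf hg hfs hgs
  -- The images of the two points are joined by an arc along a meridian, of length at most `2 L`,
  -- followed by a great circle arc in a parallel sphere, of length at most `π R`.
  obtain ⟨⟨z₁, a⟩, rfl⟩ := Φ.symm.surjective p
  obtain ⟨⟨z₂, b⟩, rfl⟩ := Φ.symm.surjective q
  have hR0 : 0 ≤ R := (abs_nonneg _).trans (hR 0)
  have h1 := norm_sub_le_of_isometry hX hT hΦ (c := fun τ => (Circle.exp τ, a))
    (contMDiff_circleExp.prodMk contMDiff_const) (hasDerivAt_meridian hL hf hg hf' hg' a)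
    (Complex.arg z₂) (Complex.arg z₁)
  simp only [Circle.exp_arg] at h1
  have h2 : L / π * |Complex.arg z₁ - Complex.arg z₂| ≤ 2 * L := by
    have h3 : |Complex.arg z₁ - Complex.arg z₂| ≤ 2 * π := by
      rw [abs_le]
      constructor <;> linarith [Complex.neg_pi_lt_arg z₁, Complex.neg_pi_lt_arg z₂,
        Complex.arg_le_pi z₁, Complex.arg_le_pi z₂]
    calc L / π * |Complex.arg z₁ - Complex.arg z₂| ≤ L / π * (2 * π) := by
          gcongr
      _ = 2 * L := by
          have := pi_pos
          field_simp
  obtain ⟨w, hw, haw, φ, hφ, hb⟩ := exists_greatCircle hn a b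
  have ha := norm_eq_of_mem_sphere a
  have hmem : ∀ τ : ℝ, cos τ • (a : EuclideanSpace ℝ (Fin n)) + sin τ • w ∈
      Metric.sphere (0 : EuclideanSpace ℝ (Fin n)) 1 := fun τ => by
    rw [mem_sphere_zero_iff_norm]
    exact norm_greatCircle ha hw haw (by rw [add_comm, sin_sq_add_cos_sq])
  have hsmooth : ContMDiff 𝓘(ℝ, ℝ) (𝓡 (n - 1)) ∞ fun τ : ℝ =>
      (⟨_, hmem τ⟩ : Metric.sphere (0 : EuclideanSpace ℝ (Fin n)) 1) := by
    refine ContMDiff.codRestrict_sphere (ContDiff.contMDiff ?_) hmem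
    exact (contDiff_cos.smul contDiff_const).add (contDiff_sin.smul contDiff_const)
  have h4 := norm_sub_le_of_isometry hX hT hΦ (c := fun τ => (z₂, ⟨_, hmem τ⟩)) (C := R)
    (contMDiff_const.prodMk hsmooth) (fun τ => by
      refine ⟨_, (join n).hasFDerivAt.comp_hasDerivAt τ ((hasDerivAt_const τ (f (angle L z₂))).prodMk
        ((hasDerivAt_greatCircle (a : EuclideanSpace ℝ (Fin n)) w τ).const_smul (g (angle L z₂)))), ?_⟩
      refine abs_le_of_sq_le_sq' ?_ hR0 |>.2
      rw [norm_join_sq, norm_smul, norm_greatCircle ha hw haw (by rw [neg_sq, sin_sq_add_cos_sq]),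
        mul_one, Real.norm_eq_abs]
      have := hR (angle L z₂)
      simp only
      nlinarith [abs_nonneg (g (angle L z₂))]) φ 0
  have h0 : (⟨_, hmem 0⟩ : Metric.sphere (0 : EuclideanSpace ℝ (Fin n)) 1) = a := by
    ext1
    simp
  have hφ' : (⟨_, hmem φ⟩ : Metric.sphere (0 : EuclideanSpace ℝ (Fin n)) 1) = b := Subtype.ext hb.symm
  simp only [h0, hφ'] at h4
  have h5 : R * |0 - φ| ≤ π * R := by
    rw [zero_sub, abs_neg, abs_of_nonneg hφ.1, mul_comm]
    exact mul_le_mul_of_nonneg_right hφ.2 hR0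
  have h6 := norm_sub_le_norm_sub_add_norm_sub (X (Φ.symm (z₁, a))) (X (Φ.symm (z₂, a)))
    (X (Φ.symm (z₂, b)))
  exact h6.trans (by linarith)

namespace ClosedProfile

variable {m : ℕ} {lam δ L : ℝ} {x r θ : ℝ → ℝ}

lemma abs_r_le (h : ClosedProfile m lam δ L x r θ) (t : ℝ) : |r t| ≤ δ + L := by
  have hp : 0 < 2 * L := by linarith [h.L_pos]
  obtain ⟨s, hs, hst⟩ := h.periodic_r.exists_mem_Ioc hp t (-L)
  have habs : |s| ∈ Icc 0 L := ⟨abs_nonneg s, abs_le.2 ⟨hs.1.le, by linarith [hs.2]⟩⟩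
  rw [abs_of_pos (h.r_pos t), hst, ← h.r_abs]
  linarith [h.arc.toTraj.r_le habs, habs.2]

/-- The points of the first torus at times `L₁` and `0` with the same `α` lie on `x = 0` at distance
`|r₁ L₁ - δ₁|`, which exceeds the diameter bound coming from the second torus. -/
theorem not_areIsometric (hn : 2 ≤ n) {δ₁ δ₂ L₁ L₂ : ℝ} {x₁ r₁ θ₁ x₂ r₂ θ₂ : ℝ → ℝ}
    (h₁ : ClosedProfile m lam δ₁ L₁ x₁ r₁ θ₁) (h₂ : ClosedProfile m lam δ₂ L₂ x₂ r₂ θ₂)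
    (hlt : 2 * L₂ + π * (δ₂ + L₂) < r₁ L₁ - δ₁) :
    ¬ AreIsometric (torusMap n L₁ x₁ r₁) (torusMap n L₂ x₂ r₂) := fun hiso => by
  have hL := h₁.L_pos
  obtain ⟨p, hp⟩ := exists_angle hL ⟨by linarith, le_refl L₁⟩
  obtain ⟨q, hq⟩ := exists_angle hL (t := 0) ⟨by linarith, hL.le⟩
  obtain ⟨a⟩ : Nonempty (Metric.sphere (0 : EuclideanSpace ℝ (Fin n)) 1) :=
    (NormedSpace.sphere_nonempty.2 zero_le_one).to_subtype
  have h3 := norm_sub_le_of_isometry_torusMap hn h₂.L_pos h₂.periodic_x h₂.periodic_r h₂.contDiff.1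
    h₂.contDiff.2.1 h₂.dx h₂.dr h₂.abs_r_le
    (contMDiff_torusMap h₁.periodic_x h₁.periodic_r h₁.contDiff.1 h₁.contDiff.2.1) hiso (p, a) (q, a)
  have h4 : ‖torusMap n L₁ x₁ r₁ (p, a) - torusMap n L₁ x₁ r₁ (q, a)‖ = |r₁ L₁ - δ₁| := by
    rw [← sq_eq_sq₀ (norm_nonneg _) (abs_nonneg _), torusMap, torusMap, sweep, sweep, ← map_sub,
      norm_join_sq]
    simp only [hp, hq, Prod.mk_sub_mk, h₁.x_end, h₁.arc.x_zero, h₁.arc.r_zero, ← sub_smul]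
    rw [norm_smul, norm_eq_of_mem_sphere, Real.norm_eq_abs]
    ring
  rw [h4] at h3
  linarith [le_abs_self (r₁ L₁ - δ₁)]

end ClosedProfile

end LambdaHypersurface
end

/-! ### Assembly of the theorem. -/

open LambdaHypersurface
theorem theorem1p2 (n : ℕ) [NeZero n] (hn : 2 ≤ n) :
    ∃ c : ℝ, 0 < c ∧
      ∃ δs : ℝ, 0 < δs ∧ δs < Real.sqrt ((n : ℝ) - 1) ∧
        ∀ lam : ℝ, -c < lam → lam < 0 →
          IsType13 n lam δs ∧
          ∃ δ₁ δ₂ : ℝ,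
            IsGLB {δ : ℝ | 0 < δ ∧ δ < δs ∧ IsType11 n lam δ} δ₁ ∧
            IsLUB {δ : ℝ | 0 < δ ∧ δ < δs ∧ IsType11 n lam δ} δ₂ ∧
            δ₁ < δ₂ ∧ IsType12 n lam δ₁ ∧ IsType12 n lam δ₂ ∧
            ∃ X₁ X₂ : Torus n → Ambient n,
              IsTorusWithProfile lam δ₁ X₁ ∧ IsTorusWithProfile lam δ₂ X₂ ∧
              ¬ AreIsometric X₁ X₂ := by
  obtain ⟨m, rfl⟩ : ∃ m, n = m + 1 := ⟨n - 1, by omega⟩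
  have hm : 1 ≤ m := by omega
  obtain ⟨c, hc, δs, hδs0, hδs, H⟩ := exists_closed_profiles hm
  refine ⟨c, hc, δs, hδs0, by simpa using hδs, fun lam hlam hlam0 => ?_⟩
  obtain ⟨hs, δ₁, δ₂, hglb, hlub, hlt, Γ₁, Γ₂, L₁, L₂, ⟨hΓ₁, hL₁, hx₁⟩, ⟨hΓ₂, hL₂, hx₂⟩, hdiam⟩ :=
    H lam hlam hlam0
  obtain ⟨x₁, r₁, θ₁, h₁, hS₁, he₁⟩ := hL₁.exists_closedProfile hΓ₁ hm hx₁
  obtain ⟨x₂, r₂, θ₂, h₂, hS₂, he₂⟩ := hL₂.exists_closedProfile hΓ₂ hm hx₂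
  refine ⟨hs, δ₁, δ₂, hglb, hlub, hlt, hL₁.isType12 hΓ₁ hm hx₁, hL₂.isType12 hΓ₂ hm hx₂, _, _,
    h₁.isTorusWithProfile rfl hΓ₁ hS₁ hL₁.s₁_eq he₁,
    h₂.isTorusWithProfile rfl hΓ₂ hS₂ hL₂.s₁_eq he₂, h₁.not_areIsometric hn h₂ ?_⟩
  rwa [(he₁ L₁ h₁.L_pos.le).2.1] at hdiam
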